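/- Setting. Let $S$ be a finite set of closed non-vertical line segments in $\mathbb R^2$ with pairwise disjoint relative interiors. Assume that four of them, forming the frame $F\subseteq S$, are the sides of a rectangle whose interior contains all segments of $S\setminus F$. Let $s\in S\setminus F$ be disjoint from all other segments of $S$. Visibility. Points $p,q$ see each other if the open segment $pq$ (empty if $p=q$) meets no element of $S$. $V_S(p)$ is the set of points seen from $p$, and $V_S(s)=\bigcup_{p\in s}V_S(p)$. $V_S^+(s)$ is the part of $V_S(s)$ in the closed half-plane above the supporting line of $s$, and $V_S^-(s)=V_S(s)\setminus V_S^+(s)$. Graphs. The edges of the visibility graph are the pairs $uv$ of distinct endpoints of segments of $S$ that see each other, together with the segments of $S$ themselves. The extended visibility graph $\mathit{EVG}(S)$ has in addition, for each directed visibility graph edge $uv$, the extension edge from $v$ in direction $\overrightarrow{uv}$ to the first point $w\neq v$ where it meets an element of $S$ (if the extension is not blocked immediately at $v$ and if there is such a point). The visibility space partition $\mathit{VSP}(S)$ is the planar subdivision induced by the union of the edges of $\mathit{EVG}(S)$ and the segments of $S$; its vertices are the endpoints of the edges of $\mathit{EVG}(S)$ and the crossing points of two such edges, and its edges are the open segments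 of this union between consecutive vertices. Let $m_s$ be the number of edges of $\mathit{VSP}(S)$ that have an endpoint on $s$ and are not contained in $s$. The sweep. An active edge for a viewpoint $p\in s$ is a segment $e=qy$ collinear with $p$, where $q$ is an endpoint of a segment of $S$ that is strictly above the supporting line of $s$ and visible from $p$, $y$ is the first point of a segment $t\in S$ on the ray from $p$ through $q$ beyond $q$, and, near the open segment $qy$, points to the right of $e$ are visible from $p$ and points to the left are not. Let $p_1,\dots,p_{m'}$ be the vertices of $\mathit{VSP}(S)$ on $s$, from left to right. (1) Start: for every $t\in S$ and every maximal open subsegment $xy$ of $t$ that consists of points strictly above the supporting line of $s$ and visible from $p_1$, put the triangle $p_1xy$ into $C_S^+(s)$. Make a list of the active edges (pairs $(q,t)$) present immediately to the right of $p_1$, each with start value $p_1$. (2) At $p_i$, $i=2,\dots,m'$: each listed pair $(q,t)$ such that some edge of $\mathit{EVG}(S)$ going upwards from $p_i$ points towards $q$, and every listed pair if $i=m'$, leaves the list and contributes to $C_S^+(s)$ the triangle with lowest vertex $q$ bounded by the lines through $q$ and $p_i$ and through $q$ and its start value, whose third side lies on $t$. If $i<m'$, the active edges $(q,t)$ present immediately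 to the right of $p_i$ such that some edge of $\mathit{EVG}(S)$ going upwards from $p_i$ points towards $q$ enter the list with start value $p_i$. Let $C_S^-(s)$ be the set of triangles generated by the mirror image of this sweep below $s$, and $C_S(s)=C_S^+(s)\cup C_S^-(s)$. Statement. $C_S^+(s)$ and $C_S^-(s)$ are finite sets of nondegenerate closed triangles. Up to boundary points, they cover exactly $V_S^+(s)$ and $V_S^-(s)$: $$\bigcup C_S^+(s)=\overline{V_S^+(s)},\qquad \bigcup C_S^-(s)=\overline{V_S^-(s)},\qquad \bigcup C_S(s)=\overline{V_S(s)},$$ and the interior of every triangle of $C_S^+(s)$ is contained in $V_S^+(s)$, the interior of every triangle of $C_S^-(s)$ in $V_S^-(s)$. Moreover, $|C_S^+(s)|\le m_s$ and $|C_S^-(s)|\le m_s$, provided that no segment is degenerately aligned as seen from $s$: whenever the supporting line of a segment $t\in S\setminus\{s\}$ meets $s$, it contains no endpoint of a segment of $S\setminus\{s\}$ other than the endpoints of $t$. -/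

import Mathlib

open Set Filter Topology

namespace Visibility

/-- The Euclidean plane, in coordinates. -/
abbrev Plane := ℝ × ℝ

/-- A closed non-vertical line segment, given by its left and its right endpoint. -/
@[ext]
structure Seg where
  left : Plane
  right : Plane
  left_lt_right : left.1 < right.1

namespace Seg

/-- The closed segment as a set of points. -/
def carrier (t : Seg) : Set Plane := segment ℝ t.left t.right

/-- The relative interior of the segment. -/
def inner (t : Seg) : Set Plane := openSegment ℝ t.left t.right

/-- The two endpoints of the segment. -/
def ends (t : Seg) : Set Plane := {t.left, t.right}

/-- The point of the segment with parameter `τ`: `pt 0` is the left endpoint, `pt 1` the right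
endpoint. -/
def pt (t : Seg) (τ : ℝ) : Plane := AffineMap.lineMap t.left t.right τ

end Seg

/-- Orientation of the triple `(o, a, b)`: positive iff `b` lies to the left of the line from `o`
to `a`, negative iff it lies to the right, zero iff the three points are collinear. -/
def cross (o a b : Plane) : ℝ := (a.1 - o.1) * (b.2 - o.2) - (a.2 - o.2) * (b.1 - o.1)

/-- All endpoints of the segments in `S`. -/
def endpoints (S : Set Seg) : Set Plane := {q | ∃ t ∈ S, q ∈ t.ends}

/-- No point of `X` lies on a segment of `S`. -/
def Avoids (S : Set Seg) (X : Set Plane) : Prop := ∀ t ∈ S, Disjoint X t.carrier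

/-- `F` consists of the four sides of a rectangle (with corners `o`, `o + u`, `o + u + v`, `o + v`)
whose interior contains all the other segments of `S`. -/
def IsBoundingFrame (S F : Set Seg) : Prop :=
  F ⊆ S ∧ ∃ o u v : Plane, u ≠ 0 ∧ v ≠ 0 ∧ u.1 * v.1 + u.2 * v.2 = 0 ∧
    Seg.carrier '' F = {segment ℝ o (o + u), segment ℝ (o + u) (o + u + v),
      segment ℝ (o + u + v) (o + v), segment ℝ (o + v) o} ∧
    ∀ t ∈ S \ F, t.carrier ⊆ interior (convexHull ℝ {o, o + u, o + u + v, o + v})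

/-! ### Visibility -/

/-- `p` and `q` see each other with respect to `S`: the open segment `pq` (which is empty if
`p = q`) meets no element of `S`. -/
def Sees (S : Set Seg) (p q : Plane) : Prop := p = q ∨ Avoids S (openSegment ℝ p q)

/-- The visibility region of a point. -/
def pointRegion (S : Set Seg) (p : Plane) : Set Plane := {q | Sees S p q}

/-- The (weak) visibility region of a segment. -/
def region (S : Set Seg) (s : Seg) : Set Plane := ⋃ p ∈ s.carrier, pointRegion S p

/-- The part of the visibility region of `s` in the closed half-plane bounded from below by the
supporting line of `s`. -/
def upperRegion (S : Set Seg) (s : Seg) : Set Plane :=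
  region S s ∩ {x | 0 ≤ cross s.left s.right x}

/-- The complementary part of the visibility region of `s`. -/
def lowerRegion (S : Set Seg) (s : Seg) : Set Plane := region S s \ upperRegion S s

/-! ### Visibility graph, extended visibility graph, visibility space partition -/

/-- Edges of the visibility graph: pairs of distinct endpoints that see each other; the segments
of `S` themselves are edges, too. -/
def VGEdge (S : Set Seg) (u v : Plane) : Prop :=
  u ≠ v ∧ u ∈ endpoints S ∧ v ∈ endpoints S ∧
    (Avoids S (openSegment ℝ u v) ∨ ∃ t ∈ S, segment ℝ u v = t.carrier)

/-- `w` is the first point at which the extension of the directed edge `uv` of the visibility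
graph beyond `v` meets an element of `S`. -/
def IsExtension (S : Set Seg) (u v w : Plane) : Prop :=
  VGEdge S u v ∧ v ∈ openSegment ℝ u w ∧ (∃ t ∈ S, w ∈ t.carrier) ∧ Avoids S (openSegment ℝ v w)

/-- Edges `ab` of the extended visibility graph: edges of the visibility graph and the
extension edges. -/
def EVGEdge (S : Set Seg) (a b : Plane) : Prop :=
  VGEdge S a b ∨ (∃ u, IsExtension S u a b) ∨ (∃ u, IsExtension S u b a)

/-- The union of the edges of the extended visibility graph and the segments of `S`: the
one-dimensional set that is removed from the plane to obtain the visibility space partition. -/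
def skeleton (S : Set Seg) : Set Plane :=
  {x | (∃ a b, EVGEdge S a b ∧ x ∈ segment ℝ a b) ∨ ∃ t ∈ S, x ∈ t.carrier}

/-- Vertices of the visibility space partition: the endpoints of the edges of the extended
visibility graph (in particular the endpoints of the segments), and the points in which two such
edges cross. -/
def vspVertices (S : Set Seg) : Set Plane :=
  {x | (∃ y, EVGEdge S x y) ∨
    ∃ a b c d, EVGEdge S a b ∧ EVGEdge S c d ∧ segment ℝ a b ∩ segment ℝ c d = {x}}

/-- The open segment `ab` is an edge of the visibility space partition: it joins two vertices,
lies on the skeleton and contains no vertex. -/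
def IsVSPEdge (S : Set Seg) (a b : Plane) : Prop :=
  a ≠ b ∧ a ∈ vspVertices S ∧ b ∈ vspVertices S ∧
    openSegment ℝ a b ⊆ skeleton S ∧ Disjoint (openSegment ℝ a b) (vspVertices S)

/-- The edges of the visibility space partition that are incident on `s`: they have an endpoint
on `s`, but are not contained in `s`. -/
def incidentEdges (S : Set Seg) (s : Seg) : Set (Set Plane) :=
  {E | ∃ a b, IsVSPEdge S a b ∧ a ∈ s.carrier ∧ E = openSegment ℝ a b ∧ ¬ E ⊆ s.carrier}

/-! ### The sweep

In the following definitions `σ = 1` gives the sweep that covers the upper region of `s`; `σ = -1`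
gives its mirror image, which covers the lower region. In both cases the viewpoint `s.pt τ` moves
along `s` from left to right. The comments describe the case `σ = 1`. -/

/-- `x` is strictly above the supporting line of `s`. -/
def OnSide (s : Seg) (σ : ℝ) (x : Plane) : Prop := 0 < σ * cross s.left s.right x

/-- The points of `t` above `s` that are visible from the left endpoint of `s`. -/
def visiblePart (S : Set Seg) (s : Seg) (σ : ℝ) (t : Seg) : Set Plane :=
  {z | z ∈ t.carrier ∧ OnSide s σ z ∧ Sees S s.left z}

/-- The open segment `xy` is a maximal visible subsegment of `t`, that is, an edge on `t` of the
visibility polygon of the left endpoint of `s`. -/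
def IsVisibleEdge (S : Set Seg) (s : Seg) (σ : ℝ) (t : Seg) (x y : Plane) : Prop :=
  x ≠ y ∧ openSegment ℝ x y ⊆ visiblePart S s σ t ∧
    ∀ x' y', openSegment ℝ x y ⊆ openSegment ℝ x' y' →
      openSegment ℝ x' y' ⊆ visiblePart S s σ t → openSegment ℝ x' y' = openSegment ℝ x y

/-- The triangles of the initial step: the visibility polygon of the left endpoint of `s` is cut
into triangles with apex at that endpoint, one for each of its edges on a segment of `S`. -/
def initialTriangles (S : Set Seg) (s : Seg) (σ : ℝ) : Set (Set Plane) :=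
  {T | ∃ t ∈ S, ∃ x y, IsVisibleEdge S s σ t x y ∧ T = convexHull ℝ {s.left, x, y}}

/-- Seen from `p`, the edge `e = qy` with lower endpoint `q` and upper endpoint `y` on the segment
`t` is an active edge: `q` is an endpoint of a segment and is visible from `p`, the open segment
`qy` is on the ray from `p` through `q` and is free, and close to it the points on its right are
visible from `p`, while the points on its left are not. -/
def Active (S : Set Seg) (s : Seg) (σ : ℝ) (p q : Plane) (t : Seg) : Prop :=
  q ∈ endpoints S ∧ OnSide s σ q ∧ Sees S p q ∧ t ∈ S ∧
    ∃ y ∈ t.carrier, q ∈ openSegment ℝ p y ∧ Avoids S (openSegment ℝ q y) ∧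
      ∀ z ∈ openSegment ℝ q y, ∀ᶠ x in 𝓝 z,
        (σ * cross p q x < 0 → Sees S p x) ∧ (0 < σ * cross p q x → ¬ Sees S p x)

/-- The edge with lower endpoint `q` and upper endpoint on `t` is active when the viewpoint has
just left `s.pt τ` to the right. -/
def ActiveAfter (S : Set Seg) (s : Seg) (σ τ : ℝ) (q : Plane) (t : Seg) : Prop :=
  ∀ᶠ τ' in 𝓝[>] τ, Active S s σ (s.pt τ') q t

/-- The event points are the vertices of the visibility space partition on `s`. -/
def IsEvent (S : Set Seg) (s : Seg) (τ : ℝ) : Prop :=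
  τ ∈ Icc (0 : ℝ) 1 ∧ s.pt τ ∈ vspVertices S

/-- `τ` and `τ'` are consecutive events. -/
def NextEvent (S : Set Seg) (s : Seg) (τ τ' : ℝ) : Prop :=
  IsEvent S s τ ∧ IsEvent S s τ' ∧ τ < τ' ∧ ∀ τ'' ∈ Ioo τ τ', ¬ IsEvent S s τ''

/-- Some edge of the extended visibility graph that goes upwards from `s.pt τ` points to `q`, and
so is collinear with an active edge with lower endpoint `q`. -/
def Hits (S : Set Seg) (s : Seg) (σ τ : ℝ) (q : Plane) : Prop :=
  ∃ x, EVGEdge S (s.pt τ) x ∧ OnSide s σ x ∧ SameRay ℝ (x - s.pt τ) (q - s.pt τ)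

/-- The state of the sweep: `OnList S s σ q t a τ` says that, when the event `τ` has been
processed, the list of active edges contains the edge with lower endpoint `q` and upper endpoint
on `t`, with the start value `a`. -/
inductive OnList (S : Set Seg) (s : Seg) (σ : ℝ) : Plane → Seg → ℝ → ℝ → Prop
  /-- Initially, the active edges are those at the left endpoint of `s`. -/
  | init {q : Plane} {t : Seg} : ActiveAfter S s σ 0 q t → OnList S s σ q t 0 0
  /-- At an event, an active edge that is not collinear with an edge of the extended visibility
  graph at the event point stays on the list. -/
  | keep {q : Plane} {t : Seg} {a τ τ' : ℝ} : OnList S s σ q t a τ → NextEvent S s τ τ' →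
      ¬ Hits S s σ τ' q → OnList S s σ q t a τ'
  /-- The other ones leave the list, and the active edges found along the edges of the extended
  visibility graph at the event point enter it, with this event as their start. -/
  | new {q : Plane} {t : Seg} {τ : ℝ} : IsEvent S s τ → 0 < τ → τ < 1 → Hits S s σ τ q →
      ActiveAfter S s σ τ q t → OnList S s σ q t τ τ

/-- The triangles of the sweep. When the event `b` is processed, an active edge leaves the list if
it is collinear with an edge of the extended visibility graph at the event point, or if this point
is the right endpoint of `s`. It then generates the triangle with lowest vertex `q` that is bounded
by the lines through `q` and `s.pt a`, where `a` is the start of the edge, and through `q` and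
`s.pt b`, and whose third side is on `t`. -/
def sweptTriangles (S : Set Seg) (s : Seg) (σ : ℝ) : Set (Set Plane) :=
  {T | ∃ q t a τ b y₁ y₂, OnList S s σ q t a τ ∧ NextEvent S s τ b ∧ (Hits S s σ b q ∨ b = 1) ∧
    y₁ ∈ t.carrier ∧ q ∈ openSegment ℝ (s.pt a) y₁ ∧
    y₂ ∈ t.carrier ∧ q ∈ openSegment ℝ (s.pt b) y₂ ∧ T = convexHull ℝ {q, y₁, y₂}}

/-- All triangles generated by the sweep along `s` on one side of `s`. -/
def sideCover (S : Set Seg) (s : Seg) (σ : ℝ) : Set (Set Plane) :=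
  initialTriangles S s σ ∪ sweptTriangles S s σ

/-- The covering of the upper region. -/
def upperCover (S : Set Seg) (s : Seg) : Set (Set Plane) := sideCover S s 1

/-- The covering of the lower region, by the mirror image of the sweep. -/
def lowerCover (S : Set Seg) (s : Seg) : Set (Set Plane) := sideCover S s (-1)

/-- The covering of the visibility region of `s`. -/
def cover (S : Set Seg) (s : Seg) : Set (Set Plane) := upperCover S s ∪ lowerCover S s

/-- A nondegenerate closed triangle. -/
def IsTriangle (T : Set Plane) : Prop :=
  ∃ a b c : Plane, AffineIndependent ℝ ![a, b, c] ∧ T = convexHull ℝ {a, b, c}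

/-- No degenerate alignment as seen from `s`: if the supporting line of a segment `t ≠ s` meets
`s`, then no endpoint of a segment other than `s` lies on this line, except for the endpoints
of `t`. -/
def NoAlignment (S : Set Seg) (s : Seg) : Prop :=
  ∀ t ∈ S, t ≠ s → (∃ p ∈ s.carrier, cross t.left t.right p = 0) →
    ∀ t' ∈ S, t' ≠ s → ∀ q ∈ t'.ends, cross t.left t.right q = 0 → q ∈ t.ends

end Visibility

namespace Visibility

/-! ### Plane geometry -/

/-! Everything rests on how the active edges change while the viewpoint `p` moves along `s`. `Act`
restates activity as pure incidence: `q` is visible, every segment at `q` leads strictly to the left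
of the line of sight, and the ray beyond `q` runs free up to a point `y` of `t`. These conditions
survive small moves of `p` as long as `y` is not an endpoint (`Act.eventually`), and a limit of
active edges is again active unless a second endpoint lies on its line (`act_of_frequently`). In
both exceptional cases an edge of the extended visibility graph runs from `p` towards `q`; the main
source of such edges is `Scene.exists_evgEdge`. Hence activity of `(q, t)` is open and closed, so
constant, along every stretch of `s` without a hit (`act_constant`), and a listed edge is active at
all viewpoints strictly between its entry `a` and its exit `b` (`Listed.act`).

Soundness: an inner point of a swept triangle lies on the active edge of some intermediate
viewpoint. Since the segments at `q` are all on the left, a small move of the viewpoint to the right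
uncovers it (`Act.exists_sees`). Initial triangles consist of free lines of sight from the left
endpoint.

Completeness: the union of finitely many triangles is closed, so it suffices to cover a dense set of
visible points, those on no line through two endpoints (`Generic`). Such a point is in an initial
triangle if the left endpoint sees it (`exists_initial`). Otherwise, consider the last blocked
viewpoint before one that sees the point. There the line of sight touches exactly one endpoint `q`,
whose segments lead to the left, so the point lies on an active edge (`exists_act`), and the
triangle generated by this edge contains it (`exists_triangle`).

Counting: an initial triangle is charged to the first partition edge along its left side, a swept
one to the first partition edge from the exit viewpoint towards `q`. Without degenerate alignments,
active edges that leave at the same viewpoint in the same direction share `q` (`Listed.not_lt`),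
then `t`, then the start value, so the charging is injective.

The frame only guarantees that rays end (`exists_beyond_of_frame`). The sign `σ` treats both sides
of `s` at once. -/

/-- The signed height of `x` over the supporting line of `s`, up to a positive factor. -/
def height (s : Seg) (σ : ℝ) (x : Plane) : ℝ := σ * cross s.left s.right x

theorem cross_comb (o p x y : Plane) {a b : ℝ} (h : a + b = 1) :
    cross o p (a • x + b • y) = a * cross o p x + b * cross o p y := by
  obtain rfl : b = 1 - a := by linarith
  simp only [cross, Prod.fst_add, Prod.snd_add, Prod.smul_fst, Prod.smul_snd, smul_eq_mul]
  ring

theorem height_comb (s : Seg) (σ : ℝ) (x y : Plane) {a b : ℝ} (h : a + b = 1) :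
    height s σ (a • x + b • y) = a * height s σ x + b * height s σ y := by
  simp only [height, cross_comb _ _ _ _ h]
  ring

theorem cross_swap (o a b : Plane) : cross o b a = - cross o a b := by
  simp only [cross]; ring

theorem cross_rotate (o a b : Plane) : cross a b o = cross o a b := by
  simp only [cross]; ring

@[simp] theorem cross_self_right (o a : Plane) : cross o a a = 0 := by
  simp only [cross]; ring

@[simp] theorem cross_self_outer (o a : Plane) : cross o a o = 0 := by
  simp only [cross]; ring

@[simp] theorem cross_self_left (o b : Plane) : cross o o b = 0 := by
  simp only [cross]; ring

theorem continuous_cross : Continuous fun z : Plane × Plane × Plane => cross z.1 z.2.1 z.2.2 := by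
  unfold cross
  fun_prop

@[fun_prop]
theorem Continuous.cross {X : Type*} [TopologicalSpace X] {f g k : X → Plane} (hf : Continuous f)
    (hg : Continuous g) (hk : Continuous k) : Continuous fun x => cross (f x) (g x) (k x) :=
  continuous_cross.comp (hf.prodMk (hg.prodMk hk))

@[fun_prop]
theorem Continuous.height {X : Type*} [TopologicalSpace X] {f : X → Plane} (s : Seg) (σ : ℝ)
    (hf : Continuous f) : Continuous fun x => height s σ (f x) := by
  unfold Visibility.height
  fun_prop

/-- A point of the line through `a` and `b` is determined by its height. -/
theorem eq_of_cross_eq_zero {s : Seg} {σ : ℝ} {a b z : Plane} (hab : height s σ a < height s σ b)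
    (h : cross a b z = 0) :
    z = (1 - (height s σ z - height s σ a) / (height s σ b - height s σ a)) • a +
      ((height s σ z - height s σ a) / (height s σ b - height s σ a)) • b := by
  have h0 : height s σ b - height s σ a ≠ 0 := by linarith
  ext
  · simp only [Prod.fst_add, Prod.smul_fst, smul_eq_mul]
    field_simp
    simp only [height, cross] at *
    linear_combination (-σ * (s.right.1 - s.left.1)) * h
  · simp only [Prod.snd_add, Prod.smul_snd, smul_eq_mul]
    field_simp
    simp only [height, cross] at *
    linear_combination (-σ * (s.right.2 - s.left.2)) * h

/-- Heights replace barycentric parameters: on a fixed line only strict inequalities remain, and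
these survive small perturbations. -/
theorem mem_openSegment_iff {s : Seg} {σ : ℝ} {a b z : Plane}
    (hab : height s σ a < height s σ b) :
    z ∈ openSegment ℝ a b ↔
      cross a b z = 0 ∧ height s σ a < height s σ z ∧ height s σ z < height s σ b := by
  constructor
  · rintro ⟨u, v, hu, hv, huv, rfl⟩
    rw [cross_comb _ _ _ _ huv, height_comb _ _ _ _ huv]
    obtain rfl : u = 1 - v := by linarith
    refine ⟨by simp, by nlinarith, by nlinarith⟩
  · rintro ⟨h, h1, h2⟩
    have h0 : 0 < height s σ b - height s σ a := by linarith
    rw [eq_of_cross_eq_zero hab h]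
    refine ⟨_, _, ?_, ?_, by ring, rfl⟩
    · rw [sub_pos, div_lt_one h0]; linarith
    · exact div_pos (by linarith) h0

theorem mem_segment_iff {s : Seg} {σ : ℝ} {a b z : Plane}
    (hab : height s σ a < height s σ b) :
    z ∈ segment ℝ a b ↔
      cross a b z = 0 ∧ height s σ a ≤ height s σ z ∧ height s σ z ≤ height s σ b := by
  constructor
  · rintro ⟨u, v, hu, hv, huv, rfl⟩
    rw [cross_comb _ _ _ _ huv, height_comb _ _ _ _ huv]
    obtain rfl : u = 1 - v := by linarith
    refine ⟨by simp, by nlinarith, by nlinarith⟩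
  · rintro ⟨h, h1, h2⟩
    have h0 : 0 < height s σ b - height s σ a := by linarith
    rw [eq_of_cross_eq_zero hab h]
    refine ⟨_, _, ?_, ?_, by ring, rfl⟩
    · rw [sub_nonneg, div_le_one h0]; linarith
    · exact div_nonneg (by linarith) h0.le

/-- Points of equal height on a line are equal. -/
theorem eq_of_height_eq {s : Seg} {σ : ℝ} {a b z w : Plane} (hab : height s σ a < height s σ b)
    (hz : cross a b z = 0) (hw : cross a b w = 0) (h : height s σ z = height s σ w) : z = w := by
  rw [eq_of_cross_eq_zero hab hz, eq_of_cross_eq_zero hab hw, h]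

/-- The line through two points is also the line through two other of its points. -/
theorem cross_eq_zero_of_line {s : Seg} {σ : ℝ} {a b c d z : Plane}
    (hab : height s σ a < height s σ b)
    (hc : cross a b c = 0) (hd : cross a b d = 0) (hz : cross a b z = 0) : cross c d z = 0 := by
  rw [eq_of_cross_eq_zero hab hc, eq_of_cross_eq_zero hab hd, eq_of_cross_eq_zero hab hz]
  simp only [cross, Prod.fst_add, Prod.snd_add, Prod.smul_fst, Prod.smul_snd, smul_eq_mul]
  ring

/-! ### Segments -/

namespace Seg

theorem left_mem (t : Seg) : t.left ∈ t.carrier := left_mem_segment ..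
theorem right_mem (t : Seg) : t.right ∈ t.carrier := right_mem_segment ..

theorem ends_subset (t : Seg) : t.ends ⊆ t.carrier := by
  rintro x (rfl | rfl)
  exacts [t.left_mem, t.right_mem]

theorem left_ne_right (t : Seg) : t.left ≠ t.right := fun h => t.left_lt_right.ne (by rw [h])

theorem convex (t : Seg) : Convex ℝ t.carrier := convex_segment ..

theorem isCompact (t : Seg) : IsCompact t.carrier := by
  rw [carrier, ← convexHull_pair]
  exact ((Set.toFinite _).isCompact_convexHull (𝕜 := ℝ))

theorem isClosed (t : Seg) : IsClosed t.carrier := t.isCompact.isClosed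

theorem inner_subset (t : Seg) : t.inner ⊆ t.carrier := openSegment_subset_segment ..

theorem mem_inner_of_notMem_ends {t : Seg} {z : Plane} (hz : z ∈ t.carrier) (h : z ∉ t.ends) :
    z ∈ t.inner := by
  rw [carrier, ← insert_endpoints_openSegment] at hz
  simp only [ends, mem_insert_iff, mem_singleton_iff, not_or] at h
  simpa [h, inner] using hz

theorem left_notMem_inner (t : Seg) : t.left ∉ t.inner := by
  rw [inner, left_mem_openSegment_iff]
  exact t.left_ne_right

theorem right_notMem_inner (t : Seg) : t.right ∉ t.inner := by
  rw [inner, right_mem_openSegment_iff]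
  exact t.left_ne_right

/-- An open segment between two points of `t` consists of inner points of `t`. -/
theorem openSegment_subset_inner {t : Seg} {x y : Plane} (hx : x ∈ t.carrier) (hy : y ∈ t.carrier)
    (hxy : x ≠ y) : openSegment ℝ x y ⊆ t.inner := by
  intro z hz
  refine mem_inner_of_notMem_ends (t.convex.openSegment_subset hx hy hz) ?_
  obtain ⟨a, b, ha, hb, hab, rfl⟩ := hx
  obtain ⟨c, d, hc, hd, hcd, rfl⟩ := hy
  obtain ⟨u, v, hu, hv, huv, rfl⟩ := hz
  have hl := t.left_lt_right
  have hne : b ≠ d := by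
    rintro rfl
    obtain rfl : a = c := by linarith
    exact hxy rfl
  obtain rfl : a = 1 - b := by linarith
  obtain rfl : c = 1 - d := by linarith
  obtain rfl : u = 1 - v := by linarith
  have key : ((1 - v) • ((1 - b) • t.left + b • t.right) + v • ((1 - d) • t.left + d • t.right)).1 =
      t.left.1 + ((1 - v) * b + v * d) * (t.right.1 - t.left.1) := by
    simp only [Prod.fst_add, Prod.smul_fst, smul_eq_mul]
    ring
  rintro (h | h)
  · have h1 := congrArg Prod.fst h
    rw [key] at h1
    have h2 : ((1 - v) * b + v * d) = 0 := by
      have : ((1 - v) * b + v * d) * (t.right.1 - t.left.1) = 0 := by linarith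
      rcases mul_eq_zero.1 this with h | h
      · exact h
      · linarith
    have hb0 : b = 0 := by nlinarith [mul_nonneg hu.le hb, mul_nonneg hv.le hd]
    have hd0 : d = 0 := by nlinarith [mul_nonneg hu.le hb, mul_nonneg hv.le hd]
    exact hne (by rw [hb0, hd0])
  · have h1 := congrArg Prod.fst h
    rw [key] at h1
    have h2 : ((1 - v) * b + v * d) = 1 := by
      have : ((1 - v) * b + v * d - 1) * (t.right.1 - t.left.1) = 0 := by linarith
      rcases mul_eq_zero.1 this with h | h
      · linarith
      · linarith
    have hb0 : 1 - b = 0 := by nlinarith [mul_nonneg hu.le ha, mul_nonneg hv.le hc]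
    have hd0 : 1 - d = 0 := by nlinarith [mul_nonneg hu.le ha, mul_nonneg hv.le hc]
    exact hne (by linarith)

theorem pt_eq (t : Seg) (τ : ℝ) : t.pt τ = (1 - τ) • t.left + τ • t.right := by
  rw [pt, AffineMap.lineMap_apply_module]

theorem pt_mem (t : Seg) {τ : ℝ} (h : τ ∈ Icc (0 : ℝ) 1) : t.pt τ ∈ t.carrier := by
  rw [pt_eq]
  exact ⟨1 - τ, τ, by linarith [h.2], h.1, by ring, rfl⟩

theorem exists_pt_eq {t : Seg} {p : Plane} (h : p ∈ t.carrier) : ∃ τ ∈ Icc (0 : ℝ) 1, t.pt τ = p := by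
  obtain ⟨a, b, ha, hb, hab, rfl⟩ := h
  refine ⟨b, ⟨hb, by linarith⟩, ?_⟩
  rw [pt_eq, ← hab, add_sub_cancel_right]

@[simp] theorem pt_zero (t : Seg) : t.pt 0 = t.left := by simp [pt_eq]
@[simp] theorem pt_one (t : Seg) : t.pt 1 = t.right := by simp [pt_eq]

theorem pt_injective (t : Seg) : Function.Injective t.pt :=
  AffineMap.lineMap_injective ℝ t.left_ne_right

@[fun_prop]
theorem continuous_pt (t : Seg) : Continuous t.pt := AffineMap.lineMap_continuous

/-- An affine function that vanishes at two points of `t` vanishes on `t`. -/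
theorem cross_eq_zero_of_two {t : Seg} {o a x y z : Plane} (hx : x ∈ t.carrier) (hy : y ∈ t.carrier)
    (hxy : x ≠ y) (h1 : cross o a x = 0) (h2 : cross o a y = 0) (hz : z ∈ t.carrier) :
    cross o a z = 0 := by
  obtain ⟨u, hu, rfl⟩ := exists_pt_eq hx
  obtain ⟨v, hv, rfl⟩ := exists_pt_eq hy
  obtain ⟨w, hw, rfl⟩ := exists_pt_eq hz
  have huv : v - u ≠ 0 := fun h => hxy (by rw [sub_eq_zero.1 h])
  rw [pt_eq, cross_comb _ _ _ _ (by ring)] at *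
  have h3 : (v - u) * (cross o a t.left - cross o a t.right) = 0 := by linear_combination h1 - h2
  have h4 := (mul_eq_zero.1 h3).resolve_left huv
  linear_combination h1 + (u - w) * h4

end Seg

@[simp] theorem height_pt (s : Seg) (σ τ : ℝ) : height s σ (s.pt τ) = 0 := by
  rw [Seg.pt_eq, height_comb _ _ _ _ (by ring)]
  simp [height]

theorem height_eq_zero {s : Seg} {σ : ℝ} {p : Plane} (hp : p ∈ s.carrier) : height s σ p = 0 := by
  obtain ⟨τ, -, rfl⟩ := Seg.exists_pt_eq hp
  simp

/-- The orientation of the ray through `q` as the viewpoint moves. -/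
theorem cross_pt (s : Seg) (σ τ τ' : ℝ) (q y : Plane) (β : ℝ) (hy : y = q + β • (q - s.pt τ)) :
    σ * cross (s.pt τ') q y = - (β * (τ' - τ) * height s σ q) := by
  subst hy
  simp only [Seg.pt_eq, cross, height, Prod.fst_add, Prod.snd_add, Prod.fst_sub, Prod.snd_sub,
    Prod.smul_fst, Prod.smul_snd, smul_eq_mul]
  ring

/-! ### Topology of free segments -/

theorem eventually_lt_of_continuous {X : Type*} [TopologicalSpace X] {f g : X → ℝ}
    (hf : Continuous f) (hg : Continuous g) {x : X} (h : f x < g x) : ∀ᶠ y in 𝓝 x, f y < g y :=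
  hf.continuousAt.eventually_lt hg.continuousAt h

/-- Segments that meet a closed set form a closed set. -/
theorem isClosed_segment_meets {C : Set Plane} (hC : IsClosed C) :
    IsClosed {z : Plane × Plane | ¬ Disjoint (segment ℝ z.1 z.2) C} := by
  have h1 : IsClosed {w : (Icc (0 : ℝ) 1) × (Plane × Plane) |
      AffineMap.lineMap w.2.1 w.2.2 (w.1 : ℝ) ∈ C} := by
    refine hC.preimage ?_
    simp only [AffineMap.lineMap_apply_module]
    fun_prop
  -- The set is the projection, along the compact parameter interval, of a closed incidence set.
  have h2 := isClosedMap_snd_of_compactSpace _ h1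
  convert h2 using 1
  ext z
  rw [mem_ofPred, Set.not_disjoint_iff, segment_eq_image_lineMap]
  constructor
  · rintro ⟨_, ⟨u, hu, rfl⟩, hx⟩
    exact ⟨(⟨u, hu⟩, z), hx, rfl⟩
  · rintro ⟨⟨u, w⟩, hx, rfl⟩
    exact ⟨_, ⟨u, u.2, rfl⟩, hx⟩

theorem eventually_disjoint {C : Set Plane} (hC : IsClosed C) {a b : Plane}
    (h : Disjoint (segment ℝ a b) C) :
    ∀ᶠ z : Plane × Plane in 𝓝 (a, b), Disjoint (segment ℝ z.1 z.2) C := by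
  have := (isClosed_segment_meets hC).isOpen_compl.mem_nhds (x := (a, b)) (by simpa using h)
  filter_upwards [this] with z hz
  simpa using hz

/-- The first point of a closed set on a segment. -/
theorem exists_first {A : Set Plane} (hA : IsClosed A) {p x : Plane} (hp : p ∉ A) (hx : x ∈ A) :
    ∃ r ∈ A, r ≠ p ∧ r ∈ segment ℝ p x ∧ Disjoint (openSegment ℝ p r) A := by
  let f : ℝ → Plane := AffineMap.lineMap p x
  have hf : Continuous f := AffineMap.lineMap_continuous
  have hK : IsCompact (Icc (0 : ℝ) 1 ∩ f ⁻¹' A) := isCompact_Icc.inter_right (hA.preimage hf)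
  obtain ⟨u, ⟨hu, huA⟩, hmin⟩ := hK.exists_isLeast ⟨1, by simp, by simpa [f] using hx⟩
  refine ⟨f u, huA, fun h => hp (h ▸ huA), ?_, ?_⟩
  · rw [segment_eq_image_lineMap]; exact ⟨u, hu, rfl⟩
  · rw [Set.disjoint_left]
    intro z hz hzA
    rw [openSegment_eq_image_lineMap] at hz
    obtain ⟨v, hv, rfl⟩ := hz
    -- The point with parameter `v` on the way to `f u` has parameter `v * u < u` on the way to `x`,
    -- against the minimality of `u`.
    have h1 : f (v * u) = AffineMap.lineMap p (f u) v := by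
      simp only [f, AffineMap.lineMap_apply, vsub_eq_sub, vadd_eq_add, add_sub_cancel_right,
        smul_smul]
    have hu0 : 0 < u := lt_of_le_of_ne hu.1 (by rintro rfl; exact hp (by simpa [f] using huA))
    have h2 : u ≤ v * u := hmin ⟨⟨by nlinarith [hv.1], by nlinarith [hv.2, hu.2, hv.1]⟩, by
      rw [mem_preimage, h1]; exact hzA⟩
    nlinarith [hv.2]

/-- Two points of a convex set on different sides of a line. -/
theorem exists_cross_eq_zero {o a c d : Plane} {σ : ℝ} (hc : σ * cross o a c < 0)
    (hd : 0 < σ * cross o a d) : ∃ w ∈ segment ℝ c d, cross o a w = 0 := by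
  have h0 : 0 < σ * cross o a d - σ * cross o a c := by linarith
  set D := σ * cross o a d - σ * cross o a c with hD
  have h1 : (σ * cross o a d) / D + (- (σ * cross o a c)) / D = 1 := by
    rw [← add_div, ← sub_eq_add_neg, div_self h0.ne']
  refine ⟨((σ * cross o a d) / D) • c + ((- (σ * cross o a c)) / D) • d,
    ⟨_, _, by positivity, div_nonneg (by linarith) h0.le, h1, rfl⟩, ?_⟩
  rw [cross_comb _ _ _ _ h1]
  field_simp
  ring

theorem height_mem_segment {s : Seg} {σ : ℝ} {c d w : Plane} (hw : w ∈ segment ℝ c d) {l u : ℝ}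
    (h1 : l < height s σ c) (h2 : l < height s σ d) (h3 : height s σ c < u)
    (h4 : height s σ d < u) : l < height s σ w ∧ height s σ w < u := by
  obtain ⟨a, b, ha, hb, hab, rfl⟩ := hw
  rw [height_comb _ _ _ _ hab]
  obtain rfl : a = 1 - b := by linarith
  rcases hb.eq_or_lt with rfl | hb
  · simp_all
  · constructor <;> nlinarith

/-- A convex set with points on both sides of an open segment, between the levels of its ends,
meets this open segment. -/
theorem not_disjoint_of_sides {s : Seg} {σ : ℝ} {C : Set Plane} (hC : Convex ℝ C) {a b c d : Plane}
    (hc : c ∈ C) (hd : d ∈ C) (h1 : height s σ a < height s σ c) (h2 : height s σ a < height s σ d)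
    (h3 : height s σ c < height s σ b) (h4 : height s σ d < height s σ b)
    (h5 : σ * cross a b c < 0) (h6 : 0 < σ * cross a b d) :
    ∃ w ∈ C, w ∈ segment ℝ c d ∧ w ∈ openSegment ℝ a b := by
  obtain ⟨w, hw, hw0⟩ := exists_cross_eq_zero h5 h6
  obtain ⟨h7, h8⟩ := height_mem_segment hw h1 h2 h3 h4
  exact ⟨w, hC.segment_subset hc hd hw, hw, (mem_openSegment_iff (by linarith)).2 ⟨hw0, h7, h8⟩⟩

/-- A segment crosses the line of `a` and `b` in its inner point `z`: there are points of it on both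
sides of the line, arbitrarily close to `z`. -/
theorem Seg.exists_sides {t : Seg} {σ : ℝ} (hσ : σ ≠ 0) {a b z : Plane} (hz : z ∈ t.inner)
    (h0 : cross a b z = 0) (hl : cross a b t.left ≠ 0) {U : Set Plane} (hU : U ∈ 𝓝 z) :
    ∃ c ∈ t.carrier, ∃ d ∈ t.carrier, c ∈ U ∧ d ∈ U ∧ σ * cross a b c < 0 ∧ 0 < σ * cross a b d := by
  obtain ⟨u, v, hu, hv, huv, rfl⟩ := id hz
  rw [cross_comb _ _ _ _ huv] at h0
  have hev : ∀ w : Plane, ∀ᶠ ν : ℝ in 𝓝[>] 0,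
      (1 - ν) • (u • t.left + v • t.right) + ν • w ∈ U := by
    intro w
    have : Continuous fun ν : ℝ => (1 - ν) • (u • t.left + v • t.right) + ν • w := by fun_prop
    refine nhdsWithin_le_nhds (this.continuousAt.preimage_mem_nhds ?_)
    simpa using hU
  obtain ⟨ν, ⟨⟨h1, h2⟩, h3⟩, h4⟩ := ((((hev t.left).and (hev t.right)).and
    (Ioo_mem_nhdsGT (show (0 : ℝ) < 1 by norm_num))).and self_mem_nhdsWithin).exists
  have hz' := t.inner_subset hz
  have hm : ∀ w ∈ t.carrier, (1 - ν) • (u • t.left + v • t.right) + ν • w ∈ t.carrier := fun w hw =>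
    t.convex hz' hw (by linarith [h3.2]) h3.1.le (by ring)
  have hcr : ∀ w, cross a b ((1 - ν) • (u • t.left + v • t.right) + ν • w) = ν * cross a b w := by
    intro w
    rw [cross_comb _ _ _ _ (by ring), cross_comb _ _ _ _ huv, h0]
    ring
  have hν : 0 < ν := h3.1
  have hsl : σ * cross a b t.left ≠ 0 := mul_ne_zero hσ hl
  -- As `z` is on the line and inside `t`, the two ends of `t` have opposite orientations. Short
  -- moves from `z` towards them give `c` and `d`.
  have hr : v * (σ * cross a b t.right) = - (u * (σ * cross a b t.left)) := by
    linear_combination σ * h0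
  rcases lt_or_gt_of_ne hsl with h | h
  · refine ⟨_, hm _ t.left_mem, _, hm _ t.right_mem, h1, h2, ?_, ?_⟩
    · rw [hcr]; nlinarith
    · rw [hcr]
      have : 0 < v * (σ * cross a b t.right) := by rw [hr]; nlinarith
      have := pos_of_mul_pos_right this hv.le
      nlinarith
  · refine ⟨_, hm _ t.right_mem, _, hm _ t.left_mem, h2, h1, ?_, ?_⟩
    · rw [hcr]
      have : v * (σ * cross a b t.right) < 0 := by rw [hr]; nlinarith
      have : σ * cross a b t.right < 0 := by
        by_contra! hcon
        nlinarith
      nlinarith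
    · rw [hcr]; nlinarith

/-- A proper crossing persists under small perturbations of the crossing segment. -/
theorem eventually_crossing {s : Seg} {σ : ℝ} (hσ : σ ≠ 0) {t : Seg} {a b z : Plane}
    (hab : height s σ a < height s σ b) (hz : z ∈ t.inner) (hzo : z ∈ openSegment ℝ a b)
    (hl : cross a b t.left ≠ 0) :
    ∀ᶠ w : Plane × Plane in 𝓝 (a, b), ¬ Disjoint (openSegment ℝ w.1 w.2) t.carrier := by
  obtain ⟨h0, h1, h2⟩ := (mem_openSegment_iff hab).1 hzo
  have hU : {x | height s σ a < height s σ x ∧ height s σ x < height s σ b} ∈ 𝓝 z := by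
    have k1 : ∀ᶠ x in 𝓝 z, height s σ a < height s σ x :=
      eventually_lt_of_continuous (by fun_prop) (by fun_prop) h1
    have k2 : ∀ᶠ x in 𝓝 z, height s σ x < height s σ b :=
      eventually_lt_of_continuous (by fun_prop) (by fun_prop) h2
    exact k1.and k2
  -- Two points of `t` on both sides of the line, at heights between those of `a` and `b`, force a
  -- crossing. All six inequalities that say so are strict, hence stable.
  obtain ⟨c, hc, d, hd, ⟨hc1, hc2⟩, ⟨hd1, hd2⟩, hc3, hd3⟩ := t.exists_sides hσ hz h0 hl hU
  have k1 : ∀ᶠ w : Plane × Plane in 𝓝 (a, b), height s σ w.1 < height s σ c :=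
    eventually_lt_of_continuous (by fun_prop) (by fun_prop) hc1
  have k2 : ∀ᶠ w : Plane × Plane in 𝓝 (a, b), height s σ w.1 < height s σ d :=
    eventually_lt_of_continuous (by fun_prop) (by fun_prop) hd1
  have k3 : ∀ᶠ w : Plane × Plane in 𝓝 (a, b), height s σ c < height s σ w.2 :=
    eventually_lt_of_continuous (by fun_prop) (by fun_prop) hc2
  have k4 : ∀ᶠ w : Plane × Plane in 𝓝 (a, b), height s σ d < height s σ w.2 :=
    eventually_lt_of_continuous (by fun_prop) (by fun_prop) hd2
  have k5 : ∀ᶠ w : Plane × Plane in 𝓝 (a, b), σ * cross w.1 w.2 c < 0 :=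
    eventually_lt_of_continuous (by fun_prop) (by fun_prop) hc3
  have k6 : ∀ᶠ w : Plane × Plane in 𝓝 (a, b), 0 < σ * cross w.1 w.2 d :=
    eventually_lt_of_continuous (by fun_prop) (by fun_prop) hd3
  filter_upwards [k1, k2, k3, k4, k5, k6] with w k1 k2 k3 k4 k5 k6
  obtain ⟨x, hx, -, hxo⟩ := not_disjoint_of_sides t.convex hc hd k1 k2 k3 k4 k5 k6
  exact Set.not_disjoint_iff.2 ⟨x, hxo, hx⟩


/-! ### First points of `S` on rays from `s` -/

/-- The assumptions on the segments and the viewpoint segment that the sweep depends on. -/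
structure Scene (S : Set Seg) (s : Seg) (σ : ℝ) : Prop where
  side_ne_zero : σ ≠ 0
  finite : S.Finite
  inner_disjoint : S.Pairwise fun t t' => Disjoint t.inner t'.inner
  mem : s ∈ S
  isolated : ∀ t ∈ S, t ≠ s → Disjoint s.carrier t.carrier
  -- The condition that some `p'` sees `x` keeps `x` inside the frame; the ray to be stopped may
  -- start at another point `p` of `s`.
  exists_beyond : ∀ p ∈ s.carrier, ∀ p' ∈ s.carrier, ∀ x, OnSide s σ x → Sees S p' x →
    ∃ κ : ℝ, 1 ≤ κ ∧ ∃ t ∈ S, p + κ • (x - p) ∈ t.carrier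

/-- The segment `t` does not cross the open segment `ab` properly. -/
def NoCross (a b : Plane) (t : Seg) : Prop :=
  ∀ z ∈ t.carrier, z ∈ openSegment ℝ a b →
    z ∈ t.ends ∨ (cross a b t.left = 0 ∧ cross a b t.right = 0)

/-- The points on the segments other than `s`. -/
def others (S : Set Seg) (s : Seg) : Set Plane := {x | ∃ t ∈ S, t ≠ s ∧ x ∈ t.carrier}

theorem endpoints_finite {S : Set Seg} (h : S.Finite) : (endpoints S).Finite := by
  have : endpoints S = ⋃ t ∈ S, t.ends := by
    ext q; simp [endpoints]
  rw [this]
  exact h.biUnion fun t _ => by simp [Seg.ends]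

theorem endpoints_subset {S : Set Seg} {q : Plane} (h : q ∈ endpoints S) :
    ∃ t ∈ S, q ∈ t.carrier := by
  obtain ⟨t, ht, hq⟩ := h
  exact ⟨t, ht, t.ends_subset hq⟩

theorem isClosed_others {S : Set Seg} (s : Seg) (h : S.Finite) : IsClosed (others S s) := by
  have : others S s = ⋃ t ∈ S \ {s}, t.carrier := by
    ext q; simp [others, and_assoc]
  rw [this]
  exact (h.subset sdiff_subset).isClosed_biUnion fun t _ => t.isClosed

theorem Scene.notMem_others {S : Set Seg} {s : Seg} {σ : ℝ} (hS : Scene S s σ) {p : Plane}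
    (hp : p ∈ s.carrier) : p ∉ others S s := by
  rintro ⟨t, ht, hts, hpt⟩
  exact Set.disjoint_left.1 (hS.isolated t ht hts) hp hpt

theorem height_pos_of_mem_openSegment {s : Seg} {σ : ℝ} {p x z : Plane} (hp : 0 ≤ height s σ p)
    (hx : 0 < height s σ x) (hz : z ∈ openSegment ℝ p x) : 0 < height s σ z := by
  obtain ⟨a, b, ha, hb, hab, rfl⟩ := hz
  rw [height_comb _ _ _ _ hab]
  positivity

/-- `s` has height zero and blocks nothing above it. So blocking can be tested against `others`, a
closed set that keeps away from `s`, which gives first points and compactness for rays that start on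
`s`. -/
theorem avoids_of_disjoint_others {S : Set Seg} {s : Seg} {σ : ℝ} {X : Set Plane}
    (hX : ∀ x ∈ X, 0 < height s σ x) (h : Disjoint X (others S s)) : Avoids S X := by
  intro t ht
  rw [Set.disjoint_left]
  intro z hz hzt
  refine Set.disjoint_left.1 h hz ⟨t, ht, ?_, hzt⟩
  rintro rfl
  exact (hX z hz).ne' (height_eq_zero hzt)

theorem Avoids.mono {S : Set Seg} {X Y : Set Plane} (h : Avoids S Y) (hXY : X ⊆ Y) : Avoids S X :=
  fun t ht => (h t ht).mono_left hXY

theorem Avoids.disjoint_others {S : Set Seg} {s : Seg} {X : Set Plane} (h : Avoids S X) :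
    Disjoint X (others S s) := by
  rw [Set.disjoint_left]
  rintro z hz ⟨t, ht, -, hzt⟩
  exact Set.disjoint_left.1 (h t ht) hz hzt

theorem Avoids.notMem {S : Set Seg} {X : Set Plane} (h : Avoids S X) {t : Seg} (ht : t ∈ S)
    {z : Plane} (hz : z ∈ X) : z ∉ t.carrier :=
  Set.disjoint_left.1 (h t ht) hz

/-- The first point of `S` on a segment that starts on `s`. -/
theorem Scene.exists_first_hit {S : Set Seg} {s : Seg} {σ : ℝ} (hS : Scene S s σ) {p x : Plane}
    (hp : p ∈ s.carrier) (hx : 0 < height s σ x) {t : Seg} (ht : t ∈ S) (hxt : x ∈ t.carrier) :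
    ∃ r ∈ segment ℝ p x, 0 < height s σ r ∧ (∃ t ∈ S, r ∈ t.carrier) ∧
      Avoids S (openSegment ℝ p r) := by
  have hp0 := height_eq_zero (σ := σ) hp
  obtain ⟨r, ⟨t', ht', hts, hrt⟩, hrp, hr, hd⟩ := exists_first (isClosed_others s hS.finite)
    (hS.notMem_others hp) (x := x) ⟨t, ht, by rintro rfl; exact hx.ne' (height_eq_zero hxt), hxt⟩
  have hr0 : 0 < height s σ r := by
    refine lt_of_le_of_ne ?_ ?_
    · have := ((mem_segment_iff (by rwa [hp0])).1 hr).2.1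
      rwa [hp0] at this
    · intro h
      obtain ⟨h1, h2, h3⟩ := (mem_segment_iff (s := s) (σ := σ) (a := p) (b := x) (by rwa [hp0])).1 hr
      exact hrp (eq_of_height_eq (s := s) (σ := σ) (a := p) (b := x) (by rwa [hp0]) h1 (by simp)
        (by rw [← h, hp0]))
  exact ⟨r, hr, hr0, ⟨t', ht', hrt⟩,
    avoids_of_disjoint_others (fun z hz => height_pos_of_mem_openSegment hp0.ge hr0 hz) hd⟩

/-! ### Segments that do not cross a line of sight properly -/

section

variable {s : Seg} {σ : ℝ} {a b : Plane}

/-- On a segment in a given line, an inner point has an endpoint below it. -/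
theorem exists_lower_end (hab : height s σ a < height s σ b) {t : Seg} {z : Plane}
    (hz : z ∈ t.carrier) (hze : z ∉ t.ends) (hl : cross a b t.left = 0) (hr : cross a b t.right = 0) :
    ∃ c ∈ t.ends, height s σ c < height s σ z ∧ cross a b c = 0 := by
  have hne : height s σ t.left ≠ height s σ t.right := fun h =>
    t.left_ne_right (eq_of_height_eq hab hl hr h)
  obtain ⟨u, v, hu, hv, huv, rfl⟩ := Seg.mem_inner_of_notMem_ends hz hze
  obtain rfl : u = 1 - v := by linarith
  rcases lt_or_gt_of_ne hne with h | h
  · refine ⟨t.left, Or.inl rfl, ?_, hl⟩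
    rw [height_comb _ _ _ _ huv]
    nlinarith
  · refine ⟨t.right, Or.inr rfl, ?_, hr⟩
    rw [height_comb _ _ _ _ huv]
    nlinarith

/-- A point between two points of a segment on a line is on this segment. -/
theorem mem_carrier_of_between (hab : height s σ a < height s σ b) {t : Seg} {c x z : Plane}
    (hc : c ∈ t.carrier) (hz : z ∈ t.carrier) (hc0 : cross a b c = 0) (hx0 : cross a b x = 0)
    (hz0 : cross a b z = 0) (h1 : height s σ c ≤ height s σ x) (h2 : height s σ x ≤ height s σ z) :
    x ∈ t.carrier := by
  rcases (h1.trans h2).lt_or_eq with h | h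
  · exact t.convex.segment_subset hc hz
      ((mem_segment_iff h).2 ⟨cross_eq_zero_of_line hab hc0 hz0 hx0, h1, h2⟩)
  · rwa [eq_of_height_eq hab hx0 hc0 (by linarith)]

/-- The first point on an open segment of a segment that does not cross properly is one of its
endpoints. -/
theorem NoCross.mem_ends (hab : height s σ a < height s σ b) {t : Seg} (hn : NoCross a b t)
    (ha : a ∉ t.carrier) {z : Plane} (hz : z ∈ t.carrier) (hzo : z ∈ openSegment ℝ a b)
    (hd : Disjoint (openSegment ℝ a z) t.carrier) : z ∈ t.ends := by
  by_contra hze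
  obtain ⟨hl, hr⟩ := (hn z hz hzo).resolve_left hze
  obtain ⟨h0, h1, h2⟩ := (mem_openSegment_iff hab).1 hzo
  -- `t` lies in the line. If its lower end is not above `a`, then `a` is on `t`; otherwise `t` is
  -- met before `z`. Both are excluded.
  obtain ⟨c, hc, hcz, hc0⟩ := exists_lower_end hab hz hze hl hr
  rcases le_or_gt (height s σ c) (height s σ a) with h | h
  · exact ha (mem_carrier_of_between hab (t.ends_subset hc) hz hc0 (by simp) h0 h h1.le)
  · exact Set.disjoint_left.1 hd ((mem_openSegment_iff h1).2
      ⟨cross_eq_zero_of_line hab (by simp) h0 hc0, h, hcz⟩) (t.ends_subset hc)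

/-- Limits of free segments are not crossed properly. -/
theorem noCross_of_frequently (hσ : σ ≠ 0) (hab : height s σ a < height s σ b) {t : Seg}
    (h : ∃ᶠ w : Plane × Plane in 𝓝 (a, b), Disjoint (openSegment ℝ w.1 w.2) t.carrier) :
    NoCross a b t := by
  intro z hz hzo
  by_contra! hcon
  obtain ⟨h1, h2⟩ := hcon
  have hzi := Seg.mem_inner_of_notMem_ends hz h1
  have h3 : cross a b t.left ≠ 0 := by
    intro h3
    refine h2 h3 (Seg.cross_eq_zero_of_two t.left_mem hz ?_ h3
      ((mem_openSegment_iff hab).1 hzo).1 t.right_mem)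
    rintro rfl
    exact t.left_notMem_inner hzi
  obtain ⟨w, hw, hw'⟩ := (h.and_eventually (eventually_crossing hσ hab hzi hzo h3)).exists
  exact hw' hw

end

/-! ### Edges of the extended visibility graph on a ray from `s` -/

section

variable {S : Set Seg} {s : Seg} {σ : ℝ}

/-- The other endpoint of a segment. -/
theorem Seg.exists_other_end {t : Seg} {q : Plane} (hq : q ∈ t.ends) :
    ∃ e ∈ t.ends, e ≠ q ∧ segment ℝ q e = t.carrier := by
  rcases hq with rfl | rfl
  · exact ⟨t.right, Or.inr rfl, t.left_ne_right.symm, rfl⟩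
  · exact ⟨t.left, Or.inl rfl, t.left_ne_right, segment_symm _ _ _⟩

theorem vgEdge_of_segment {t : Seg} (ht : t ∈ S) {q e : Plane} (hq : q ∈ t.ends) (he : e ∈ t.ends)
    (hne : e ≠ q) (h : segment ℝ q e = t.carrier) : VGEdge S e q :=
  ⟨hne, ⟨t, ht, he⟩, ⟨t, ht, hq⟩, Or.inr ⟨t, ht, by rw [segment_symm, h]⟩⟩

/-- The extension of `uv` beyond `v` is stopped at `p` because `p` is on `s`. This supplies edges at
viewpoints that need not be endpoints. -/
theorem evgEdge_of_extension (hS : Scene S s σ) {p u v : Plane} (hp : p ∈ s.carrier)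
    (huv : VGEdge S u v) (h : v ∈ openSegment ℝ p u) (hA : Avoids S (openSegment ℝ p v)) :
    EVGEdge S p v :=
  Or.inr (Or.inr ⟨u, huv, by rwa [openSegment_symm], ⟨s, hS.mem, hp⟩, by rwa [openSegment_symm]⟩)

/-- If a ray from `s` passes through two endpoints and is not crossed properly before the second
one, then there is an edge of the extended visibility graph on it. -/
theorem Scene.exists_evgEdge (hS : Scene S s σ) {p r r' : Plane} (hp : p ∈ s.carrier)
    (hr : r ∈ endpoints S) (hr' : r' ∈ endpoints S) (hpos : 0 < height s σ r')
    (hrr : r ∈ openSegment ℝ p r') (hn : ∀ t ∈ S, NoCross p r' t) :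
    ∃ x ∈ openSegment ℝ p r', EVGEdge S p x := by
  have hp0 := height_eq_zero (σ := σ) hp
  have hab : height s σ p < height s σ r' := by rwa [hp0]
  have hposr := height_pos_of_mem_openSegment hp0.ge hpos hrr
  obtain ⟨t0, ht0, hrt0⟩ := endpoints_subset hr
  obtain ⟨x, hxr, hx0, ⟨t, ht, hxt⟩, hA⟩ := hS.exists_first_hit hp hposr ht0 hrt0
  obtain ⟨k0, k1, k2⟩ := (mem_openSegment_iff hab).1 hrr
  obtain ⟨l0, l1, l2⟩ := (mem_segment_iff (by rwa [hp0])).1 hxr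
  have hxl : cross p r' x = 0 := cross_eq_zero_of_line (s := s) (σ := σ) (a := p) (b := r)
    (by rwa [hp0]) (by simp) (by rw [cross_swap, k0, neg_zero]) l0
  have hxo : x ∈ openSegment ℝ p r' := (mem_openSegment_iff hab).2 ⟨hxl, by rwa [hp0], by linarith⟩
  refine ⟨x, hxo, ?_⟩
  have hpn : ∀ t ∈ S, x ∈ t.carrier → p ∉ t.carrier := by
    intro t ht hxt hpt
    refine hS.notMem_others hp ⟨t, ht, ?_, hpt⟩
    rintro rfl
    exact hx0.ne' (height_eq_zero hxt)
  have hxends : ∀ t ∈ S, x ∈ t.carrier → x ∈ t.ends := fun t ht hxt =>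
    (hn t ht).mem_ends hab (hpn t ht hxt) hxt hxo (hA t ht)
  -- The first hit `x` is an endpoint. If a segment at `x` runs along the ray, it goes upwards from
  -- `x`, and this segment is the visibility graph edge to be extended down to `p`.
  by_cases hcol : ∃ t ∈ S, x ∈ t.carrier ∧ cross p r' t.left = 0 ∧ cross p r' t.right = 0
  · obtain ⟨t, ht, hxt, hl, hrt⟩ := hcol
    obtain ⟨e, he, hne, hseg⟩ := Seg.exists_other_end (hxends t ht hxt)
    have hel : cross p r' e = 0 := by rcases he with rfl | rfl <;> assumption
    have het := t.ends_subset he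
    refine evgEdge_of_extension hS hp (vgEdge_of_segment ht (hxends t ht hxt) he hne hseg) ?_ hA
    have hlt : height s σ x < height s σ e := by
      by_contra! hle
      have hlt : height s σ e < height s σ x := lt_of_le_of_ne hle fun h =>
        hne (eq_of_height_eq hab hel hxl h)
      rcases le_or_gt (height s σ e) 0 with h | h
      · exact hpn t ht hxt (mem_carrier_of_between hab het hxt hel (by simp) hxl
          (by rwa [hp0]) (by rw [hp0]; exact hx0.le))
      · exact hA.notMem ht ((mem_openSegment_iff (by rwa [hp0])).2
          ⟨cross_eq_zero_of_line hab (by simp) hxl hel, by rwa [hp0], hlt⟩) het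
    exact (mem_openSegment_iff (by rw [hp0]; linarith)).2
      ⟨cross_eq_zero_of_line hab (by simp) hel hxl, by rwa [hp0], hlt⟩
  · push Not at hcol
    have hxr' : height s σ x < height s σ r' := ((mem_openSegment_iff hab).1 hxo).2.2
    -- Otherwise, the next endpoint `r2` above `x` on the ray sees `x`, and the edge from `r2` to
    -- `x` is extended down to `p`.
    obtain ⟨r2, ⟨hr2, hr2x⟩, -, hr2s, hd⟩ := exists_first (A := endpoints S \ {x})
      ((endpoints_finite hS.finite).subset sdiff_subset).isClosed (p := x) (x := r') (by simp)
      ⟨hr', by rintro rfl; exact lt_irrefl _ hxr'⟩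
    obtain ⟨m0, m1, m2⟩ := (mem_segment_iff hxr').1 hr2s
    have hr2l : cross p r' r2 = 0 := cross_eq_zero_of_line hxr'
      (cross_eq_zero_of_line hab hxl (by simp) (by simp)) (by simp) m0
    have hlt : height s σ x < height s σ r2 := lt_of_le_of_ne m1 fun h =>
      hr2x (eq_of_height_eq hab hr2l hxl h.symm)
    have hVG : VGEdge S r2 x := by
      refine ⟨hr2x, hr2, ⟨t, ht, hxends t ht hxt⟩, Or.inl ?_⟩
      rw [openSegment_symm]
      intro t' ht'
      rw [Set.disjoint_left]
      intro z hz hzt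
      obtain ⟨z0, z1, z2⟩ := (mem_openSegment_iff hlt).1 hz
      have hzl : cross p r' z = 0 := cross_eq_zero_of_line hlt
        (cross_eq_zero_of_line hab hxl hr2l (by simp))
        (cross_eq_zero_of_line hab hxl hr2l (by simp)) z0
      have hzx : z ≠ x := by rintro rfl; exact lt_irrefl _ z1
      have hze : z ∉ t'.ends := fun h =>
        Set.disjoint_left.1 hd hz ⟨⟨t', ht', h⟩, hzx⟩
      obtain ⟨hl, hrt⟩ := (hn t' ht' z hzt ((mem_openSegment_iff hab).2
        ⟨hzl, by rw [hp0]; linarith, by linarith⟩)).resolve_left hze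
      -- A segment between `x` and `r2` without an end at `z` lies in the ray. Either it reaches
      -- down to `x`, against `hcol`, or its lower end is an endpoint before `r2`.
      obtain ⟨c, hc, hcz, hc0⟩ := exists_lower_end hab hzt hze hl hrt
      rcases le_or_gt (height s σ c) (height s σ x) with h | h
      · exact hcol t' ht' (mem_carrier_of_between hab (t'.ends_subset hc) hzt hc0 hxl hzl h z1.le)
          hl hrt
      · exact Set.disjoint_left.1 hd ((mem_openSegment_iff hlt).2
          ⟨cross_eq_zero_of_line hab hxl hr2l hc0, h, by linarith⟩)
          ⟨⟨t', ht', hc⟩, by rintro rfl; exact lt_irrefl _ h⟩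
    refine evgEdge_of_extension hS hp hVG ?_ hA
    exact (mem_openSegment_iff (by rw [hp0]; linarith)).2
      ⟨cross_eq_zero_of_line hab (by simp) hr2l hxl, by rwa [hp0], hlt⟩

end


/-! ### Active edges in terms of incidence -/

/-- A description of active edges without neighbourhoods: all segments that contain `q` are to the
left of the line of sight. -/
structure Act (S : Set Seg) (s : Seg) (σ : ℝ) (p q : Plane) (t : Seg) : Prop where
  mem_endpoints : q ∈ endpoints S
  side : 0 < height s σ q
  free : Avoids S (openSegment ℝ p q)
  left : ∀ t' ∈ S, q ∈ t'.carrier → ∀ e ∈ t'.carrier, e ≠ q → 0 < σ * cross p q e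
  mem : t ∈ S
  hit : ∃ y ∈ t.carrier, q ∈ openSegment ℝ p y ∧ Avoids S (openSegment ℝ q y)

section

variable {S : Set Seg} {s : Seg} {σ : ℝ} {p q : Plane} {t : Seg}

theorem cross_of_mem_openSegment {p q z : Plane} (h : q ∈ openSegment ℝ p z) :
    ∃ b : ℝ, 0 < b ∧ b < 1 ∧ q = (1 - b) • p + b • z ∧ ∀ e, cross p q e = b * cross p z e := by
  obtain ⟨a, b, ha, hb, hab, rfl⟩ := h
  obtain rfl : a = 1 - b := by linarith
  refine ⟨b, hb, by linarith, rfl, fun e => ?_⟩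
  simp only [cross, Prod.fst_add, Prod.snd_add, Prod.smul_fst, Prod.smul_snd, smul_eq_mul]
  ring

/-- Nothing on a segment through `q` is below `q` on the line of sight. -/
theorem height_le_of_free (hS : Scene S s σ) (hp : p ∈ s.carrier) (hq : 0 < height s σ q)
    (hf : Avoids S (openSegment ℝ p q)) {t' : Seg} (ht' : t' ∈ S) (hqt : q ∈ t'.carrier) {e : Plane}
    (he : e ∈ t'.carrier) (h0 : cross p q e = 0) : height s σ q ≤ height s σ e := by
  by_contra! hlt
  have hp0 := height_eq_zero (σ := σ) hp
  have hab : height s σ p < height s σ q := by rwa [hp0]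
  rcases le_or_gt (height s σ e) (height s σ p) with h | h
  · refine hS.notMem_others hp ⟨t', ht', ?_,
      mem_carrier_of_between hab he hqt h0 (by simp) (by simp) h hab.le⟩
    rintro rfl
    exact hq.ne' (height_eq_zero hqt)
  · exact hf.notMem ht' ((mem_openSegment_iff hab).2 ⟨h0, h, hlt⟩) he

theorem Act.line (h : Act S s σ p q t) (hp : p ∈ s.carrier) : height s σ p < height s σ q := by
  rw [height_eq_zero hp]; exact h.side

/-- At an inner point of `t'`, the zero orientation of `q` would be a positive combination of the
positive orientations of the two ends. -/
theorem Act.mem_ends (h : Act S s σ p q t) {t' : Seg} (ht' : t' ∈ S)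
    (hq : q ∈ t'.carrier) : q ∈ t'.ends := by
  by_contra hqe
  have hi := Seg.mem_inner_of_notMem_ends hq hqe
  have h1 := h.left t' ht' hq t'.left t'.left_mem (by rintro rfl; exact t'.left_notMem_inner hi)
  have h2 := h.left t' ht' hq t'.right t'.right_mem (by rintro rfl; exact t'.right_notMem_inner hi)
  obtain ⟨a, b, ha, hb, hab, hab'⟩ := hi
  have h3 : cross p q q = 0 := by simp
  nth_rw 2 [← hab'] at h3
  rw [cross_comb _ _ _ _ hab] at h3
  have h4 : σ * (a * cross p q t'.left + b * cross p q t'.right) = 0 := by rw [h3, mul_zero]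
  have := mul_pos ha h1
  have := mul_pos hb h2
  linarith

/-- Heights along the line of sight. -/
theorem height_lt_of_mem_openSegment (hp : p ∈ s.carrier) (hq : 0 < height s σ q) {y : Plane}
    (hqy : q ∈ openSegment ℝ p y) : height s σ q < height s σ y ∧ cross p q y = 0 := by
  have hp0 := height_eq_zero (σ := σ) hp
  obtain ⟨a, b, ha, hb, hab, rfl⟩ := hqy
  rw [height_comb _ _ _ _ hab, hp0, mul_zero, zero_add] at *
  have := pos_of_mul_pos_right hq hb.le
  refine ⟨by nlinarith, ?_⟩
  rw [cross_swap, cross_comb _ _ _ _ hab]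
  simp

/-- Otherwise the point of `t` beyond `q` on the line of sight would also be strictly to the left of
this line. -/
theorem Act.notMem (h : Act S s σ p q t) (hp : p ∈ s.carrier) : q ∉ t.carrier := by
  intro hq
  obtain ⟨y, hy, hqy, -⟩ := h.hit
  obtain ⟨h1, h2⟩ := height_lt_of_mem_openSegment hp h.side hqy
  have := h.left t h.mem hq y hy (by rintro rfl; exact lt_irrefl _ h1)
  simp [h2] at this

theorem mem_openSegment_of_height_lt (hp : p ∈ s.carrier) (hq : 0 < height s σ q) {y : Plane}
    (h0 : cross p q y = 0) (h1 : height s σ q < height s σ y) : q ∈ openSegment ℝ p y := by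
  have hp0 := height_eq_zero (σ := σ) hp
  exact (mem_openSegment_iff (by rw [hp0]; linarith)).2 ⟨by rw [cross_swap, h0, neg_zero], by rwa [hp0], h1⟩

/-- The line of sight beyond `q` is free. -/
theorem disjoint_segment_beyond (hp : p ∈ s.carrier) (hq : 0 < height s σ q)
    (hf : Avoids S (openSegment ℝ p q)) {y : Plane} (hqy : q ∈ openSegment ℝ p y)
    (hA : Avoids S (openSegment ℝ q y)) (hS : Scene S s σ)
    {z : Plane} (hz : z ∈ openSegment ℝ q y) {t' : Seg} (ht' : t' ∈ S) (hts : t' ≠ s)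
    (hqt : q ∉ t'.carrier) : Disjoint (segment ℝ p z) t'.carrier := by
  have hp0 := height_eq_zero (σ := σ) hp
  obtain ⟨h1, h2⟩ := height_lt_of_mem_openSegment hp hq hqy
  obtain ⟨k0, k1, k2⟩ := (mem_openSegment_iff h1).1 hz
  have hpq : height s σ p < height s σ q := by rwa [hp0]
  have hpz : height s σ p < height s σ z := hpq.trans k1
  have hzl : cross p q z = 0 := cross_eq_zero_of_line h1
    (cross_eq_zero_of_line hpq (by simp) h2 (by simp)) (by simp) k0
  rw [Set.disjoint_left]
  intro w hw hwt
  obtain ⟨w0, w1, w2⟩ := (mem_segment_iff hpz).1 hw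
  have hwl : cross p q w = 0 := cross_eq_zero_of_line hpz (by simp)
    (by rw [cross_swap, hzl, neg_zero]) w0
  rcases w1.eq_or_lt with h | h
  · rw [← eq_of_height_eq hpq (by simp) hwl h] at hwt
    exact hS.notMem_others hp ⟨t', ht', hts, hwt⟩
  rcases lt_trichotomy (height s σ w) (height s σ q) with h' | h' | h'
  · exact hf.notMem ht' ((mem_openSegment_iff hpq).2 ⟨hwl, h, h'⟩) hwt
  · rw [eq_of_height_eq hpq hwl (by simp) h'] at hwt
    exact hqt hwt
  · exact hA.notMem ht' ((mem_openSegment_iff h1).2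
      ⟨cross_eq_zero_of_line hpq (by simp) h2 hwl, h', by linarith⟩) hwt

/-- Points of a segment that starts at `q` and leads to the left, close to `q`. -/
theorem exists_near_end {t' : Seg} {e : Plane} (hq : q ∈ t'.carrier) (he : e ∈ t'.carrier)
    (h : 0 < σ * cross p q e) {U : Set Plane} (hU : U ∈ 𝓝 q) :
    ∃ e' ∈ t'.carrier, e' ∈ U ∧ 0 < σ * cross p q e' := by
  have hc : Continuous fun ν : ℝ => (1 - ν) • q + ν • e := by fun_prop
  have hev : ∀ᶠ ν : ℝ in 𝓝[>] 0, (1 - ν) • q + ν • e ∈ U := by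
    refine nhdsWithin_le_nhds (hc.continuousAt.preimage_mem_nhds ?_)
    simpa using hU
  obtain ⟨ν, h1, h2⟩ := (hev.and (Ioo_mem_nhdsGT (show (0 : ℝ) < 1 by norm_num))).exists
  refine ⟨_, t'.convex hq he (by linarith [h2.2]) h2.1.le (by ring), h1, ?_⟩
  rw [cross_comb _ _ _ _ (by ring)]
  simp only [cross_self_right, mul_zero, zero_add]
  have := mul_pos h2.1 h
  linarith

theorem sees_iff_of_pos (hp : p ∈ s.carrier) {x : Plane} (hx : 0 < height s σ x) :
    Sees S p x ↔ Avoids S (openSegment ℝ p x) := by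
  refine ⟨fun h => h.resolve_left ?_, Or.inr⟩
  rintro rfl
  exact hx.ne' (height_eq_zero hp)

/-- A segment at `q` along the line of sight would either run down into the free part `pq` or cover
a part of the free edge `qy`; one that leads to the right would hide points just to the right of
`qy`. -/
theorem Active.act (hS : Scene S s σ) (hp : p ∈ s.carrier) (h : Active S s σ p q t) :
    Act S s σ p q t := by
  obtain ⟨hq, hside, hsee, ht, y, hyt, hqy, hA, hev⟩ := h
  have hside' : 0 < height s σ q := hside
  have hfree := (sees_iff_of_pos hp hside').1 hsee
  refine ⟨hq, hside, hfree, ?_, ht, y, hyt, hqy, hA⟩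
  intro t' ht' hqt e he hne
  have hp0 := height_eq_zero (σ := σ) hp
  have hpq : height s σ p < height s σ q := by rwa [hp0]
  obtain ⟨h1, h2⟩ := height_lt_of_mem_openSegment hp hside' hqy
  by_contra! hle
  rcases hle.eq_or_lt with h | h
  · have h0 : cross p q e = 0 := (mul_eq_zero.1 h).resolve_left hS.side_ne_zero
    have h3 := height_le_of_free hS hp hside' hfree ht' hqt he h0
    have h4 : height s σ q < height s σ e := lt_of_le_of_ne h3 fun h =>
      hne (eq_of_height_eq hpq h0 (by simp) h.symm)
    rcases lt_or_ge (height s σ e) (height s σ y) with h5 | h5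
    · exact hA.notMem ht' ((mem_openSegment_iff h1).2
        ⟨cross_eq_zero_of_line hpq (by simp) h2 h0, h4, h5⟩) he
    · have hy' := mem_carrier_of_between hpq hqt he (by simp) h2 h0 h1.le h5
      have hm : midpoint ℝ q y ∈ openSegment ℝ q y :=
        ⟨1 / 2, 1 / 2, by norm_num, by norm_num, by norm_num, by
          rw [midpoint_eq_smul_add, smul_add]; norm_num⟩
      exact hA.notMem ht' hm (t'.convex.openSegment_subset hqt hy' hm)
  -- Here `e` is on the right. A point `z` of the edge is shifted by `ν • (e - q)`. The shifted
  -- point is on the right, but its line of sight meets `t'` in the point of `qe` with parameter `b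
  -- * ν`, where `b` is the parameter of `q` on `pz`.
  · have hm : (2⁻¹ : ℝ) • q + (2⁻¹ : ℝ) • y ∈ openSegment ℝ q y :=
      ⟨_, _, by norm_num, by norm_num, by norm_num, rfl⟩
    obtain ⟨k0, k1, k2⟩ := (mem_openSegment_iff h1).1 hm
    have hz := hev _ hm
    set z := (2⁻¹ : ℝ) • q + (2⁻¹ : ℝ) • y
    have hzl : cross p q z = 0 := cross_eq_zero_of_line h1
      (cross_eq_zero_of_line hpq (by simp) h2 (by simp)) (by simp) k0
    have hqz := mem_openSegment_of_height_lt hp hside' hzl k1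
    obtain ⟨b, hb0, hb1, hqb, hcr⟩ := cross_of_mem_openSegment hqz
    have hc : Continuous fun ν : ℝ => z + ν • (e - q) := by fun_prop
    have hev' : ∀ᶠ ν : ℝ in 𝓝[>] 0, σ * cross p q (z + ν • (e - q)) < 0 →
        Sees S p (z + ν • (e - q)) := by
      have : Tendsto (fun ν : ℝ => z + ν • (e - q)) (𝓝[>] 0) (𝓝 z) := by
        refine tendsto_nhdsWithin_of_tendsto_nhds ?_
        simpa using hc.tendsto 0
      exact (this.eventually hz).mono fun ν h => h.1
    obtain ⟨ν, h5, h6⟩ := (hev'.and (Ioo_mem_nhdsGT (show (0 : ℝ) < 1 by norm_num))).exists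
    have hcrν : cross p q (z + ν • (e - q)) = ν * cross p q e := by
      have : cross p q (z + ν • (e - q)) = cross p q z + ν * cross p q e := by
        simp only [cross, Prod.fst_add, Prod.snd_add, Prod.smul_fst, Prod.smul_snd, smul_eq_mul,
          Prod.fst_sub, Prod.snd_sub]
        ring
      rw [this, hzl, zero_add]
    have h7 : σ * cross p q (z + ν • (e - q)) < 0 := by
      rw [hcrν]; nlinarith [h6.1]
    have h8 : Avoids S (openSegment ℝ p (z + ν • (e - q))) := by
      refine (h5 h7).resolve_left ?_
      intro h9
      rw [← h9] at h7
      simp at h7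
    refine h8.notMem ht' (z := (1 - b) • p + b • (z + ν • (e - q)))
      ⟨1 - b, b, by linarith, hb0, by ring, rfl⟩ ?_
    have h10 : (1 - b) • p + b • (z + ν • (e - q)) = (1 - b * ν) • q + (b * ν) • e := by
      have : (1 - b) • p + b • (z + ν • (e - q)) = ((1 - b) • p + b • z) + (b * ν) • (e - q) := by
        module
      rw [this, ← hqb]
      module
    rw [h10]
    exact t'.convex hqt he (by nlinarith [h6.1, h6.2]) (by nlinarith [h6.1]) (by ring)

/-- To the right of the edge nothing blocks: segments at `q` are on the left, and all others keep a
distance from the closed line of sight. To the left, a single segment at `q` blocks everything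
nearby. -/
theorem Act.active (hS : Scene S s σ) (hp : p ∈ s.carrier) (h : Act S s σ p q t) :
    Active S s σ p q t := by
  obtain ⟨y, hyt, hqy, hA⟩ := h.hit
  refine ⟨h.mem_endpoints, h.side, Or.inr h.free, h.mem, y, hyt, hqy, hA, ?_⟩
  intro z hz
  have hp0 := height_eq_zero (σ := σ) hp
  have hpq := h.line hp
  obtain ⟨h1, h2⟩ := height_lt_of_mem_openSegment hp h.side hqy
  obtain ⟨k0, k1, k2⟩ := (mem_openSegment_iff h1).1 hz
  have hzl : cross p q z = 0 := cross_eq_zero_of_line h1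
    (cross_eq_zero_of_line hpq (by simp) h2 (by simp)) (by simp) k0
  have hqz := mem_openSegment_of_height_lt hp h.side hzl k1
  have hxq : ∀ᶠ x in 𝓝 z, height s σ q < height s σ x :=
    eventually_lt_of_continuous (by fun_prop) (by fun_prop) k1
  have hfar : ∀ᶠ x in 𝓝 z, ∀ t' ∈ S, t' ≠ s → q ∉ t'.carrier →
      Disjoint (segment ℝ p x) t'.carrier := by
    rw [eventually_all_finite hS.finite]
    intro t' ht'
    by_cases hts : t' = s ∨ q ∈ t'.carrier
    · exact Eventually.of_forall fun x h1 h2 => by tauto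
    · push Not at hts
      have := eventually_disjoint t'.isClosed
        (disjoint_segment_beyond hp h.side h.free hqy hA hS hz ht' hts.1 hts.2)
      have hc : Continuous fun x : Plane => (p, x) := by fun_prop
      exact ((hc.tendsto z).eventually this).mono fun x hx _ _ => hx
  obtain ⟨t', ht', hqe⟩ := h.mem_endpoints
  obtain ⟨e, he, hne, -⟩ := Seg.exists_other_end hqe
  have hU : {x | 0 < height s σ x ∧ height s σ x < height s σ z} ∈ 𝓝 q := by
    have k3 : ∀ᶠ x in 𝓝 q, 0 < height s σ x :=
      eventually_lt_of_continuous (by fun_prop) (by fun_prop) h.side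
    have k4 : ∀ᶠ x in 𝓝 q, height s σ x < height s σ z :=
      eventually_lt_of_continuous (by fun_prop) (by fun_prop) k1
    exact k3.and k4
  obtain ⟨e', he't, ⟨hu1, hu2⟩, he'⟩ := exists_near_end (t'.ends_subset hqe) (t'.ends_subset he)
    (h.left t' ht' (t'.ends_subset hqe) e (t'.ends_subset he) hne) hU
  obtain ⟨b, hb0, hb1, hqb, hcr⟩ := cross_of_mem_openSegment hqz
  have hez : 0 < σ * cross p z e' := by
    rw [hcr] at he'
    have : 0 < b * (σ * cross p z e') := by linarith
    exact pos_of_mul_pos_right this hb0.le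
  have hex : ∀ᶠ x in 𝓝 z, 0 < σ * cross p x e' :=
    eventually_lt_of_continuous (by fun_prop) (by fun_prop) hez
  have hehx : ∀ᶠ x in 𝓝 z, height s σ e' < height s σ x :=
    eventually_lt_of_continuous (by fun_prop) (by fun_prop) hu2
  filter_upwards [hxq, hfar, hex, hehx] with x hxq hfar hex hehx
  have hx0 : 0 < height s σ x := h.side.trans hxq
  constructor
  · intro hright
    refine Or.inr fun t'' ht'' => ?_
    by_cases hts : t'' = s
    · subst hts
      rw [Set.disjoint_left]
      intro w hw hwt
      exact (height_pos_of_mem_openSegment hp0.ge hx0 hw).ne' (height_eq_zero hwt)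
    by_cases hqt : q ∈ t''.carrier
    · rw [Set.disjoint_left]
      rintro w ⟨a, c, ha, hc, hac, rfl⟩ hwt
      have h3 : 0 ≤ σ * cross p q (a • p + c • x) := by
        by_cases hwq : a • p + c • x = q
        · rw [hwq]; simp
        · exact (h.left t'' ht'' hqt _ hwt hwq).le
      rw [cross_comb _ _ _ _ hac] at h3
      simp only [cross_self_outer, mul_zero, zero_add] at h3
      have := mul_pos_of_neg_of_neg hright (neg_neg_of_pos hc)
      linarith
    · exact (hfar t'' ht'' hts hqt).mono_left (openSegment_subset_segment ..)
  -- Seen from `p`, `x` has `q` on its right and `e'` on its left, both lower than `x`, so the line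
  -- of sight to `x` crosses the segment through `q` and `e'`.
  · intro hleft hsee
    obtain ⟨w, hw, -, hw'⟩ := not_disjoint_of_sides (s := s) (σ := σ) (a := p) (b := x) t'.convex
      (t'.ends_subset hqe) he't (by rw [hp0]; exact h.side) (by rwa [hp0]) hxq hehx
      (by rw [cross_swap]; linarith) hex
    exact ((sees_iff_of_pos hp hx0).1 hsee).notMem ht' hw' hw

theorem active_iff (hS : Scene S s σ) (hp : p ∈ s.carrier) :
    Active S s σ p q t ↔ Act S s σ p q t :=
  ⟨Active.act hS hp, Act.active hS hp⟩

end


/-! ### Persistence and limits of active edges -/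

section

variable {S : Set Seg} {s : Seg} {σ : ℝ} {p q : Plane} {t : Seg}

/-- The condition on the segments at `q` persists when the viewpoint moves. -/
theorem Act.eventually_left (hS : Scene S s σ) (h : Act S s σ p q t) :
    ∀ᶠ p' in 𝓝 p, ∀ t' ∈ S, q ∈ t'.carrier → ∀ e ∈ t'.carrier, e ≠ q → 0 < σ * cross p' q e := by
  rw [eventually_all_finite hS.finite]
  intro t' ht'
  by_cases hqt : q ∈ t'.carrier
  swap
  · exact Eventually.of_forall fun _ h => absurd h hqt
  -- Since `q` is an end of `t'`, the single condition at the other end gives the condition on all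
  -- of `t'`.
  obtain ⟨e, he, hne, hseg⟩ := Seg.exists_other_end (h.mem_ends ht' hqt)
  have : ∀ᶠ p' in 𝓝 p, 0 < σ * cross p' q e :=
    eventually_lt_of_continuous (by fun_prop) (by fun_prop)
      (h.left t' ht' hqt e (t'.ends_subset he) hne)
  filter_upwards [this] with p' hp' _ x hx hxq
  rw [← hseg] at hx
  obtain ⟨a, b, ha, hb, hab, rfl⟩ := hx
  rw [cross_comb _ _ _ _ hab, cross_self_right, mul_zero, zero_add]
  rcases hb.eq_or_lt with rfl | hb
  · obtain rfl : a = 1 := by linarith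
    simp at hxq
  · have := mul_pos hb hp'
    linarith

/-- Segments that avoid `q` are at positive distance from the closed line of sight, and segments at
`q` stay to its left. -/
theorem Act.eventually_free (hS : Scene S s σ) (hp : p ∈ s.carrier) (h : Act S s σ p q t) :
    ∀ᶠ p' in 𝓝 p, p' ∈ s.carrier → Avoids S (openSegment ℝ p' q) := by
  have hpq := h.line hp
  have h1 : ∀ᶠ p' in 𝓝 p, ∀ t' ∈ S, t' ≠ s → q ∉ t'.carrier →
      Disjoint (segment ℝ p' q) t'.carrier := by
    rw [eventually_all_finite hS.finite]
    intro t' ht'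
    by_cases hts : t' = s ∨ q ∈ t'.carrier
    · exact Eventually.of_forall fun x h1 h2 => by tauto
    push Not at hts
    have hd : Disjoint (segment ℝ p q) t'.carrier := by
      rw [← insert_endpoints_openSegment, Set.disjoint_left]
      rintro w (rfl | rfl | hw) hwt
      · exact hS.notMem_others hp ⟨t', ht', hts.1, hwt⟩
      · exact hts.2 hwt
      · exact h.free.notMem ht' hw hwt
    have hc : Continuous fun x : Plane => (x, q) := by fun_prop
    exact ((hc.tendsto p).eventually (eventually_disjoint t'.isClosed hd)).mono fun x hx _ _ => hx
  filter_upwards [h1, h.eventually_left hS] with p' h1 h2 hp'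
  have hp'0 := height_eq_zero (σ := σ) hp'
  have hp'q : height s σ p' < height s σ q := by rw [hp'0]; exact h.side
  intro t' ht'
  by_cases hts : t' = s
  · subst hts
    rw [Set.disjoint_left]
    intro w hw hwt
    exact (height_pos_of_mem_openSegment hp'0.ge h.side hw).ne' (height_eq_zero hwt)
  by_cases hqt : q ∈ t'.carrier
  · rw [Set.disjoint_left]
    intro w hw hwt
    obtain ⟨k0, k1, k2⟩ := (mem_openSegment_iff hp'q).1 hw
    have := h2 t' ht' hqt w hwt (by rintro rfl; exact lt_irrefl _ k2)
    simp [k0] at this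
  · exact (h1 t' ht' hts hqt).mono_left (openSegment_subset_segment ..)

/-- An active edge persists when the viewpoint moves, unless its upper end is an endpoint. -/
theorem Act.eventually (hS : Scene S s σ) (hp : p ∈ s.carrier) (h : Act S s σ p q t)
    {y : Plane} (hyt : y ∈ t.carrier) (hqy : q ∈ openSegment ℝ p y)
    (hA : Avoids S (openSegment ℝ q y)) (hy : y ∉ endpoints S) :
    ∀ᶠ p' in 𝓝 p, p' ∈ s.carrier → Act S s σ p' q t := by
  have hp0 := height_eq_zero (σ := σ) hp
  have hpq := h.line hp
  obtain ⟨h1, h2⟩ := height_lt_of_mem_openSegment hp h.side hqy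
  have hyi : ∀ t' ∈ S, y ∈ t'.carrier → y ∈ t'.inner := fun t' ht' hyt' =>
    Seg.mem_inner_of_notMem_ends hyt' fun h => hy ⟨t', ht', h⟩
  -- If `t` ran along the line of sight, its lower end would be met before `y`, or `q` would be on
  -- `t`.
  have hl : cross p q t.left ≠ 0 := by
    intro hl
    have hye : y ∉ t.ends := fun h' => hy ⟨t, h.mem, h'⟩
    have hr : cross p q t.right = 0 := by
      refine Seg.cross_eq_zero_of_two t.left_mem hyt ?_ hl h2 t.right_mem
      rintro rfl
      exact hye (Or.inl rfl)
    obtain ⟨c, hc, hcy, hc0⟩ := exists_lower_end hpq hyt hye hl hr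
    rcases le_or_gt (height s σ c) (height s σ q) with h' | h'
    · exact h.notMem hp (mem_carrier_of_between hpq (t.ends_subset hc) hyt hc0 (by simp) h2 h' h1.le)
    · exact hA.notMem h.mem ((mem_openSegment_iff h1).2
        ⟨cross_eq_zero_of_line hpq (by simp) h2 hc0, h', hcy⟩) (t.ends_subset hc)
  have hU1 : ∀ᶠ y' in 𝓝 y, height s σ q < height s σ y' :=
    eventually_lt_of_continuous (by fun_prop) (by fun_prop) h1
  have hU2 : ∀ᶠ y' in 𝓝 y, ∀ t' ∈ S, t' ≠ t → q ∉ t'.carrier →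
      Disjoint (segment ℝ q y') t'.carrier := by
    rw [eventually_all_finite hS.finite]
    intro t' ht'
    by_cases hts : t' = t ∨ q ∈ t'.carrier
    · exact Eventually.of_forall fun x h1 h2 => by tauto
    push Not at hts
    have hd : Disjoint (segment ℝ q y) t'.carrier := by
      rw [← insert_endpoints_openSegment, Set.disjoint_left]
      rintro w (rfl | rfl | hw) hwt
      · exact hts.2 hwt
      · exact Set.disjoint_left.1 (hS.inner_disjoint ht' h.mem hts.1) (hyi t' ht' hwt)
          (hyi t h.mem hyt)
      · exact hA.notMem ht' hw hwt
    have hc : Continuous fun x : Plane => (q, x) := by fun_prop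
    exact ((hc.tendsto y).eventually (eventually_disjoint t'.isClosed hd)).mono fun x hx _ _ => hx
  obtain ⟨ε, hε, hball⟩ := Metric.eventually_nhds_iff_ball.1 (hU1.and hU2)
  obtain ⟨c, hc, d, hd, hcU, hdU, hcs, hds⟩ := t.exists_sides hS.side_ne_zero (hyi t h.mem hyt) h2 hl
    (Metric.ball_mem_nhds y hε)
  have k1 : ∀ᶠ p' in 𝓝 p, σ * cross p' q c < 0 :=
    eventually_lt_of_continuous (by fun_prop) (by fun_prop) hcs
  have k2 : ∀ᶠ p' in 𝓝 p, 0 < σ * cross p' q d :=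
    eventually_lt_of_continuous (by fun_prop) (by fun_prop) hds
  filter_upwards [k1, k2, h.eventually_left hS, h.eventually_free hS hp] with p' k1 k2 k3 k4 hp'
  have hp'q : height s σ p' < height s σ q := by rw [height_eq_zero hp']; exact h.side
  refine ⟨h.mem_endpoints, h.side, k4 hp', k3, h.mem, ?_⟩
  -- The new upper end: `c` and `d` are points of `t` near `y` that the line through `p'` and `q`
  -- still separates.
  obtain ⟨y', hy', hy'0⟩ := exists_cross_eq_zero k1 k2
  have hy'U := (convex_ball y ε).segment_subset hcU hdU hy'
  obtain ⟨l1, l2⟩ := hball y' hy'U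
  have hy't := t.convex.segment_subset hc hd hy'
  refine ⟨y', hy't, mem_openSegment_of_height_lt hp' h.side hy'0 l1, fun t' ht' => ?_⟩
  by_cases hqt : q ∈ t'.carrier
  · rw [Set.disjoint_left]
    intro w hw hwt
    obtain ⟨m0, m1, m2⟩ := (mem_openSegment_iff l1).1 hw
    have := k3 t' ht' hqt w hwt (by rintro rfl; exact lt_irrefl _ m1)
    rw [cross_eq_zero_of_line l1 (cross_eq_zero_of_line hp'q (by simp) hy'0 (by simp)) (by simp) m0,
      mul_zero] at this
    exact lt_irrefl _ this
  by_cases htt : t' = t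
  · subst htt
    rw [Set.disjoint_left]
    intro w hw hwt
    obtain ⟨m0, m1, m2⟩ := (mem_openSegment_iff l1).1 hw
    have := Seg.cross_eq_zero_of_two hwt hy't (by rintro rfl; exact lt_irrefl _ m2)
      (cross_eq_zero_of_line l1 (cross_eq_zero_of_line hp'q (by simp) hy'0 (by simp)) (by simp) m0)
      hy'0 hc
    simp [this] at k1
  · exact (l2 t' ht' htt hqt).mono_left (openSegment_subset_segment ..)

/-- An edge of the extended visibility graph from `p` points to `q`. -/
def HitsPoint (S : Set Seg) (s : Seg) (σ : ℝ) (p q : Plane) : Prop :=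
  ∃ x, EVGEdge S p x ∧ 0 < height s σ x ∧ cross p q x = 0

theorem sameRay_iff (hp : p ∈ s.carrier) (hq : 0 < height s σ q) {x : Plane}
    (hx : 0 < height s σ x) : SameRay ℝ (x - p) (q - p) ↔ cross p q x = 0 := by
  have hp0 := height_eq_zero (σ := σ) hp
  constructor
  · intro h
    have key : ∀ a b : ℝ, a • (x - p) = b • (q - p) → a * cross p q x = 0 := by
      intro a b hab
      have h1 := congrArg Prod.fst hab
      have h2 := congrArg Prod.snd hab
      simp only [Prod.smul_fst, Prod.smul_snd, Prod.fst_sub, Prod.snd_sub, smul_eq_mul] at h1 h2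
      simp only [cross]
      linear_combination (q.1 - p.1) * h2 - (q.2 - p.2) * h1
    rcases h with h | h | ⟨a, b, ha, hb, hab⟩
    · simpa using key 1 0 (by simpa using h)
    · obtain rfl := sub_eq_zero.1 h
      simp
    · exact (mul_eq_zero.1 (key a b hab)).resolve_left ha.ne'
  · intro h
    have h1 := eq_of_cross_eq_zero (s := s) (σ := σ) (by rwa [hp0]) h
    rw [hp0, sub_zero, sub_zero] at h1
    have h2 : x - p = (height s σ x / height s σ q) • (q - p) := by
      nth_rw 1 [h1]
      module
    rw [h2]
    exact SameRay.sameRay_pos_smul_left _ (by positivity)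

theorem hits_iff {τ : ℝ} (hτ : τ ∈ Icc (0 : ℝ) 1) (hq : 0 < height s σ q) :
    Hits S s σ τ q ↔ HitsPoint S s σ (s.pt τ) q := by
  constructor
  · rintro ⟨x, h1, h2, h3⟩
    exact ⟨x, h1, h2, (sameRay_iff (s.pt_mem hτ) hq h2).1 h3⟩
  · rintro ⟨x, h1, h2, h3⟩
    exact ⟨x, h1, h2, (sameRay_iff (s.pt_mem hτ) hq h2).2 h3⟩

theorem exists_evgEdge_hits (hp : p ∈ s.carrier) {r : Plane}
    (hr : cross p q r = 0) (hr0 : 0 < height s σ r)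
    (h : ∃ x ∈ openSegment ℝ p r, EVGEdge S p x) : HitsPoint S s σ p q := by
  have hp0 := height_eq_zero (σ := σ) hp
  obtain ⟨x, hx, he⟩ := h
  obtain ⟨k0, k1, k2⟩ := (mem_openSegment_iff (by rwa [hp0])).1 hx
  exact ⟨x, he, by rwa [← hp0], cross_eq_zero_of_line (s := s) (σ := σ) (a := p) (b := r)
    (by rwa [hp0]) (by simp) (by rw [cross_swap, hr, neg_zero]) k0⟩

/-- If the upper end `y` were an endpoint, `yq` would be a visibility graph edge whose extension
beyond `q` ends at `p`: a hit. -/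
theorem Act.eventually_of_not_hits (hS : Scene S s σ) (hp : p ∈ s.carrier) (h : Act S s σ p q t)
    (hn : ¬ HitsPoint S s σ p q) : ∀ᶠ p' in 𝓝 p, p' ∈ s.carrier → Act S s σ p' q t := by
  obtain ⟨y, hyt, hqy, hA⟩ := h.hit
  refine h.eventually hS hp hyt hqy hA fun hy => hn ?_
  have h1 := (height_lt_of_mem_openSegment hp h.side hqy).1
  refine ⟨q, evgEdge_of_extension hS hp (u := y) ⟨?_, hy, h.mem_endpoints, Or.inl ?_⟩ hqy h.free,
    h.side, by simp⟩
  · rintro rfl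
    exact lt_irrefl _ h1
  · rwa [openSegment_symm]

/-- The limit of a sequence of active edges. -/
theorem exists_limit (hS : Scene S s σ) (hp : p ∈ s.carrier)
    (h : ∃ᶠ p' in 𝓝 p, p' ∈ s.carrier ∧ Act S s σ p' q t) :
    ∃ y ∈ t.carrier, q ∈ openSegment ℝ p y ∧ (∀ t' ∈ S, NoCross p q t') ∧
      (∀ t' ∈ S, NoCross q y t') ∧
      ∀ t' ∈ S, q ∈ t'.carrier → ∀ e ∈ t'.carrier, 0 ≤ σ * cross p q e := by
  have hp0 := height_eq_zero (σ := σ) hp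
  obtain ⟨v, hv, hvA⟩ := exists_seq_forall_of_frequently h
  choose hvs hvA using hvA
  choose y hyt hqy hA using fun n => (hvA n).hit
  obtain ⟨y0, hy0, φ, hφ, hlim⟩ := t.isCompact.tendsto_subseq hyt
  have hvφ : Tendsto (v ∘ φ) atTop (𝓝 p) := hv.comp hφ.tendsto_atTop
  have hside := (hvA 0).side
  have hpq : height s σ p < height s σ q := by rwa [hp0]
  have hqt := (hvA 0).notMem (hvs 0)
  have hc0 : cross p q y0 = 0 := by
    have hc : Continuous fun w : Plane × Plane => cross w.1 q w.2 := by fun_prop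
    have h1 := (hc.tendsto (p, y0)).comp (hvφ.prodMk_nhds hlim)
    refine tendsto_nhds_unique h1 ((tendsto_congr fun n => ?_).2 tendsto_const_nhds)
    exact (height_lt_of_mem_openSegment (hvs _) hside (hqy _)).2
  have hle : height s σ q ≤ height s σ y0 := by
    have hc : Continuous fun w : Plane => height s σ w := by fun_prop
    refine le_of_tendsto_of_tendsto' tendsto_const_nhds ((hc.tendsto y0).comp hlim) fun n => ?_
    exact (height_lt_of_mem_openSegment (hvs _) hside (hqy _)).1.le
  -- The limit edge does not shrink to a point, because `t` is closed and misses `q`.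
  have hlt : height s σ q < height s σ y0 := lt_of_le_of_ne hle fun h' =>
    hqt (by rwa [eq_of_height_eq hpq (by simp) hc0 h'])
  refine ⟨y0, hy0, mem_openSegment_of_height_lt hp hside hc0 hlt, ?_, ?_, ?_⟩
  · intro t' ht'
    refine noCross_of_frequently hS.side_ne_zero hpq ?_
    have h1 : Tendsto (fun n => (v n, q)) atTop (𝓝 (p, q)) := hv.prodMk_nhds tendsto_const_nhds
    exact h1.frequently (Eventually.of_forall fun n => (hvA n).free t' ht').frequently
  · intro t' ht'
    refine noCross_of_frequently hS.side_ne_zero hlt ?_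
    have h1 : Tendsto (fun n => (q, (y ∘ φ) n)) atTop (𝓝 (q, y0)) :=
      tendsto_const_nhds.prodMk_nhds hlim
    exact h1.frequently (Eventually.of_forall fun n => hA (φ n) t' ht').frequently
  · intro t' ht' hqt' e he
    have hc : Continuous fun w : Plane => σ * cross w q e := by fun_prop
    refine ge_of_tendsto' ((hc.tendsto p).comp hv) fun n => ?_
    by_cases heq : e = q
    · simp [heq]
    · exact ((hvA n).left t' ht' hqt' e he heq).le

/-- A limit of active edges is active, or there is an edge of the extended visibility graph on its
line of sight. -/
theorem act_of_frequently (hS : Scene S s σ) (hp : p ∈ s.carrier)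
    (h : ∃ᶠ p' in 𝓝 p, p' ∈ s.carrier ∧ Act S s σ p' q t) (hn : ¬ HitsPoint S s σ p q) :
    Act S s σ p q t := by
  have hp0 := height_eq_zero (σ := σ) hp
  obtain ⟨y, hyt, hqy, hn1, hn2, hle⟩ := exists_limit hS hp h
  obtain ⟨p', hp', hact⟩ := h.exists
  have hside := hact.side
  have hpq : height s σ p < height s σ q := by rwa [hp0]
  obtain ⟨h1, h2⟩ := height_lt_of_mem_openSegment hp hside hqy
  -- The first obstacle below `q` would be an endpoint, since proper crossings are excluded in the
  -- limit. Together with `q` it produces a hit.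
  have hfree : Avoids S (openSegment ℝ p q) := by
    intro t' ht'
    rw [Set.disjoint_left]
    intro z hz hzt
    have hz0 := height_pos_of_mem_openSegment hp0.ge hside hz
    obtain ⟨r, hr, hr0, ⟨t'', ht'', hrt⟩, hA⟩ := hS.exists_first_hit hp hz0 ht' hzt
    have hro : r ∈ openSegment ℝ p q := by
      obtain ⟨k0, k1, k2⟩ := (mem_openSegment_iff hpq).1 hz
      obtain ⟨l0, l1, l2⟩ := (mem_segment_iff (by rwa [hp0])).1 hr
      exact (mem_openSegment_iff hpq).2 ⟨cross_eq_zero_of_line k1 (by simp)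
        (by rw [cross_swap, k0, neg_zero]) l0, by rwa [hp0], by linarith⟩
    have hre := (hn1 t'' ht'').mem_ends hpq (fun hpt => hS.notMem_others hp ⟨t'', ht'', by
      rintro rfl; exact hr0.ne' (height_eq_zero hrt), hpt⟩) hrt hro (hA t'' ht'')
    exact hn (exists_evgEdge_hits hp (by simp) hside
      (hS.exists_evgEdge hp ⟨t'', ht'', hre⟩ hact.mem_endpoints hside hro hn1))
  -- In the limit only `0 ≤` survives. Equality means that a segment at `q` runs up the line of
  -- sight; its extension beyond `q` to `p` would be a hit.
  have hleft : ∀ t' ∈ S, q ∈ t'.carrier → ∀ e ∈ t'.carrier, e ≠ q → 0 < σ * cross p q e := by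
    intro t' ht' hqt e he hne
    refine lt_of_le_of_ne (hle t' ht' hqt e he) fun h0 => hn ?_
    have h0 := (mul_eq_zero.1 h0.symm).resolve_left hS.side_ne_zero
    have hqe := hact.mem_ends ht' hqt
    obtain ⟨e', he', hne', hseg⟩ := Seg.exists_other_end hqe
    have he't := t'.ends_subset he'
    have h3 : cross p q e' = 0 := Seg.cross_eq_zero_of_two hqt he hne.symm (by simp) h0 he't
    have h4 : height s σ q < height s σ e' :=
      lt_of_le_of_ne (height_le_of_free hS hp hside hfree ht' hqt he't h3)
        fun h => hne' (eq_of_height_eq hpq h3 (by simp) h.symm)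
    exact ⟨q, evgEdge_of_extension hS hp (vgEdge_of_segment ht' hqe he' hne' hseg)
      (mem_openSegment_of_height_lt hp hside h3 h4) hfree, hside, by simp⟩
  refine ⟨hact.mem_endpoints, hside, hfree, hleft, hact.mem, y, hyt, hqy, ?_⟩
  intro t' ht'
  rw [Set.disjoint_left]
  intro z hz hzt
  obtain ⟨z0, z1, z2⟩ := (mem_openSegment_iff h1).1 hz
  have hline : ∀ w, cross q y w = 0 → cross p q w = 0 := fun w hw =>
    cross_eq_zero_of_line h1 (cross_eq_zero_of_line hpq (by simp) h2 (by simp)) (by simp) hw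
  -- An obstacle between `q` and `y` yields an endpoint `r` above `q` on the line of sight. The pair
  -- of `q` and `r` then produces a hit.
  have hend : ∃ r ∈ t'.ends, height s σ q < height s σ r ∧ height s σ r ≤ height s σ z ∧
      cross q y r = 0 := by
    by_cases hze : z ∈ t'.ends
    · exact ⟨z, hze, z1, le_rfl, z0⟩
    obtain ⟨hl, hr⟩ := (hn2 t' ht' z hzt hz).resolve_left hze
    obtain ⟨c, hc, hcz, hc0⟩ := exists_lower_end h1 hzt hze hl hr
    refine ⟨c, hc, ?_, hcz.le, hc0⟩
    by_contra! hcq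
    have hqt := mem_carrier_of_between h1 (t'.ends_subset hc) hzt hc0 (by simp) z0 hcq z1.le
    have := hleft t' ht' hqt z hzt (by rintro rfl; exact lt_irrefl _ z1)
    simp [hline z z0] at this
  obtain ⟨r, hr, hqr, hrz, hr0⟩ := hend
  have hrl := hline r hr0
  have hqr' := mem_openSegment_of_height_lt hp hside hrl hqr
  have hr0 : 0 < height s σ r := hside.trans hqr
  refine hn (exists_evgEdge_hits hp hrl hr0 (hS.exists_evgEdge hp hact.mem_endpoints
    ⟨t', ht', hr⟩ hr0 hqr' fun t'' ht'' w hwt hw => ?_))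
  obtain ⟨w0, w1, w2⟩ := (mem_openSegment_iff (by rwa [hp0])).1 hw
  have hpr : height s σ p < height s σ r := by rwa [hp0]
  have hwl : cross p q w = 0 := cross_eq_zero_of_line hpr (by simp)
    (by rw [cross_swap, hrl, neg_zero]) w0
  have htr : ∀ w, cross p q w = 0 → cross p r w = 0 := fun w hw =>
    cross_eq_zero_of_line hpq (by simp) hrl hw
  rcases lt_trichotomy (height s σ w) (height s σ q) with h' | h' | h'
  · exact (hn1 t'' ht'' w hwt ((mem_openSegment_iff hpq).2 ⟨hwl, w1, h'⟩)).imp_right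
      fun h => ⟨htr _ h.1, htr _ h.2⟩
  · obtain rfl := eq_of_height_eq hpq hwl (by simp) h'
    exact Or.inl (hact.mem_ends ht'' hwt)
  · exact (hn2 t'' ht'' w hwt ((mem_openSegment_iff h1).2
      ⟨cross_eq_zero_of_line hpq (by simp) h2 hwl, h', by linarith⟩)).imp_right
      fun h => ⟨htr _ (hline _ h.1), htr _ (hline _ h.2)⟩

/-- At the ends of `s`, all edges that have been active are hit. -/
theorem hitsPoint_of_frequently (hS : Scene S s σ) (hp : p ∈ s.ends)
    (h : ∃ᶠ p' in 𝓝 p, p' ∈ s.carrier ∧ Act S s σ p' q t) : HitsPoint S s σ p q := by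
  have hps := s.ends_subset hp
  have hp0 := height_eq_zero (σ := σ) hps
  obtain ⟨y, hyt, hqy, hn1, hn2, hle⟩ := exists_limit hS hps h
  obtain ⟨p', hp', hact⟩ := h.exists
  have hside := hact.side
  have hpq : height s σ p < height s σ q := by rwa [hp0]
  obtain ⟨t', ht', hqt⟩ := endpoints_subset hact.mem_endpoints
  obtain ⟨r, hr, hr0, ⟨t'', ht'', hrt⟩, hA⟩ := hS.exists_first_hit hps hside ht' hqt
  obtain ⟨l0, l1, l2⟩ := (mem_segment_iff hpq).1 hr
  have hre : r ∈ t''.ends := by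
    rcases l2.eq_or_lt with h' | h'
    · obtain rfl := eq_of_height_eq hpq l0 (by simp) h'
      exact hact.mem_ends ht'' hrt
    · exact (hn1 t'' ht'').mem_ends hpq (fun hpt => hS.notMem_others hps ⟨t'', ht'', by
        rintro rfl; exact hr0.ne' (height_eq_zero hrt), hpt⟩) hrt
        ((mem_openSegment_iff hpq).2 ⟨l0, by rwa [hp0], h'⟩) (hA t'' ht'')
  -- No second endpoint on the ray is needed: `p` itself is an endpoint and sees `r`.
  refine ⟨r, Or.inl ⟨?_, ⟨s, hS.mem, hp⟩, ⟨t'', ht'', hre⟩, Or.inl hA⟩, hr0, l0⟩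
  rintro rfl
  exact hr0.ne' hp0

/-- Between hits nothing changes. -/
theorem act_constant (hS : Scene S s σ) {a b : ℝ} (h0 : 0 ≤ a) (h1 : b ≤ 1)
    (hn : ∀ τ ∈ Ioo a b, ¬ Hits S s σ τ q) {τ τ' : ℝ} (hτ : τ ∈ Ioo a b) (hτ' : τ' ∈ Ioo a b)
    (h : Act S s σ (s.pt τ) q t) : Act S s σ (s.pt τ') q t := by
  have hmem : ∀ τ ∈ Ioo a b, s.pt τ ∈ s.carrier := fun τ hτ =>
    s.pt_mem ⟨by linarith [hτ.1], by linarith [hτ.2]⟩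
  have hn' : ∀ τ ∈ Ioo a b, ¬ HitsPoint S s σ (s.pt τ) q := fun τ hτ h' =>
    hn τ hτ ((hits_iff ⟨by linarith [hτ.1], by linarith [hτ.2]⟩ h.side).2 h')
  have hcl : ∀ τ ∈ Ioo a b, τ ∈ closure {τ | τ ∈ Ioo a b ∧ Act S s σ (s.pt τ) q t} →
      Act S s σ (s.pt τ) q t := by
    intro τ hτ hcl
    refine act_of_frequently hS (hmem τ hτ) ?_ (hn' τ hτ)
    rw [mem_closure_iff_frequently] at hcl
    exact (s.continuous_pt.tendsto τ).frequently (hcl.mono fun x hx => ⟨hmem x hx.1, hx.2⟩)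
  have hop : IsOpen {τ | τ ∈ Ioo a b ∧ Act S s σ (s.pt τ) q t} := by
    rw [isOpen_iff_mem_nhds]
    rintro τ ⟨hτ, hact⟩
    have h1 := (s.continuous_pt.tendsto τ).eventually
      (hact.eventually_of_not_hits hS (hmem τ hτ) (hn' τ hτ))
    filter_upwards [h1, Ioo_mem_nhds hτ.1 hτ.2] with x hx hx'
    exact ⟨hx', hx (hmem x hx')⟩
  -- The active parameters form a nonempty subset of a connected interval that is open and
  -- relatively closed.
  have hsub := isPreconnected_Ioo.subset_of_closure_inter_subset hop (s := Ioo a b)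
    ⟨τ, hτ, hτ, h⟩ (fun x hx => ⟨hx.2, hcl x hx.2 hx.1⟩)
  exact (hsub hτ').2

end


/-! ### Finiteness of the visibility space partition -/

section

variable {S : Set Seg} {s : Seg} {σ : ℝ} {q : Plane} {t : Seg}

theorem exists_eq_of_mem_openSegment {u v w : Plane} (h : v ∈ openSegment ℝ u w) :
    ∃ α : ℝ, 0 < α ∧ w = v + α • (v - u) := by
  obtain ⟨a, b, ha, hb, hab, rfl⟩ := h
  refine ⟨a / b, by positivity, ?_⟩
  obtain rfl : a = 1 - b := by linarith
  ext <;> simp <;> field_simp <;> ring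

theorem mem_openSegment_of_lt {v d : Plane} {α β : ℝ} (hα : 0 < α) (h : α < β) :
    v + α • d ∈ openSegment ℝ v (v + β • d) := by
  have hβ : 0 < β := hα.trans h
  refine ⟨1 - α / β, α / β, by rw [sub_pos, div_lt_one hβ]; exact h, by positivity, by ring, ?_⟩
  rw [smul_add, smul_smul, div_mul_cancel₀ _ hβ.ne']
  module

/-- The nearer of two stopping points would lie inside the free extension to the farther one. This
makes the extended visibility graph finite. -/
theorem IsExtension.unique {u v w w' : Plane} (h : IsExtension S u v w)
    (h' : IsExtension S u v w') : w = w' := by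
  obtain ⟨-, hv, ⟨t, ht, hwt⟩, hA⟩ := h
  obtain ⟨-, hv', ⟨t', ht', hwt'⟩, hA'⟩ := h'
  obtain ⟨α, hα, rfl⟩ := exists_eq_of_mem_openSegment hv
  obtain ⟨β, hβ, rfl⟩ := exists_eq_of_mem_openSegment hv'
  rcases lt_trichotomy α β with h | rfl | h
  · exact absurd hwt (hA'.notMem ht (mem_openSegment_of_lt hα h))
  · rfl
  · exact absurd hwt' (hA.notMem ht' (mem_openSegment_of_lt hβ h))

theorem evgEdge_finite (h : S.Finite) : {e : Plane × Plane | EVGEdge S e.1 e.2}.Finite := by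
  have hE := endpoints_finite h
  have hVG : {e : Plane × Plane | VGEdge S e.1 e.2}.Finite :=
    (hE.prod hE).subset fun e he => ⟨he.2.1, he.2.2.1⟩
  have hX : {e : Plane × Plane | ∃ u, IsExtension S u e.1 e.2}.Finite := by
    refine (hVG.biUnion fun e _ => (Set.Subsingleton.finite (s := {f : Plane × Plane |
      f.1 = e.2 ∧ IsExtension S e.1 e.2 f.2}) ?_)).subset ?_
    · rintro ⟨a, b⟩ ⟨h1, h2⟩ ⟨c, d⟩ ⟨h3, h4⟩
      simp only at h1 h2 h3 h4
      rw [h1, h3, h2.unique h4]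
    · rintro ⟨a, b⟩ ⟨u, hu⟩
      exact mem_biUnion (x := (u, a)) hu.1 ⟨rfl, hu⟩
  refine (hVG.union (hX.union (hX.image Prod.swap))).subset ?_
  rintro ⟨a, b⟩ (h | h | h)
  · exact Or.inl h
  · exact Or.inr (Or.inl h)
  · exact Or.inr (Or.inr ⟨(b, a), h, rfl⟩)

theorem vspVertices_finite (h : S.Finite) : (vspVertices S).Finite := by
  have hE := evgEdge_finite h
  have h1 : {x | ∃ y, EVGEdge S x y}.Finite :=
    (hE.image Prod.fst).subset fun x ⟨y, hy⟩ => ⟨(x, y), hy, rfl⟩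
  have h2 : {x | ∃ a b c d, EVGEdge S a b ∧ EVGEdge S c d ∧
      segment ℝ a b ∩ segment ℝ c d = {x}}.Finite := by
    refine ((hE.prod hE).biUnion fun e _ => (Set.Subsingleton.finite (s := {x |
      segment ℝ e.1.1 e.1.2 ∩ segment ℝ e.2.1 e.2.2 = {x}}) ?_)).subset ?_
    · intro x hx y hy
      exact singleton_injective (hx.symm.trans hy)
    · rintro x ⟨a, b, c, d, hab, hcd, hx⟩
      exact mem_biUnion (x := ((a, b), (c, d))) ⟨hab, hcd⟩ hx
  exact h1.union h2

theorem events_finite (h : S.Finite) (s : Seg) : {τ | IsEvent S s τ}.Finite :=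
  ((vspVertices_finite h).preimage s.pt_injective.injOn).subset fun _ hτ => hτ.2

theorem Scene.vgEdge_self (hS : Scene S s σ) : VGEdge S s.left s.right :=
  ⟨s.left_ne_right, ⟨s, hS.mem, Or.inl rfl⟩, ⟨s, hS.mem, Or.inr rfl⟩, Or.inr ⟨s, hS.mem, rfl⟩⟩

theorem Scene.vgEdge_self' (hS : Scene S s σ) : VGEdge S s.right s.left :=
  ⟨s.left_ne_right.symm, ⟨s, hS.mem, Or.inr rfl⟩, ⟨s, hS.mem, Or.inl rfl⟩,
    Or.inr ⟨s, hS.mem, segment_symm _ _ _⟩⟩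

theorem Scene.isEvent_zero (hS : Scene S s σ) : IsEvent S s 0 :=
  ⟨by simp, Or.inl ⟨s.right, Or.inl (by simpa using hS.vgEdge_self)⟩⟩

theorem Scene.isEvent_one (hS : Scene S s σ) : IsEvent S s 1 :=
  ⟨by simp, Or.inl ⟨s.left, Or.inl (by simpa using hS.vgEdge_self')⟩⟩

theorem Hits.isEvent {τ : ℝ} (hτ : τ ∈ Icc (0 : ℝ) 1) (h : Hits S s σ τ q) : IsEvent S s τ := by
  obtain ⟨x, hx, -⟩ := h
  exact ⟨hτ, Or.inl ⟨x, hx⟩⟩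

/-! ### The events -/

theorem exists_nextEvent_of_lt (hS : Scene S s σ) {τ : ℝ} (h0 : 0 ≤ τ) (h1 : τ < 1) :
    ∃ a b, NextEvent S s a b ∧ a ≤ τ ∧ τ < b := by
  have hfin := events_finite hS.finite s
  obtain ⟨a, ⟨ha, haτ⟩, hamax⟩ := Set.exists_max_image {x | IsEvent S s x ∧ x ≤ τ} id
    (hfin.subset fun x hx => hx.1) ⟨0, hS.isEvent_zero, h0⟩
  obtain ⟨b, ⟨hb, hbτ⟩, hbmin⟩ := Set.exists_min_image {x | IsEvent S s x ∧ τ < x} id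
    (hfin.subset fun x hx => hx.1) ⟨1, hS.isEvent_one, h1⟩
  refine ⟨a, b, ⟨ha, hb, haτ.trans_lt hbτ, ?_⟩, haτ, hbτ⟩
  intro c hc hce
  rcases le_or_gt c τ with h | h
  · exact absurd (hamax c ⟨hce, h⟩) (not_le.2 hc.1)
  · exact absurd (hbmin c ⟨hce, h⟩) (not_le.2 hc.2)

theorem exists_nextEvent (hS : Scene S s σ) {τ : ℝ} (h : IsEvent S s τ) (h1 : τ < 1) :
    ∃ b, NextEvent S s τ b := by
  obtain ⟨a, b, hab, ha, hb⟩ := exists_nextEvent_of_lt hS h.1.1 h1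
  rcases ha.eq_or_lt with rfl | ha
  · exact ⟨b, hab⟩
  · exact absurd h (hab.2.2.2 τ ⟨ha, hb⟩)

theorem exists_prevEvent (hS : Scene S s σ) {τ : ℝ} (h : IsEvent S s τ) (h0 : 0 < τ) :
    ∃ a, NextEvent S s a τ := by
  have hfin := events_finite hS.finite s
  obtain ⟨a, ⟨ha, haτ⟩, hamax⟩ := Set.exists_max_image {x | IsEvent S s x ∧ x < τ} id
    (hfin.subset fun x hx => hx.1) ⟨0, hS.isEvent_zero, h0⟩
  exact ⟨a, ha, h, haτ, fun c hc hce => absurd (hamax c ⟨hce, hc.2⟩) (not_le.2 hc.1)⟩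

theorem NextEvent.not_hits {a b τ : ℝ} (h : NextEvent S s a b) (hτ : τ ∈ Ioo a b) :
    ¬ Hits S s σ τ q := fun hh =>
  h.2.2.2 τ hτ (hh.isEvent ⟨h.1.1.1.trans hτ.1.le, hτ.2.le.trans h.2.1.1.2⟩)

theorem ActiveAfter.act (hS : Scene S s σ) {a b τ : ℝ} (h0 : 0 ≤ a) (h1 : b ≤ 1)
    (hn : ∀ τ ∈ Ioo a b, ¬ Hits S s σ τ q) (h : ActiveAfter S s σ a q t) (hτ : τ ∈ Ioo a b) :
    Act S s σ (s.pt τ) q t := by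
  obtain ⟨τ', h2, h3⟩ := (h.and (Ioo_mem_nhdsGT (hτ.1.trans hτ.2))).exists
  exact act_constant hS h0 h1 hn h3 hτ
    ((active_iff hS (s.pt_mem ⟨h0.trans h3.1.le, h3.2.le.trans h1⟩)).1 h2)

theorem activeAfter_of_act (hS : Scene S s σ) {a b τ : ℝ} (h0 : 0 ≤ a) (h1 : b ≤ 1)
    (hn : ∀ τ ∈ Ioo a b, ¬ Hits S s σ τ q) (hτ : τ ∈ Ioo a b) (h : Act S s σ (s.pt τ) q t) :
    ActiveAfter S s σ a q t := by
  filter_upwards [Ioo_mem_nhdsGT (hτ.1.trans hτ.2)] with τ' h3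
  exact (active_iff hS (s.pt_mem ⟨h0.trans h3.1.le, h3.2.le.trans h1⟩)).2
    (act_constant hS h0 h1 hn hτ h3 h)

/-! ### The list of active edges -/

/-- The invariant of the list of active edges. -/
structure ListInvariant (S : Set Seg) (s : Seg) (σ : ℝ) (q : Plane) (t : Seg) (a τ : ℝ) : Prop where
  nonneg : 0 ≤ a
  lt_one : a < 1
  le : a ≤ τ
  start : ActiveAfter S s σ a q t
  first : a = 0 ∨ Hits S s σ a q
  not_hits : ∀ x ∈ Ioc a τ, ¬ Hits S s σ x q

theorem OnList.invariant {a τ : ℝ} (h : OnList S s σ q t a τ) : ListInvariant S s σ q t a τ := by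
  induction h with
  | init h => exact ⟨le_rfl, one_pos, le_rfl, h, Or.inl rfl, by simp⟩
  | keep h hn hh ih =>
    refine ⟨ih.nonneg, ih.lt_one, ih.le.trans hn.2.2.1.le, ih.start, ih.first, ?_⟩
    intro x hx
    rcases le_or_gt x _ with h' | h'
    · exact ih.not_hits x ⟨hx.1, h'⟩
    rcases hx.2.eq_or_lt with rfl | h''
    · exact hh
    · exact hn.not_hits ⟨h', h''⟩
  | new he h0 h1 hh h => exact ⟨h0.le, h1, le_rfl, h, Or.inr hh, by simp⟩

/-- By the invariant, the start value is the last hit of `q` up to `τ`, or `0` if no hit has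
occurred after `0`. -/
theorem OnList.unique {a a' τ : ℝ} (h : OnList S s σ q t a τ) (h' : OnList S s σ q t a' τ) :
    a = a' := by
  have h1 := h.invariant
  have h2 := h'.invariant
  rcases lt_trichotomy a a' with hlt | rfl | hlt
  · exact absurd (h2.first.resolve_left (by linarith [h1.nonneg])) (h1.not_hits a' ⟨hlt, h2.le⟩)
  · rfl
  · exact absurd (h1.first.resolve_left (by linarith [h2.nonneg])) (h2.not_hits a ⟨hlt, h1.le⟩)

/-- All edges that are active after an event are on the list. -/
theorem exists_onList (hS : Scene S s σ) {τ : ℝ} (he : IsEvent S s τ) (h1 : τ < 1)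
    (h : ActiveAfter S s σ τ q t) : ∃ a, OnList S s σ q t a τ := by
  have hfin := events_finite hS.finite s
  induction hn : {x | IsEvent S s x ∧ x < τ}.ncard using Nat.strong_induction_on generalizing τ with
  | _ n ih =>
  rcases he.1.1.eq_or_lt with rfl | h0
  · exact ⟨0, .init h⟩
  by_cases hh : Hits S s σ τ q
  · exact ⟨τ, .new he h0 h1 hh h⟩
  obtain ⟨c, hc⟩ := exists_prevEvent hS he h0
  obtain ⟨b, hb⟩ := exists_nextEvent hS he h1
  have hnh : ∀ x ∈ Ioo c b, ¬ Hits S s σ x q := by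
    intro x hx
    rcases lt_trichotomy x τ with h' | rfl | h'
    · exact hc.not_hits ⟨hx.1, h'⟩
    · exact hh
    · exact hb.not_hits ⟨h', hx.2⟩
  have hτb := hb.2.2.1
  have hcτ := hc.2.2.1
  have hact := h.act hS (h0.le) hb.2.1.1.2 (fun x hx => hb.not_hits hx) (τ := (τ + b) / 2)
    ⟨by linarith, by linarith⟩
  -- Without a hit at `τ` the edge is active on both sides of `τ`, so it was already active after
  -- the preceding event `c`, to which the induction on the number of earlier events applies.
  have hc' := activeAfter_of_act hS hc.1.1.1 hb.2.1.1.2 hnh ⟨by linarith, by linarith⟩ hact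
  obtain ⟨a, ha⟩ := ih _ (by
    rw [← hn]
    refine Set.ncard_lt_ncard ⟨fun x hx => ⟨hx.1, hx.2.trans hcτ⟩, fun hsub => ?_⟩
      (hfin.subset fun x hx => hx.1)
    exact lt_irrefl _ (hsub (a := c) ⟨hc.1, hcτ⟩).2) hc.1 (hcτ.trans h1) hc' rfl
  exact ⟨a, .keep ha hc hh⟩

/-- Every edge on the list leaves it at some event. -/
theorem exists_leave (hS : Scene S s σ) {a τ : ℝ} (he : IsEvent S s τ) (h1 : τ < 1)
    (h : OnList S s σ q t a τ) : ∃ τ' b, τ ≤ τ' ∧ OnList S s σ q t a τ' ∧ NextEvent S s τ' b ∧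
      (Hits S s σ b q ∨ b = 1) := by
  have hfin := events_finite hS.finite s
  induction hn : {x | IsEvent S s x ∧ τ < x}.ncard using Nat.strong_induction_on generalizing τ with
  | _ n ih =>
  obtain ⟨b, hb⟩ := exists_nextEvent hS he h1
  by_cases hh : Hits S s σ b q ∨ b = 1
  · exact ⟨τ, b, le_rfl, h, hb, hh⟩
  push Not at hh
  have hτb := hb.2.2.1
  obtain ⟨τ', c, h2, h3⟩ := ih _ (by
    rw [← hn]
    refine Set.ncard_lt_ncard ⟨fun x hx => ⟨hx.1, hτb.trans hx.2⟩, fun hsub => ?_⟩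
      (hfin.subset fun x hx => hx.1)
    exact lt_irrefl _ (hsub (a := b) ⟨hb.2.1, hτb⟩).2) hb.2.1 (lt_of_le_of_ne hb.2.1.1.2 hh.2)
    (.keep h hb hh.1) rfl
  exact ⟨τ', c, hτb.le.trans h2, h3⟩

/-- The active edge with lower endpoint `q` and upper endpoint on `t` enters the list at `a` and
leaves it at `b`. -/
def Listed (S : Set Seg) (s : Seg) (σ : ℝ) (q : Plane) (t : Seg) (a b : ℝ) : Prop :=
  ∃ τ, OnList S s σ q t a τ ∧ NextEvent S s τ b ∧ (Hits S s σ b q ∨ b = 1)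

theorem Listed.lt {a b : ℝ} (h : Listed S s σ q t a b) : a < b := by
  obtain ⟨τ, h1, h2, -⟩ := h
  exact h1.invariant.le.trans_lt h2.2.2.1

theorem Listed.nonneg {a b : ℝ} (h : Listed S s σ q t a b) : 0 ≤ a := by
  obtain ⟨τ, h1, h2, -⟩ := h
  exact h1.invariant.nonneg

theorem Listed.le_one {a b : ℝ} (h : Listed S s σ q t a b) : b ≤ 1 := by
  obtain ⟨τ, h1, h2, -⟩ := h
  exact h2.2.1.1.2

theorem Listed.act (hS : Scene S s σ) {a b τ : ℝ} (h : Listed S s σ q t a b) (hτ : τ ∈ Ioo a b) :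
    Act S s σ (s.pt τ) q t := by
  have h0 := h.nonneg
  have h1 := h.le_one
  obtain ⟨c, h2, h3, -⟩ := h
  refine h2.invariant.start.act hS h0 h1 ?_ hτ
  intro x hx
  rcases le_or_gt x c with h' | h'
  · exact h2.invariant.not_hits x ⟨hx.1, h'⟩
  · exact h3.not_hits ⟨h', hx.2⟩

/-- An active edge is active infinitely often close to the end of its time on the list. -/
theorem Listed.frequently (hS : Scene S s σ) {a b τ : ℝ} (h : Listed S s σ q t a b)
    (hτ : τ ∈ Icc a b) : ∃ᶠ p in 𝓝 (s.pt τ), p ∈ s.carrier ∧ Act S s σ p q t := by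
  refine (s.continuous_pt.tendsto τ).frequently ?_
  have : τ ∈ closure (Ioo a b) := by rwa [closure_Ioo h.lt.ne]
  rw [mem_closure_iff_frequently] at this
  exact this.mono fun x hx => ⟨s.pt_mem ⟨h.nonneg.trans hx.1.le, hx.2.le.trans h.le_one⟩,
    h.act hS hx⟩

/-- An edge that leaves only because `b = 1` is hit as well, since the right endpoint of `s` is
itself an endpoint. So every swept triangle has an edge to be charged. -/
theorem Listed.hits (hS : Scene S s σ) {a b : ℝ} (h : Listed S s σ q t a b) : Hits S s σ b q := by
  have hlt := h.lt
  have hfr := h.frequently hS (right_mem_Icc.2 hlt.le)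
  obtain ⟨p, -, hp⟩ := hfr.exists
  obtain ⟨τ, -, -, hh | rfl⟩ := h
  · exact hh
  · exact (hits_iff (by simp) hp.side).2 (hitsPoint_of_frequently hS (Or.inr (by simp)) hfr)

theorem Listed.exists_upper (hS : Scene S s σ) {a b τ : ℝ} (h : Listed S s σ q t a b)
    (hτ : τ ∈ Icc a b) : ∃ y ∈ t.carrier, q ∈ openSegment ℝ (s.pt τ) y := by
  obtain ⟨y, hy, hqy, -⟩ := exists_limit hS
    (s.pt_mem ⟨h.nonneg.trans hτ.1, hτ.2.trans h.le_one⟩) (h.frequently hS hτ)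
  exact ⟨y, hy, hqy⟩

theorem Listed.side (hS : Scene S s σ) {a b : ℝ} (h : Listed S s σ q t a b) : 0 < height s σ q := by
  obtain ⟨p, -, hp⟩ := (h.frequently hS (left_mem_Icc.2 h.lt.le)).exists
  exact hp.side

/-- The upper end of an active edge is determined by the viewpoint. -/
theorem Listed.upper_unique (hS : Scene S s σ) {a b τ : ℝ} (h : Listed S s σ q t a b)
    {y y' : Plane} (hy : y ∈ t.carrier) (hqy : q ∈ openSegment ℝ (s.pt τ) y)
    (hy' : y' ∈ t.carrier) (hqy' : q ∈ openSegment ℝ (s.pt τ) y') (hτ : τ ∈ Icc a b) : y = y' := by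
  by_contra hne
  have hlt := h.lt
  have hside := h.side hS
  have hp := s.pt_mem (τ := τ) ⟨h.nonneg.trans hτ.1, hτ.2.trans h.le_one⟩
  -- Two common points would put `t` into the line through `s.pt τ` and `q`. But `t` also has a
  -- point above `q` on the line from a second viewpoint, and the two lines share only `q`.
  obtain ⟨τ', hτ', hττ'⟩ : ∃ τ' ∈ Icc a b, τ ≠ τ' := by
    by_cases hτa : τ = a
    · exact ⟨b, right_mem_Icc.2 hlt.le, by rw [hτa]; exact hlt.ne⟩
    · exact ⟨a, left_mem_Icc.2 hlt.le, hτa⟩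
  obtain ⟨z, hz, hqz⟩ := h.exists_upper hS hτ'
  obtain ⟨β, hβ, hzβ⟩ := exists_eq_of_mem_openSegment hqz
  have h1 := cross_pt s σ τ' τ q z β hzβ
  rw [Seg.cross_eq_zero_of_two hy hy' hne (height_lt_of_mem_openSegment hp hside hqy).2
    (height_lt_of_mem_openSegment hp hside hqy').2 hz, mul_zero, eq_comm, neg_eq_zero] at h1
  exact mul_ne_zero (mul_ne_zero hβ.ne' (sub_ne_zero.2 hττ')) hside.ne' h1

end


/-! ### Triangles -/

theorem affineIndependent_of_cross {a b c : Plane} (h : cross a b c ≠ 0) :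
    AffineIndependent ℝ ![a, b, c] := by
  rw [affineIndependent_iff_of_fintype]
  intro w hw h0
  rw [Finset.univ.weightedVSub_eq_linear_combination hw] at h0
  simp only [Fin.sum_univ_three, Matrix.cons_val_zero, Matrix.cons_val_one, Matrix.cons_val] at hw h0
  have h1 := congrArg Prod.fst h0
  have h2 := congrArg Prod.snd h0
  simp only [Prod.fst_add, Prod.smul_fst, smul_eq_mul, Prod.snd_add, Prod.smul_snd, Prod.fst_zero,
    Prod.snd_zero] at h1 h2
  have k1 : w 1 * cross a b c = 0 := by
    simp only [cross]
    linear_combination (c.2 - a.2) * h1 - (c.1 - a.1) * h2 + (a.2 * c.1 - a.1 * c.2) * hw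
  have k2 : w 2 * cross a b c = 0 := by
    simp only [cross]
    linear_combination (b.1 - a.1) * h2 - (b.2 - a.2) * h1 + (a.1 * b.2 - a.2 * b.1) * hw
  have k1' := (mul_eq_zero.1 k1).resolve_right h
  have k2' := (mul_eq_zero.1 k2).resolve_right h
  intro i
  fin_cases i
  · simpa [k1', k2'] using hw
  · exact k1'
  · exact k2'

theorem range_triple (a b c : Plane) : range ![a, b, c] = {a, b, c} := by
  ext x
  simp [eq_comm]
  tauto

theorem exists_affineBasis {a b c : Plane} (h : cross a b c ≠ 0) :
    ∃ B : AffineBasis (Fin 3) ℝ Plane, ⇑B = ![a, b, c] := by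
  have hi := affineIndependent_of_cross h
  refine ⟨⟨![a, b, c], hi, ?_⟩, rfl⟩
  rw [hi.affineSpan_eq_top_iff_card_eq_finrank_add_one]
  simp

/-- Inner points of a triangle are positive combinations of its corners. -/
theorem exists_weights_of_mem_interior {a b c x : Plane} (h : cross a b c ≠ 0)
    (hx : x ∈ interior (convexHull ℝ {a, b, c})) :
    ∃ u v w : ℝ, 0 < u ∧ 0 < v ∧ 0 < w ∧ u + v + w = 1 ∧ x = u • a + v • b + w • c := by
  obtain ⟨B, hB⟩ := exists_affineBasis h
  rw [← range_triple, ← hB, B.interior_convexHull] at hx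
  refine ⟨B.coord 0 x, B.coord 1 x, B.coord 2 x, hx 0, hx 1, hx 2, ?_, ?_⟩
  · have := B.sum_coord_apply_eq_one x
    rwa [Fin.sum_univ_three] at this
  · have := B.linear_combination_coord_eq_self x
    rw [Fin.sum_univ_three, hB] at this
    exact this.symm

theorem convexHull_subset_closure_interior {a b c : Plane} (h : cross a b c ≠ 0) :
    convexHull ℝ {a, b, c} ⊆ closure (interior (convexHull ℝ {a, b, c})) := by
  obtain ⟨B, hB⟩ := exists_affineBasis h
  have hne : (interior (convexHull ℝ ({a, b, c} : Set Plane))).Nonempty := by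
    rw [← range_triple, ← hB]
    exact ⟨_, B.centroid_mem_interior_convexHull⟩
  rw [(convex_convexHull ℝ _).closure_interior_eq_closure_of_nonempty_interior hne]
  exact subset_closure

theorem isTriangle_of_cross {a b c : Plane} (h : cross a b c ≠ 0) :
    IsTriangle (convexHull ℝ {a, b, c}) :=
  ⟨a, b, c, affineIndependent_of_cross h, rfl⟩

theorem IsTriangle.isClosed {T : Set Plane} (h : IsTriangle T) : IsClosed T := by
  obtain ⟨a, b, c, -, rfl⟩ := h
  exact ((Set.toFinite _).isCompact_convexHull (𝕜 := ℝ)).isClosed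

/-- A point of an open triangle is between its apex and a point of the opposite side. -/
theorem exists_mem_openSegment_of_weights {a b c x : Plane} {u v w : ℝ} (hu : 0 < u) (hv : 0 < v)
    (hw : 0 < w) (h : u + v + w = 1) (hx : x = u • a + v • b + w • c) :
    ∃ z ∈ openSegment ℝ b c, x ∈ openSegment ℝ a z := by
  have hvw : 0 < v + w := by positivity
  refine ⟨(v / (v + w)) • b + (w / (v + w)) • c,
    ⟨_, _, by positivity, by positivity, by field_simp, rfl⟩, u, v + w, hu, hvw, by linarith, ?_⟩
  rw [smul_add, smul_smul, smul_smul, mul_div_cancel₀ _ hvw.ne', mul_div_cancel₀ _ hvw.ne', hx,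
    add_assoc]

/-! ### The swept triangles -/

section

variable {S : Set Seg} {s : Seg} {σ : ℝ} {q : Plane} {t : Seg}

/-- The visible points strictly above `s`. -/
def openRegion (S : Set Seg) (s : Seg) (σ : ℝ) : Set Plane :=
  {x | 0 < height s σ x ∧ ∃ p ∈ s.carrier, Sees S p x}

/-- Moving the viewpoint reveals the points on the line of sight above an active edge. -/
theorem Act.exists_sees (hS : Scene S s σ) {a b τ : ℝ} (h0 : 0 ≤ a) (h1 : b ≤ 1)
    (hact : ∀ τ ∈ Ioo a b, Act S s σ (s.pt τ) q t) (hτ : τ ∈ Ioo a b) {y x : Plane}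
    (hy : y ∈ t.carrier) (hqy : q ∈ openSegment ℝ (s.pt τ) y) (hx : x ∈ openSegment ℝ q y) :
    x ∈ openRegion S s σ := by
  have hmem : ∀ τ ∈ Ioo a b, s.pt τ ∈ s.carrier := fun τ hτ =>
    s.pt_mem ⟨h0.trans hτ.1.le, hτ.2.le.trans h1⟩
  have h := hact τ hτ
  have hp := hmem τ hτ
  have hpq := h.line hp
  have hp0 := height_eq_zero (σ := σ) hp
  obtain ⟨h1, h2⟩ := height_lt_of_mem_openSegment hp h.side hqy
  obtain ⟨k0, k1, k2⟩ := (mem_openSegment_iff h1).1 hx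
  have hA : Avoids S (openSegment ℝ q y) := by
    obtain ⟨y', hy', hqy', hA⟩ := h.hit
    rcases eq_or_ne y y' with rfl | hne
    · exact hA
    obtain ⟨h3, h4⟩ := height_lt_of_mem_openSegment hp h.side hqy'
    refine hA.mono fun w hw => ?_
    obtain ⟨w0, w1, w2⟩ := (mem_openSegment_iff h1).1 hw
    have hyy' : height s σ y ≤ height s σ y' := by
      by_contra! hlt
      obtain ⟨τ', hτ', hne'⟩ : ∃ τ' ∈ Ioo a b, τ' ≠ τ := by
        exact ⟨(a + τ) / 2, ⟨by linarith [hτ.1], by linarith [hτ.1, hτ.2]⟩, by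
          have := hτ.1
          intro h
          linarith⟩
      obtain ⟨z, hz, hqz, -⟩ := (hact τ' hτ').hit
      obtain ⟨β, hβ, hzβ⟩ := exists_eq_of_mem_openSegment hqz
      have h5 := cross_pt s σ τ' τ q z β hzβ
      rw [Seg.cross_eq_zero_of_two hy hy' hne h2 h4 hz, mul_zero, eq_comm, neg_eq_zero] at h5
      exact mul_ne_zero (mul_ne_zero hβ.ne' (sub_ne_zero.2 hne'.symm)) h.side.ne' h5
    have hl : ∀ w, cross q y w = 0 → cross q y' w = 0 := fun w hw =>
      cross_eq_zero_of_line hpq (by simp) h4 (cross_eq_zero_of_line h1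
        (cross_eq_zero_of_line hpq (by simp) h2 (by simp)) (by simp) hw)
    exact (mem_openSegment_iff h3).2 ⟨hl w w0, w1, by linarith⟩
  have hxl : cross (s.pt τ) q x = 0 := cross_eq_zero_of_line h1
    (cross_eq_zero_of_line hpq (by simp) h2 (by simp)) (by simp) k0
  have hqx := mem_openSegment_of_height_lt hp h.side hxl k1
  have hx0 : 0 < height s σ x := h.side.trans k1
  have hfar : ∀ᶠ p' in 𝓝 (s.pt τ), ∀ t' ∈ S, t' ≠ s → q ∉ t'.carrier →
      Disjoint (segment ℝ p' x) t'.carrier := by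
    rw [eventually_all_finite hS.finite]
    intro t' ht'
    by_cases hts : t' = s ∨ q ∈ t'.carrier
    · exact Eventually.of_forall fun x h1 h2 => by tauto
    · push Not at hts
      have := eventually_disjoint t'.isClosed
        (disjoint_segment_beyond hp h.side h.free hqy hA hS hx ht' hts.1 hts.2)
      have hc : Continuous fun p' : Plane => (p', x) := by fun_prop
      exact ((hc.tendsto _).eventually this).mono fun x hx _ _ => hx
  have hfar' := ((s.continuous_pt.tendsto τ).eventually hfar).filter_mono
    (nhdsWithin_le_nhds (s := Ioi τ))
  -- A viewpoint slightly further to the right: `x` is then to the right of the line through `s.pt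
  -- τ'` and `q`, while all segments at `q` are to its left.
  obtain ⟨τ', hfar, hττ', hτ'b⟩ := (hfar'.and (Ioo_mem_nhdsGT hτ.2)).exists
  have hτ' : τ' ∈ Ioo a b := ⟨hτ.1.trans hττ', hτ'b⟩
  refine ⟨hx0, s.pt τ', hmem τ' hτ', Or.inr fun t' ht' => ?_⟩
  by_cases hts : t' = s
  · subst hts
    rw [Set.disjoint_left]
    intro w hw hwt
    exact (height_pos_of_mem_openSegment (height_eq_zero (hmem τ' hτ')).ge hx0 hw).ne'
      (height_eq_zero hwt)
  by_cases hqt : q ∈ t'.carrier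
  · obtain ⟨β, hβ, hxβ⟩ := exists_eq_of_mem_openSegment hqx
    have h5 := cross_pt s σ τ τ' q x β hxβ
    rw [Set.disjoint_left]
    rintro w ⟨c, d, hc, hd, hcd, rfl⟩ hwt
    have h6 : 0 ≤ σ * cross (s.pt τ') q (c • s.pt τ' + d • x) := by
      by_cases hwq : c • s.pt τ' + d • x = q
      · rw [hwq]; simp
      · exact ((hact τ' hτ').left t' ht' hqt _ hwt hwq).le
    rw [cross_comb _ _ _ _ hcd] at h6
    simp only [cross_self_outer, mul_zero, zero_add] at h6
    have h7 := mul_pos (mul_pos hβ (sub_pos.2 hττ')) h.side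
    have h8 := mul_pos hd h7
    have h9 : σ * (d * cross (s.pt τ') q x) = d * (σ * cross (s.pt τ') q x) := by ring
    rw [h9, h5] at h6
    linarith
  · exact (hfar t' ht' hts hqt).mono_left (openSegment_subset_segment ..)

/-- The two sides at `q` lie on lines through different points of `s`, and `q` is off the supporting
line of `s`. -/
theorem Listed.cross_ne_zero (hS : Scene S s σ) {a b : ℝ} (h : Listed S s σ q t a b)
    {y₁ y₂ : Plane} (hq₁ : q ∈ openSegment ℝ (s.pt a) y₁) (hq₂ : q ∈ openSegment ℝ (s.pt b) y₂) :
    cross q y₁ y₂ ≠ 0 := by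
  obtain ⟨α, hα, h1⟩ := exists_eq_of_mem_openSegment hq₁
  obtain ⟨β, hβ, h2⟩ := exists_eq_of_mem_openSegment hq₂
  have h3 := cross_pt s σ a b q y₁ α h1
  have h4 : cross q y₁ y₂ = - (β * cross (s.pt b) q y₁) := by
    rw [h2]
    simp only [cross, Prod.fst_add, Prod.snd_add, Prod.smul_fst, Prod.smul_snd, smul_eq_mul,
      Prod.fst_sub, Prod.snd_sub]
    ring
  rw [h4]
  refine neg_ne_zero.2 (mul_ne_zero hβ.ne' fun h0 => ?_)
  rw [h0, mul_zero, eq_comm, neg_eq_zero] at h3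
  exact mul_ne_zero (mul_ne_zero hα.ne' (sub_ne_zero.2 h.lt.ne')) (h.side hS).ne' h3

/-- Points between the upper ends of an active edge are its upper ends in the meantime. -/
theorem exists_viewpoint {a b : ℝ} {y₁ y₂ z : Plane} (hq₁ : q ∈ openSegment ℝ (s.pt a) y₁)
    (hq₂ : q ∈ openSegment ℝ (s.pt b) y₂) (hab : a < b) (hz : z ∈ openSegment ℝ y₁ y₂) :
    ∃ τ ∈ Ioo a b, q ∈ openSegment ℝ (s.pt τ) z := by
  obtain ⟨α, hα, rfl⟩ := exists_eq_of_mem_openSegment hq₁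
  obtain ⟨β, hβ, rfl⟩ := exists_eq_of_mem_openSegment hq₂
  obtain ⟨u, v, hu, hv, huv, rfl⟩ := hz
  have hW : 0 < u * α + v * β := by positivity
  have hW1 : 0 < 1 + (u * α + v * β) := by positivity
  -- With `y₁ = q + α (q - s.pt a)` and `y₂ = q + β (q - s.pt b)`, the point `u y₁ + v y₂` is
  -- opposite, across `q`, to the mean of the viewpoints with weights `u * α` and `v * β`.
  refine ⟨(u * α * a + v * β * b) / (u * α + v * β), ⟨?_, ?_⟩, ?_⟩
  · rw [lt_div_iff₀ hW]
    nlinarith [mul_pos (mul_pos hv hβ) (sub_pos.2 hab)]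
  · rw [div_lt_iff₀ hW]
    nlinarith [mul_pos (mul_pos hu hα) (sub_pos.2 hab)]
  · refine ⟨(u * α + v * β) / (1 + (u * α + v * β)), 1 / (1 + (u * α + v * β)), by positivity,
      by positivity, by field_simp; ring, ?_⟩
    obtain rfl : u = 1 - v := by linarith
    simp only [Seg.pt_eq]
    ext <;> simp <;> field_simp <;> ring

/-- The upper end of an active edge is between the first and the last one. -/
theorem exists_upper_between {a b τ : ℝ} {y₁ y₂ : Plane} (hq₁ : q ∈ openSegment ℝ (s.pt a) y₁)
    (hq₂ : q ∈ openSegment ℝ (s.pt b) y₂) (hab : a < b) (hτ : τ ∈ Icc a b) :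
    ∃ z ∈ segment ℝ y₁ y₂, q ∈ openSegment ℝ (s.pt τ) z := by
  obtain ⟨α, hα, rfl⟩ := exists_eq_of_mem_openSegment hq₁
  obtain ⟨β, hβ, rfl⟩ := exists_eq_of_mem_openSegment hq₂
  have h1 : 0 ≤ τ - a := sub_nonneg.2 hτ.1
  have h2 : 0 ≤ b - τ := sub_nonneg.2 hτ.2
  have hD : 0 < (τ - a) * α + (b - τ) * β := by
    rcases h1.eq_or_lt with h | h
    · rw [← h]
      have : 0 < b - τ := by linarith
      positivity
    · positivity
  -- The inverse computation: `τ` is the mean of `a` and `b` with weights `u * α`, `v * β` when `u :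
  -- v` equals `(b - τ) * β : (τ - a) * α`.
  refine ⟨((b - τ) * β / ((τ - a) * α + (b - τ) * β)) • (q + α • (q - s.pt a)) +
      ((τ - a) * α / ((τ - a) * α + (b - τ) * β)) • (q + β • (q - s.pt b)),
    ⟨_, _, by positivity, by positivity, by field_simp; ring, rfl⟩, ?_⟩
  have hab' : 0 < b - a := sub_pos.2 hab
  set D := (τ - a) * α + (b - τ) * β with hDdef
  have hW : 0 < α * β * (b - a) / D := by positivity
  refine ⟨(α * β * (b - a) / D) / (1 + α * β * (b - a) / D), 1 / (1 + α * β * (b - a) / D),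
    by positivity, by positivity, by field_simp; ring, ?_⟩
  have hD1 : D + α * β * (b - a) ≠ 0 := by positivity
  simp only [Seg.pt_eq]
  ext
  · simp
    field_simp
    rw [hDdef]
    ring
  · simp
    field_simp
    rw [hDdef]
    ring

theorem sweptTriangles_eq : sweptTriangles S s σ = {T | ∃ q t a b y₁ y₂, Listed S s σ q t a b ∧
    y₁ ∈ t.carrier ∧ q ∈ openSegment ℝ (s.pt a) y₁ ∧ y₂ ∈ t.carrier ∧
    q ∈ openSegment ℝ (s.pt b) y₂ ∧ T = convexHull ℝ {q, y₁, y₂}} := by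
  ext T
  constructor
  · rintro ⟨q, t, a, τ, b, y₁, y₂, h1, h2, h3, h4⟩
    exact ⟨q, t, a, b, y₁, y₂, ⟨τ, h1, h2, h3⟩, h4⟩
  · rintro ⟨q, t, a, b, y₁, y₂, ⟨τ, h1, h2, h3⟩, h4⟩
    exact ⟨q, t, a, τ, b, y₁, y₂, h1, h2, h3, h4⟩

theorem swept_isTriangle (hS : Scene S s σ) {T : Set Plane} (hT : T ∈ sweptTriangles S s σ) :
    IsTriangle T := by
  rw [sweptTriangles_eq] at hT
  obtain ⟨q, t, a, b, y₁, y₂, h, hy₁, hq₁, hy₂, hq₂, rfl⟩ := hT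
  exact isTriangle_of_cross (h.cross_ne_zero hS hq₁ hq₂)

/-- An inner point is strictly between `q` and an inner point of the third side, that is, on the
active edge of a viewpoint strictly between `a` and `b`. -/
theorem swept_interior_subset (hS : Scene S s σ) {T : Set Plane} (hT : T ∈ sweptTriangles S s σ) :
    interior T ⊆ openRegion S s σ := by
  rw [sweptTriangles_eq] at hT
  obtain ⟨q, t, a, b, y₁, y₂, h, hy₁, hq₁, hy₂, hq₂, rfl⟩ := hT
  intro x hx
  obtain ⟨u, v, w, hu, hv, hw, huvw, hx⟩ :=
    exists_weights_of_mem_interior (h.cross_ne_zero hS hq₁ hq₂) hx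
  obtain ⟨z, hz, hxz⟩ := exists_mem_openSegment_of_weights hu hv hw huvw hx
  obtain ⟨τ, hτ, hqz⟩ := exists_viewpoint hq₁ hq₂ h.lt hz
  exact Act.exists_sees hS h.nonneg h.le_one (fun τ hτ => h.act hS hτ) hτ
    (t.convex.openSegment_subset hy₁ hy₂ hz) hqz hxz

theorem swept_subset_closure (hS : Scene S s σ) {T : Set Plane} (hT : T ∈ sweptTriangles S s σ) :
    T ⊆ closure (openRegion S s σ) := by
  have h := swept_interior_subset hS hT
  rw [sweptTriangles_eq] at hT
  obtain ⟨q, t, a, b, y₁, y₂, hl, hy₁, hq₁, hy₂, hq₂, rfl⟩ := hT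
  exact (convexHull_subset_closure_interior (hl.cross_ne_zero hS hq₁ hq₂)).trans (closure_mono h)

theorem sweptTriangles_finite (hS : Scene S s σ) : (sweptTriangles S s σ).Finite := by
  rw [sweptTriangles_eq]
  have hev := events_finite hS.finite s
  have hfin := (endpoints_finite hS.finite).prod (hS.finite.prod (hev.prod hev))
  refine (hfin.biUnion fun e _ => Set.Subsingleton.finite (s := {T | ∃ y₁ y₂,
    Listed S s σ e.1 e.2.1 e.2.2.1 e.2.2.2 ∧ y₁ ∈ e.2.1.carrier ∧
    e.1 ∈ openSegment ℝ (s.pt e.2.2.1) y₁ ∧ y₂ ∈ e.2.1.carrier ∧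
    e.1 ∈ openSegment ℝ (s.pt e.2.2.2) y₂ ∧ T = convexHull ℝ {e.1, y₁, y₂}}) ?_).subset ?_
  · rintro _ ⟨y₁, y₂, h, h1, h2, h3, h4, rfl⟩ _ ⟨z₁, z₂, -, k1, k2, k3, k4, rfl⟩
    rw [h.upper_unique hS h1 h2 k1 k2 (left_mem_Icc.2 h.lt.le),
      h.upper_unique hS h3 h4 k3 k4 (right_mem_Icc.2 h.lt.le)]
  · rintro T ⟨q, t, a, b, y₁, y₂, h, hT⟩
    refine mem_biUnion (x := (q, t, a, b)) ⟨?_, ?_, ?_, ?_⟩ ⟨y₁, y₂, h, hT⟩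
    · obtain ⟨p, -, hp⟩ := (h.frequently hS (left_mem_Icc.2 h.lt.le)).exists
      exact hp.mem_endpoints
    · obtain ⟨p, -, hp⟩ := (h.frequently hS (left_mem_Icc.2 h.lt.le)).exists
      exact hp.mem
    · obtain ⟨τ, h1, h2, h3⟩ := h
      rcases h1.invariant.first with h4 | h4
      · change IsEvent S s a
        rw [h4]; exact hS.isEvent_zero
      · exact h4.isEvent ⟨h1.invariant.nonneg, h1.invariant.lt_one.le⟩
    · obtain ⟨τ, h1, h2, h3⟩ := h
      exact h2.2.1

end


/-! ### The initial triangles -/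

theorem openSegment_subset_of_mem {p x z : Plane} (h : x ∈ openSegment ℝ p z) :
    openSegment ℝ p x ⊆ openSegment ℝ p z := by
  obtain ⟨c, d, hc, hd, hcd, rfl⟩ := h
  rintro w ⟨a, b, ha, hb, hab, rfl⟩
  exact ⟨a + b * c, b * d, by positivity, by positivity, by linear_combination hab + b * hcd,
    by module⟩

section

variable {S : Set Seg} {s : Seg} {σ : ℝ} {t : Seg} {x y : Plane}

theorem Scene.left_height (_ : Scene S s σ) : height s σ s.left = 0 := height_eq_zero s.left_mem

theorem IsVisibleEdge.symm (h : IsVisibleEdge S s σ t x y) : IsVisibleEdge S s σ t y x := by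
  obtain ⟨h1, h2, h3⟩ := h
  refine ⟨h1.symm, by rwa [openSegment_symm], ?_⟩
  rwa [openSegment_symm ℝ y x]

theorem IsVisibleEdge.segment_subset (h : IsVisibleEdge S s σ t x y) :
    segment ℝ x y ⊆ t.carrier ∩ {z | 0 ≤ height s σ z} := by
  rw [← closure_openSegment]
  refine closure_minimal (fun z hz => ⟨(h.2.1 hz).1, le_of_lt (h.2.1 hz).2.1⟩) ?_
  exact t.isClosed.inter (isClosed_le (by fun_prop) (by fun_prop))

theorem IsVisibleEdge.left_mem (h : IsVisibleEdge S s σ t x y) : x ∈ t.carrier :=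
  (h.segment_subset (left_mem_segment ..)).1

theorem IsVisibleEdge.right_mem (h : IsVisibleEdge S s σ t x y) : y ∈ t.carrier :=
  (h.segment_subset (right_mem_segment ..)).1

/-- Of two visible points on segments, none is in front of the other. -/
theorem eq_of_visible (hS : Scene S s σ) {t t' : Seg} (ht : t ∈ S) (ht' : t' ∈ S) {z z' : Plane}
    (hz : z ∈ visiblePart S s σ t) (hz' : z' ∈ visiblePart S s σ t')
    (h : cross s.left z z' = 0) : z = z' := by
  have h0 := hS.left_height
  have hz0 : 0 < height s σ z := hz.2.1
  have hz0' : 0 < height s σ z' := hz'.2.1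
  rcases lt_trichotomy (height s σ z) (height s σ z') with hlt | heq | hlt
  · refine absurd hz.1 (((sees_iff_of_pos s.left_mem hz0').1 hz'.2.2).notMem ht
      ((mem_openSegment_iff (by rwa [h0])).2 ⟨by rw [cross_swap, h, neg_zero], by rwa [h0], hlt⟩))
  · exact eq_of_height_eq (s := s) (σ := σ) (a := s.left) (b := z) (by rwa [h0]) (by simp) h heq
  · exact absurd hz'.1 (((sees_iff_of_pos s.left_mem hz0).1 hz.2.2).notMem ht'
      ((mem_openSegment_iff (by rwa [h0])).2 ⟨h, by rwa [h0], hlt⟩))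

/-- On a line through the left endpoint of `s`, at most one point of a segment is visible, so two
different points of the open edge give a contradiction. -/
theorem IsVisibleEdge.cross_ne_zero (hS : Scene S s σ) (ht : t ∈ S)
    (h : IsVisibleEdge S s σ t x y) : cross s.left x y ≠ 0 := by
  intro h0
  have h1 : (2⁻¹ : ℝ) • x + (2⁻¹ : ℝ) • y ∈ openSegment ℝ x y :=
    ⟨_, _, by norm_num, by norm_num, by norm_num, rfl⟩
  have h2 : (3⁻¹ : ℝ) • x + (2 / 3 : ℝ) • y ∈ openSegment ℝ x y :=
    ⟨_, _, by norm_num, by norm_num, by norm_num, rfl⟩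
  have h3 := eq_of_visible hS ht ht (h.2.1 h1) (h.2.1 h2) (by
    simp only [cross, Prod.fst_add, Prod.snd_add, Prod.smul_fst, Prod.smul_snd, smul_eq_mul] at *
    linear_combination (2⁻¹ * (2 / 3) - 3⁻¹ * 2⁻¹ : ℝ) * h0)
  refine h.1 ?_
  have h4 : (6⁻¹ : ℝ) • x = (6⁻¹ : ℝ) • y := by
    linear_combination (norm := module) h3
  exact smul_right_injective _ (by norm_num : (6⁻¹ : ℝ) ≠ 0) h4

theorem cross_left_ne_zero (hx : x ∈ t.carrier) (hy : y ∈ t.carrier) {o : Plane}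
    (h : cross o x y ≠ 0) {z : Plane} (hz : cross o z t.left = 0) (hz' : cross o z t.right = 0) :
    z = o := by
  have h1 : cross o z x = 0 := Seg.cross_eq_zero_of_two t.left_mem t.right_mem t.left_ne_right hz hz' hx
  have h2 : cross o z y = 0 := Seg.cross_eq_zero_of_two t.left_mem t.right_mem t.left_ne_right hz hz' hy
  simp only [cross] at *
  have k1 : (z.1 - o.1) * ((x.1 - o.1) * (y.2 - o.2) - (x.2 - o.2) * (y.1 - o.1)) = 0 := by
    linear_combination (x.1 - o.1) * h2 - (y.1 - o.1) * h1
  have k2 : (z.2 - o.2) * ((x.1 - o.1) * (y.2 - o.2) - (x.2 - o.2) * (y.1 - o.1)) = 0 := by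
    linear_combination (x.2 - o.2) * h2 - (y.2 - o.2) * h1
  ext
  · linarith [(mul_eq_zero.1 k1).resolve_right h]
  · linarith [(mul_eq_zero.1 k2).resolve_right h]

/-- The visible part of a segment is open in the segment, apart from endpoints. -/
theorem eventually_visible (hS : Scene S s σ) (ht : t ∈ S) {z : Plane}
    (hz : z ∈ visiblePart S s σ t) (hze : z ∉ endpoints S) (hx : x ∈ t.carrier) (hy : y ∈ t.carrier)
    (hxy : cross s.left x y ≠ 0) : ∀ᶠ w in 𝓝 z, w ∈ t.carrier → w ∈ visiblePart S s σ t := by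
  have h0 := hS.left_height
  have hz0 : 0 < height s σ z := hz.2.1
  have hA := (sees_iff_of_pos s.left_mem hz0).1 hz.2.2
  have hpos : ∀ᶠ w in 𝓝 z, 0 < height s σ w :=
    eventually_lt_of_continuous (by fun_prop) (by fun_prop) hz0
  have hfar : ∀ᶠ w in 𝓝 z, ∀ t' ∈ S, t' ≠ s → t' ≠ t → Disjoint (segment ℝ s.left w) t'.carrier := by
    rw [eventually_all_finite hS.finite]
    intro t' ht'
    by_cases hts : t' = s ∨ t' = t
    · exact Eventually.of_forall fun x h1 h2 => by tauto
    push Not at hts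
    have hd : Disjoint (segment ℝ s.left z) t'.carrier := by
      rw [← insert_endpoints_openSegment, Set.disjoint_left]
      rintro w (rfl | rfl | hw) hwt
      · exact hS.notMem_others s.left_mem ⟨t', ht', hts.1, hwt⟩
      · exact Set.disjoint_left.1 (hS.inner_disjoint ht' ht hts.2)
          (Seg.mem_inner_of_notMem_ends hwt fun h => hze ⟨t', ht', h⟩)
          (Seg.mem_inner_of_notMem_ends hz.1 fun h => hze ⟨t, ht, h⟩)
      · exact hA.notMem ht' hw hwt
    have hc : Continuous fun x : Plane => (s.left, x) := by fun_prop
    exact ((hc.tendsto z).eventually (eventually_disjoint t'.isClosed hd)).mono fun x hx _ _ => hx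
  filter_upwards [hpos, hfar] with w hw hfar hwt
  refine ⟨hwt, hw, Or.inr fun t' ht' => ?_⟩
  by_cases hts : t' = s
  · subst hts
    rw [Set.disjoint_left]
    intro v hv hvt
    exact (height_pos_of_mem_openSegment h0.ge hw hv).ne' (height_eq_zero hvt)
  by_cases htt : t' = t
  · subst htt
    rw [Set.disjoint_left]
    intro v hv hvt
    obtain ⟨v0, v1, v2⟩ := (mem_openSegment_iff (by rwa [h0])).1 hv
    have hvw : v ≠ w := by rintro rfl; exact lt_irrefl _ v2
    have := cross_left_ne_zero hx hy hxy
      (Seg.cross_eq_zero_of_two hvt hwt hvw v0 (by simp) t'.left_mem)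
      (Seg.cross_eq_zero_of_two hvt hwt hvw v0 (by simp) t'.right_mem)
    rw [this, h0] at hw
    exact lt_irrefl _ hw
  · exact (hfar t' ht' hts htt).mono_left (openSegment_subset_segment ..)

/-- A segment can be extended beyond an inner point. -/
theorem Seg.eventually_extend {x y : Plane} (hx : x ∈ t.inner) (hy : y ∈ t.carrier) :
    ∀ᶠ ν : ℝ in 𝓝[>] 0, x + ν • (x - y) ∈ t.carrier := by
  obtain ⟨a, b, ha, hb, hab, rfl⟩ := hx
  obtain ⟨c, d, hc, hd, hcd, rfl⟩ := hy
  have h1 : ∀ᶠ ν : ℝ in 𝓝 0, 0 < a + ν * (a - c) :=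
    eventually_lt_of_continuous (by fun_prop) (by fun_prop) (by simpa using ha)
  have h2 : ∀ᶠ ν : ℝ in 𝓝 0, 0 < b + ν * (b - d) :=
    eventually_lt_of_continuous (by fun_prop) (by fun_prop) (by simpa using hb)
  filter_upwards [h1.filter_mono nhdsWithin_le_nhds, h2.filter_mono nhdsWithin_le_nhds] with ν h1 h2
  refine ⟨_, _, h1.le, h2.le, by linear_combination (1 + ν) * hab - ν * hcd, ?_⟩
  module

/-- A visible edge ends at an endpoint, or a part of its points beyond is not visible. -/
theorem IsVisibleEdge.left_mem_endpoints (hS : Scene S s σ) (ht : t ∈ S)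
    (h : IsVisibleEdge S s σ t x y) (hx0 : 0 < height s σ x)
    (hA : Avoids S (openSegment ℝ s.left x)) : x ∈ endpoints S := by
  by_contra hxe
  have hxt := h.left_mem
  have hyt := h.right_mem
  have hxi := Seg.mem_inner_of_notMem_ends hxt fun h => hxe ⟨t, ht, h⟩
  have hxv : x ∈ visiblePart S s σ t := ⟨hxt, hx0, Or.inr hA⟩
  have hev := eventually_visible hS ht hxv hxe hxt hyt (h.cross_ne_zero hS ht)
  have hc : Continuous fun ν : ℝ => x + ν • (x - y) := by fun_prop
  have hev' : ∀ᶠ ν : ℝ in 𝓝[>] 0, x + ν • (x - y) ∈ t.carrier →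
      x + ν • (x - y) ∈ visiblePart S s σ t := by
    refine Eventually.filter_mono nhdsWithin_le_nhds ?_
    have := hc.tendsto 0
    rw [zero_smul, add_zero] at this
    exact this.eventually hev
  have hall : ∀ᶠ ν : ℝ in 𝓝[>] 0, x + ν • (x - y) ∈ visiblePart S s σ t := by
    filter_upwards [hev', Seg.eventually_extend hxi hyt] with ν h1 h2 using h1 h2
  rw [eventually_nhdsWithin_iff, Metric.eventually_nhds_iff] at hall
  obtain ⟨ε, hε, hall⟩ := hall
  have hsub : openSegment ℝ (x + ε • (x - y)) y ⊆ visiblePart S s σ t := by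
    rintro z ⟨a, b, ha, hb, hab, rfl⟩
    obtain rfl : b = 1 - a := by linarith
    have key : a • (x + ε • (x - y)) + (1 - a) • y = x + (a * (1 + ε) - 1) • (x - y) := by module
    rw [key]
    rcases lt_trichotomy (a * (1 + ε) - 1) 0 with h' | h' | h'
    · exact h.2.1 ⟨a * (1 + ε), 1 - a * (1 + ε), by positivity, by linarith, by ring, by module⟩
    · rwa [h', zero_smul, add_zero]
    · refine hall ?_ h'
      rw [Real.dist_eq, sub_zero, abs_of_pos h']
      nlinarith
  have hmem : x ∈ openSegment ℝ (x + ε • (x - y)) y := by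
    refine ⟨1 / (1 + ε), ε / (1 + ε), by positivity, by positivity, by field_simp, ?_⟩
    ext <;> simp <;> field_simp <;> ring
  have hsub' : openSegment ℝ x y ⊆ openSegment ℝ (x + ε • (x - y)) y := by
    rintro z ⟨a, b, ha, hb, hab, rfl⟩
    refine ⟨a / (1 + ε), 1 - a / (1 + ε), by positivity, ?_, by ring, ?_⟩
    · rw [sub_pos, div_lt_one (by positivity)]
      linarith
    · obtain rfl : b = 1 - a := by linarith
      ext <;> simp <;> field_simp <;> ring
  -- Visible points of `t` just beyond `x` give a longer visible open segment that contains `x`,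
  -- against maximality.
  rw [h.2.2 _ _ hsub' hsub, left_mem_openSegment_iff] at hmem
  exact h.1 hmem

/-- There is an edge of the extended visibility graph along the left side of an initial triangle. -/
theorem IsVisibleEdge.exists_evgEdge (hS : Scene S s σ) (ht : t ∈ S)
    (h : IsVisibleEdge S s σ t x y) (hl : σ * cross s.left x y < 0) :
    ∃ κ : ℝ, 0 < κ ∧ EVGEdge S s.left (s.left + κ • (x - s.left)) ∧
      (height s σ x = 0 → ∃ c : ℝ, c < 0 ∧ x = s.left + c • (s.right - s.left)) := by
  have h0 := hS.left_height
  have hxt := h.left_mem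
  have hx0 : 0 ≤ height s σ x := (h.segment_subset (left_mem_segment ..)).2
  have hy0 : 0 ≤ height s σ y := (h.segment_subset (right_mem_segment ..)).2
  rcases hx0.eq_or_lt with hx0 | hx0
  -- `x` is on the supporting line of `s`. As `y` is to the right of `x`, the point `x` lies beyond
  -- `s.left`, and the required edge is the extension of `s` beyond `s.left`.
  · have hls : 0 < s.right.1 - s.left.1 := sub_pos.2 s.left_lt_right
    obtain ⟨c, hc⟩ : ∃ c : ℝ, x = s.left + c • (s.right - s.left) := by
      have h1 : cross s.left s.right x = 0 := (mul_eq_zero.1 hx0.symm).resolve_left hS.side_ne_zero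
      refine ⟨(x.1 - s.left.1) / (s.right.1 - s.left.1), ?_⟩
      simp only [cross] at h1
      ext
      · simp; field_simp; ring
      · simp; field_simp; linear_combination h1
    have hcy : σ * cross s.left x y = c * height s σ y := by
      rw [hc, height]
      simp only [cross, Prod.fst_add, Prod.snd_add, Prod.smul_fst, Prod.smul_snd, smul_eq_mul,
        Prod.fst_sub, Prod.snd_sub]
      ring
    have hc0 : c < 0 := by
      rw [hcy] at hl
      by_contra! hcon
      exact absurd (mul_nonneg hcon hy0) (not_le.2 hl)
    have hts : t ≠ s := by
      rintro rfl
      have h1 : (2⁻¹ : ℝ) • x + (2⁻¹ : ℝ) • y ∈ openSegment ℝ x y :=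
        ⟨_, _, by norm_num, by norm_num, by norm_num, rfl⟩
      have h2 := h.2.1 h1
      exact (show 0 < height t σ _ from h2.2.1).ne' (height_eq_zero h2.1)
    obtain ⟨r, ⟨t', ht', hts', hrt⟩, hrp, hr, hd⟩ := exists_first (isClosed_others s hS.finite)
      (hS.notMem_others s.left_mem) (x := x) ⟨t, ht, hts, hxt⟩
    obtain ⟨κ, hκ, rfl⟩ : ∃ κ : ℝ, 0 < κ ∧ r = s.left + κ • (x - s.left) := by
      obtain ⟨a, b, ha, hb, hab, rfl⟩ := hr
      obtain rfl : a = 1 - b := by linarith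
      refine ⟨b, lt_of_le_of_ne hb ?_, by module⟩
      rintro rfl
      simp at hrp
    refine ⟨κ, hκ, Or.inr (Or.inl ⟨s.right, hS.vgEdge_self', ?_, ⟨t', ht', hrt⟩, ?_⟩),
      fun _ => ⟨c, hc0, hc⟩⟩
    · refine ⟨(-(κ * c)) / (1 - κ * c), 1 / (1 - κ * c), ?_, ?_, ?_, ?_⟩
      · have : κ * c < 0 := mul_neg_of_pos_of_neg hκ hc0
        exact div_pos (by linarith) (by linarith)
      · have : κ * c < 0 := mul_neg_of_pos_of_neg hκ hc0
        exact div_pos (by linarith) (by linarith)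
      · have : κ * c < 0 := mul_neg_of_pos_of_neg hκ hc0
        have : 1 - κ * c ≠ 0 := by linarith
        field_simp
        ring
      · have : κ * c < 0 := mul_neg_of_pos_of_neg hκ hc0
        have : 1 - κ * c ≠ 0 := by linarith
        rw [hc]
        ext <;> simp <;> field_simp <;> ring
    · intro t'' ht''
      rw [Set.disjoint_left]
      intro z hz hzt
      by_cases hts : t'' = s
      · subst hts
        obtain ⟨a, b, ha, hb, hab, rfl⟩ := hz
        obtain ⟨τ, hτ, hτz⟩ := Seg.exists_pt_eq hzt
        obtain rfl : a = 1 - b := by linarith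
        have h1 := congrArg Prod.fst hτz
        rw [hc, Seg.pt_eq] at h1
        simp only [Prod.fst_add, Prod.smul_fst, smul_eq_mul, Prod.fst_sub, add_sub_cancel_left] at h1
        have h2 : (τ - b * κ * c) * (t''.right.1 - t''.left.1) = 0 := by linear_combination h1
        have h3 := (mul_eq_zero.1 h2).resolve_right hls.ne'
        have h4 : b * κ * c < 0 := mul_neg_of_pos_of_neg (by positivity) hc0
        linarith [hτ.1]
      · exact Set.disjoint_left.1 hd hz ⟨t'', ht'', hts, hzt⟩
  · obtain ⟨r, hr, hr0, ⟨t', ht', hrt⟩, hA⟩ := hS.exists_first_hit s.left_mem hx0 ht hxt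
    have hpx : height s σ s.left < height s σ x := by rwa [h0]
    obtain ⟨r0, r1, r2⟩ := (mem_segment_iff hpx).1 hr
    have hre : r ∈ endpoints S := by
      rcases r2.eq_or_lt with heq | hlt
      · obtain rfl := eq_of_height_eq hpx r0 (by simp) heq
        exact h.left_mem_endpoints hS ht hr0 hA
      · refine ⟨t', ht', ?_⟩
        -- The line of sight to `x` is a limit of free ones, to inner points of the visible edge.
        have hn : NoCross s.left x t' := by
          refine noCross_of_frequently hS.side_ne_zero hpx ?_
          have hc : Continuous fun ν : ℝ => (s.left, x + ν • (y - x)) := by fun_prop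
          have htend : Tendsto (fun ν : ℝ => (s.left, x + ν • (y - x))) (𝓝[>] 0) (𝓝 (s.left, x)) := by
            have := hc.tendsto 0
            rw [zero_smul, add_zero] at this
            exact this.mono_left nhdsWithin_le_nhds
          refine htend.frequently (Eventually.frequently ?_)
          filter_upwards [Ioo_mem_nhdsGT (show (0 : ℝ) < 1 by norm_num)] with ν hν
          have hv := h.2.1 (show x + ν • (y - x) ∈ openSegment ℝ x y from
            ⟨1 - ν, ν, by linarith [hν.2], hν.1, by ring, by module⟩)
          exact (sees_iff_of_pos s.left_mem hv.2.1).1 hv.2.2 t' ht'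
        exact hn.mem_ends hpx (fun hpt => hS.notMem_others s.left_mem ⟨t', ht', by
          rintro rfl; exact hr0.ne' (height_eq_zero hrt), hpt⟩) hrt
          ((mem_openSegment_iff hpx).2 ⟨r0, by rwa [h0], hlt⟩) (hA t' ht')
    have hrx : r = s.left + (height s σ r / height s σ x) • (x - s.left) := by
      have := eq_of_cross_eq_zero hpx r0
      rw [h0, sub_zero, sub_zero] at this
      nth_rw 1 [this]
      module
    refine ⟨height s σ r / height s σ x, by positivity, ?_, fun h => absurd h hx0.ne'⟩
    rw [← hrx]
    refine Or.inl ⟨?_, ⟨s, hS.mem, Or.inl rfl⟩, hre, Or.inl hA⟩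
    rintro rfl
    exact hr0.ne' h0

theorem Seg.exists_openSegment_eq (hx : x ∈ t.carrier) (hy : y ∈ t.carrier) (hxy : x ≠ y) :
    ∃ u v : ℝ, u < v ∧ openSegment ℝ x y = t.pt '' Ioo u v := by
  obtain ⟨u, hu, rfl⟩ := exists_pt_eq hx
  obtain ⟨v, hv, rfl⟩ := exists_pt_eq hy
  have himg : ∀ u v : ℝ, openSegment ℝ (t.pt u) (t.pt v) = t.pt '' openSegment ℝ u v := fun u v =>
    (image_openSegment ℝ (AffineMap.lineMap t.left t.right : ℝ →ᵃ[ℝ] Plane) u v).symm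
  rcases lt_trichotomy u v with h | rfl | h
  · exact ⟨u, v, h, by rw [himg, openSegment_eq_Ioo h]⟩
  · exact absurd rfl hxy
  · exact ⟨v, u, h, by rw [himg, openSegment_symm, openSegment_eq_Ioo h]⟩

theorem Seg.pt_image_Ioo (t : Seg) {u v : ℝ} (h : u < v) :
    t.pt '' Ioo u v = openSegment ℝ (t.pt u) (t.pt v) := by
  rw [← openSegment_eq_Ioo h]
  exact image_openSegment ℝ (AffineMap.lineMap t.left t.right : ℝ →ᵃ[ℝ] Plane) u v

/-- Two visible edges on a segment that overlap are equal. -/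
theorem IsVisibleEdge.openSegment_eq {x' y' z : Plane} (h : IsVisibleEdge S s σ t x y)
    (h' : IsVisibleEdge S s σ t x' y') (hz : z ∈ openSegment ℝ x y)
    (hz' : z ∈ openSegment ℝ x' y') : openSegment ℝ x y = openSegment ℝ x' y' := by
  obtain ⟨u, v, huv, h1⟩ := Seg.exists_openSegment_eq h.left_mem h.right_mem h.1
  obtain ⟨u', v', huv', h1'⟩ := Seg.exists_openSegment_eq h'.left_mem h'.right_mem h'.1
  rw [h1] at hz
  rw [h1'] at hz'
  obtain ⟨c, hc, rfl⟩ := hz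
  obtain ⟨c', hc', hcc⟩ := hz'
  obtain rfl := t.pt_injective hcc
  have hlt : min u u' < max v v' := (min_le_left _ _).trans_lt (huv.trans_le (le_max_left _ _))
  have hsub : t.pt '' Ioo (min u u') (max v v') ⊆ visiblePart S s σ t := by
    rintro _ ⟨d, ⟨hd1, hd2⟩, rfl⟩
    rw [min_lt_iff] at hd1
    rw [lt_max_iff] at hd2
    by_cases hd : d ∈ Ioo u v
    · exact h.2.1 (h1 ▸ mem_image_of_mem _ hd)
    · refine h'.2.1 (h1' ▸ mem_image_of_mem _ ?_)
      simp only [mem_Ioo, not_and_or, not_lt] at hd hc hc' ⊢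
      rcases hd with hd | hd
      · exact ⟨hd1.resolve_left (not_lt.2 hd), by linarith [hc.1, hc'.2]⟩
      · exact ⟨by linarith [hc.2, hc'.1], hd2.resolve_left (not_lt.2 hd)⟩
  have k1 := h.2.2 (t.pt (min u u')) (t.pt (max v v')) (by
    rw [h1, ← t.pt_image_Ioo hlt]
    exact image_mono (Ioo_subset_Ioo (min_le_left _ _) (le_max_left _ _)))
    (by rwa [← t.pt_image_Ioo hlt])
  have k2 := h'.2.2 (t.pt (min u u')) (t.pt (max v v')) (by
    rw [h1', ← t.pt_image_Ioo hlt]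
    exact image_mono (Ioo_subset_Ioo (min_le_right _ _) (le_max_right _ _)))
    (by rwa [← t.pt_image_Ioo hlt])
  rw [← k1, k2]

theorem convexHull_eq_of_openSegment_eq {p x y x' y' : Plane}
    (h : openSegment ℝ x y = openSegment ℝ x' y') :
    convexHull ℝ {p, x, y} = convexHull ℝ {p, x', y'} := by
  rw [convexHull_insert (insert_nonempty _ _), convexHull_insert (insert_nonempty _ _),
    convexHull_pair, convexHull_pair, ← closure_openSegment, ← closure_openSegment, h]

/-- An initial triangle is determined by its left side. -/
theorem IsVisibleEdge.convexHull_eq (hS : Scene S s σ) {t' : Seg} (ht : t ∈ S) (ht' : t' ∈ S)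
    {x' y' : Plane} (h : IsVisibleEdge S s σ t x y) (h' : IsVisibleEdge S s σ t' x' y')
    (hl : σ * cross s.left x y < 0) (hl' : σ * cross s.left x' y' < 0) {κ : ℝ} (hκ : 0 < κ)
    (hx : x' = s.left + κ • (x - s.left)) :
    convexHull ℝ {s.left, x, y} = convexHull ℝ {s.left, x', y'} := by
  obtain ⟨z, hz, z', hz', hzz⟩ : ∃ z ∈ openSegment ℝ x y, ∃ z' ∈ openSegment ℝ x' y',
      cross s.left z z' = 0 := by
    -- Both edges begin on the same ray and lead to the right of it, so some ray slightly to the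
    -- right meets both: `z` is proportional to `x + ε y` relative to `s.left`, and the weights of
    -- `x'` and `y'` solve `cross s.left z z' = 0`. A small `ε` makes them positive.
    set m := - (σ * cross s.left x y) with hm
    set n := - (σ * cross s.left x' y') with hn
    have hm0 : 0 < m := by linarith
    have hn0 : 0 < n := by linarith
    set A := σ * cross s.left y y' with hA
    have hA1 : 0 < 1 + |A| := by positivity
    obtain ⟨ε, hε, hεA⟩ : ∃ ε : ℝ, 0 < ε ∧ 0 < n - ε * A * κ := by
      have hc : ∀ᶠ ε : ℝ in 𝓝 0, 0 < n - ε * A * κ :=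
        eventually_lt_of_continuous (by fun_prop) (by fun_prop) (by simpa using hn0)
      obtain ⟨ε, h1, h2⟩ := ((hc.filter_mono (nhdsWithin_le_nhds (s := Ioi 0))).and
        self_mem_nhdsWithin).exists
      exact ⟨ε, h2, h1⟩
    have hB : 0 < ε * m * κ ^ 2 := by positivity
    set W := (n - ε * A * κ) + ε * m * κ ^ 2 with hW
    have hW0 : 0 < W := by positivity
    refine ⟨(1 / (1 + ε)) • x + (ε / (1 + ε)) • y,
      ⟨_, _, by positivity, by positivity, by field_simp, rfl⟩,
      ((n - ε * A * κ) / W) • x' + ((ε * m * κ ^ 2) / W) • y',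
      ⟨_, _, by positivity, by positivity, by field_simp; linarith, rfl⟩, ?_⟩
    rw [cross_comb _ _ _ _ (by field_simp; linarith)]
    have h1ε : 1 + ε ≠ 0 := by positivity
    have hσ := hS.side_ne_zero
    rw [hx] at hn ⊢
    field_simp
    rw [hn, hm, hA]
    simp only [cross, Prod.fst_add, Prod.snd_add, Prod.smul_fst, Prod.smul_snd, smul_eq_mul,
      Prod.fst_sub, Prod.snd_sub]
    field_simp
    ring
  obtain rfl := eq_of_visible hS ht ht' (h.2.1 hz) (h'.2.1 hz') hzz
  obtain rfl : t = t' := by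
    by_contra hne
    exact Set.disjoint_left.1 (hS.inner_disjoint ht ht' hne)
      (Seg.openSegment_subset_inner h.left_mem h.right_mem h.1 hz)
      (Seg.openSegment_subset_inner h'.left_mem h'.right_mem h'.1 hz')
  exact convexHull_eq_of_openSegment_eq (h.openSegment_eq h' hz hz')

/-- Initial triangles with their sides in order. -/
theorem exists_left_right (hS : Scene S s σ) {T : Set Plane} (hT : T ∈ initialTriangles S s σ) :
    ∃ t ∈ S, ∃ x y, IsVisibleEdge S s σ t x y ∧ σ * cross s.left x y < 0 ∧
      T = convexHull ℝ {s.left, x, y} := by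
  obtain ⟨t, ht, x, y, h, rfl⟩ := hT
  rcases lt_or_gt_of_ne (mul_ne_zero hS.side_ne_zero (h.cross_ne_zero hS ht)) with h1 | h1
  · exact ⟨t, ht, x, y, h, h1, rfl⟩
  · exact ⟨t, ht, y, x, h.symm, by rw [cross_swap]; linarith, by rw [Set.pair_comm]⟩

theorem initial_isTriangle (hS : Scene S s σ) {T : Set Plane} (hT : T ∈ initialTriangles S s σ) :
    IsTriangle T := by
  obtain ⟨t, ht, x, y, h, rfl⟩ := hT
  exact isTriangle_of_cross (h.cross_ne_zero hS ht)

theorem initial_interior_subset (hS : Scene S s σ) {T : Set Plane}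
    (hT : T ∈ initialTriangles S s σ) : interior T ⊆ openRegion S s σ := by
  obtain ⟨t, ht, x, y, h, rfl⟩ := hT
  intro p hp
  obtain ⟨u, v, w, hu, hv, hw, huvw, hx⟩ :=
    exists_weights_of_mem_interior (h.cross_ne_zero hS ht) hp
  obtain ⟨z, hz, hpz⟩ := exists_mem_openSegment_of_weights hu hv hw huvw hx
  have hv := h.2.1 hz
  refine ⟨height_pos_of_mem_openSegment hS.left_height.ge hv.2.1 hpz, s.left, s.left_mem, Or.inr ?_⟩
  exact ((sees_iff_of_pos s.left_mem hv.2.1).1 hv.2.2).mono (openSegment_subset_of_mem hpz)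

theorem initial_subset_closure (hS : Scene S s σ) {T : Set Plane}
    (hT : T ∈ initialTriangles S s σ) : T ⊆ closure (openRegion S s σ) := by
  have h1 := initial_interior_subset hS hT
  obtain ⟨t, ht, x, y, h, rfl⟩ := hT
  exact (convexHull_subset_closure_interior (h.cross_ne_zero hS ht)).trans (closure_mono h1)

end


/-! ### Points in general position -/

/-- The point `x` is not on a line through two endpoints. -/
def Generic (S : Set Seg) (x : Plane) : Prop :=
  ∀ a ∈ endpoints S, ∀ b ∈ endpoints S, a ≠ b → cross a b x ≠ 0

theorem dense_cross_ne_zero {a b : Plane} (h : a ≠ b) : Dense {x | cross a b x ≠ 0} := by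
  intro x
  by_cases hx : cross a b x = 0
  swap
  · exact subset_closure hx
  have hn : 0 < (b.1 - a.1) ^ 2 + (b.2 - a.2) ^ 2 := by
    by_contra! hcon
    have h1 : b.1 - a.1 = 0 := by nlinarith [sq_nonneg (b.1 - a.1), sq_nonneg (b.2 - a.2)]
    have h2 : b.2 - a.2 = 0 := by nlinarith [sq_nonneg (b.1 - a.1), sq_nonneg (b.2 - a.2)]
    exact h (by ext <;> linarith)
  have hc : Continuous fun ε : ℝ => x + ε • ((-(b.2 - a.2), b.1 - a.1) : Plane) := by fun_prop
  have ht := hc.tendsto 0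
  rw [zero_smul, add_zero] at ht
  refine mem_closure_of_tendsto (ht.mono_left (nhdsWithin_le_nhds (s := Ioi 0))) ?_
  filter_upwards [self_mem_nhdsWithin] with ε hε
  have : cross a b (x + ε • ((-(b.2 - a.2), b.1 - a.1) : Plane)) =
      cross a b x + ε * ((b.1 - a.1) ^ 2 + (b.2 - a.2) ^ 2) := by
    simp only [cross, Prod.fst_add, Prod.snd_add, Prod.smul_fst, Prod.smul_snd, smul_eq_mul]
    ring
  change cross a b _ ≠ 0
  rw [this, hx, zero_add]
  exact (mul_pos hε hn).ne'

/-- Finitely many lines have a dense complement. -/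
theorem exists_generic {S : Set Seg} (hS : S.Finite) {U : Set Plane} (hU : IsOpen U)
    (hne : U.Nonempty) : ∃ x ∈ U, Generic S x := by
  have hE := endpoints_finite hS
  have hd : Dense (⋂ e ∈ {e : Plane × Plane | e.1 ∈ endpoints S ∧ e.2 ∈ endpoints S ∧ e.1 ≠ e.2},
      {x | cross e.1 e.2 x ≠ 0}) := by
    refine dense_biInter_of_isOpen (fun e _ => ?_) ?_ fun e he => dense_cross_ne_zero he.2.2
    · exact isOpen_ne_fun (by fun_prop) (by fun_prop)
    · exact ((hE.prod hE).subset fun e he => ⟨he.1, he.2.1⟩).countable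
  obtain ⟨x, hxU, hx⟩ := hd.inter_open_nonempty U hU hne
  refine ⟨x, hxU, fun a ha b hb hab => ?_⟩
  exact mem_iInter₂.1 hx (a, b) ⟨ha, hb, hab⟩

section

variable {S : Set Seg} {s : Seg} {σ : ℝ} {x : Plane}

theorem cross_eq_zero_of_mem {t : Seg} {z : Plane} (hz : z ∈ t.carrier) :
    cross t.left t.right z = 0 :=
  Seg.cross_eq_zero_of_two t.left_mem t.right_mem t.left_ne_right (by simp) (by simp) hz

theorem Generic.cross_ends (hx : Generic S x) {t : Seg} (ht : t ∈ S) :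
    cross t.left t.right x ≠ 0 :=
  hx _ ⟨t, ht, Or.inl rfl⟩ _ ⟨t, ht, Or.inr rfl⟩ t.left_ne_right

theorem Generic.notMem (hx : Generic S x) {t : Seg} (ht : t ∈ S) : x ∉ t.carrier := fun h =>
  hx.cross_ends ht (cross_eq_zero_of_mem h)

theorem Generic.notMem_others (hx : Generic S x) : x ∉ others S s := by
  rintro ⟨t, ht, -, hxt⟩
  exact hx.notMem ht hxt

theorem sees_of_disjoint {p : Plane} (hp : p ∈ s.carrier) (hx : 0 < height s σ x)
    (h : Disjoint (segment ℝ p x) (others S s)) : Sees S p x :=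
  Or.inr (avoids_of_disjoint_others
    (fun _ hz => height_pos_of_mem_openSegment (height_eq_zero hp).ge hx hz)
    (h.mono_left (openSegment_subset_segment ..)))

theorem mem_closure_height_pos (hσ : σ ≠ 0) (hx : 0 ≤ height s σ x) :
    x ∈ closure {z | 0 < height s σ z} := by
  have hc : Continuous fun ε : ℝ => x + ε • ((-(σ * (s.right.2 - s.left.2)),
    σ * (s.right.1 - s.left.1)) : Plane) := by fun_prop
  have ht := hc.tendsto 0
  rw [zero_smul, add_zero] at ht
  refine mem_closure_of_tendsto (ht.mono_left (nhdsWithin_le_nhds (s := Ioi 0))) ?_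
  filter_upwards [self_mem_nhdsWithin] with ε hε
  have : height s σ (x + ε • ((-(σ * (s.right.2 - s.left.2)),
      σ * (s.right.1 - s.left.1)) : Plane)) = height s σ x +
      ε * (σ ^ 2 * ((s.right.1 - s.left.1) ^ 2 + (s.right.2 - s.left.2) ^ 2)) := by
    simp only [height, cross, Prod.fst_add, Prod.snd_add, Prod.smul_fst, Prod.smul_snd, smul_eq_mul]
    ring
  change 0 < height s σ _
  rw [this]
  have h1 : 0 < s.right.1 - s.left.1 := sub_pos.2 s.left_lt_right
  have h2 : (0 : ℝ) < ε := hε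
  positivity

/-- A free closed segment stays free when its upper end moves, so this end can be moved off finitely
many lines and strictly above `s`. -/
theorem mem_closure_generic (hS : Scene S s σ) {p : Plane} (hp : p ∈ s.carrier)
    (hx : 0 ≤ height s σ x) (h : Disjoint (segment ℝ p x) (others S s)) :
    x ∈ closure {z | Generic S z ∧ z ∈ openRegion S s σ} := by
  rw [mem_closure_iff_nhds]
  intro U hU
  have hc : Continuous fun z : Plane => (p, z) := by fun_prop
  have h1 := (hc.tendsto x).eventually (eventually_disjoint (isClosed_others s hS.finite) h)
  obtain ⟨V, hV, hVo, hxV⟩ := mem_nhds_iff.1 (inter_mem hU h1)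
  have hO : IsOpen {z | 0 < height s σ z} := isOpen_lt (by fun_prop) (by fun_prop)
  obtain ⟨z, ⟨hzV, hz⟩, hzg⟩ := exists_generic hS.finite (hVo.inter hO)
    (mem_closure_iff.1 (mem_closure_height_pos hS.side_ne_zero hx) V hVo hxV)
  exact ⟨z, (hV hzV).1, hzg, hz, p, hp, sees_of_disjoint hp hz (hV hzV).2⟩

/-- The closed region is the closure of its generic points. -/
theorem region_subset_closure (hS : Scene S s σ) :
    region S s ∩ {x | 0 ≤ height s σ x} ⊆ closure {z | Generic S z ∧ z ∈ openRegion S s σ} := by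
  rintro x ⟨hx, hx0⟩
  obtain ⟨p, hp, hpx⟩ := mem_iUnion₂.1 hx
  have hp0 := height_eq_zero (σ := σ) hp
  rcases hpx with rfl | hA
  · refine mem_closure_generic hS hp hx0 ?_
    rw [segment_same, Set.disjoint_singleton_left]
    exact hS.notMem_others hp
  · have hsub : openSegment ℝ p x ⊆ closure {z | Generic S z ∧ z ∈ openRegion S s σ} := by
      intro z hz
      refine mem_closure_generic hS hp ?_ ?_
      · obtain ⟨a, b, ha, hb, hab, rfl⟩ := hz
        rw [height_comb _ _ _ _ hab, hp0, mul_zero, zero_add]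
        exact mul_nonneg hb.le hx0
      · rw [← insert_endpoints_openSegment, Set.disjoint_left]
        rintro w (rfl | rfl | hw) hwo
        · exact hS.notMem_others hp hwo
        · exact Set.disjoint_left.1 hA.disjoint_others hz hwo
        · exact Set.disjoint_left.1 hA.disjoint_others (openSegment_subset_of_mem hz hw) hwo
    exact closure_minimal hsub isClosed_closure (by
      rw [closure_openSegment]; exact right_mem_segment ..)

/-! ### The triangles cover the region -/

/-- The maximal visible subsegment around a point. -/
theorem exists_isVisibleEdge {t : Seg} {ζ : ℝ} (h : {u | t.pt u ∈ visiblePart S s σ t} ∈ 𝓝 ζ) :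
    ∃ x y, IsVisibleEdge S s σ t x y ∧ t.pt ζ ∈ openSegment ℝ x y := by
  set V := {u | t.pt u ∈ visiblePart S s σ t} with hV
  have hV01 : V ⊆ Icc 0 1 := by
    intro u hu
    obtain ⟨v, hv, hvu⟩ := Seg.exists_pt_eq hu.1
    rwa [← t.pt_injective hvu]
  obtain ⟨ε, hε, hball⟩ := Metric.mem_nhds_iff.1 h
  rw [Real.ball_eq_Ioo] at hball
  -- The infimum of `A` and the supremum of `B` bound the component of `ζ` in the visible
  -- parameters.
  set A := {u | u < ζ ∧ Ioc u ζ ⊆ V} with hA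
  set B := {v | ζ < v ∧ Ico ζ v ⊆ V} with hB
  have hAε : ζ - ε ∈ A := ⟨by linarith, fun c hc => hball ⟨hc.1, by linarith [hc.2]⟩⟩
  have hBε : ζ + ε ∈ B := ⟨by linarith, fun c hc => hball ⟨by linarith [hc.1], hc.2⟩⟩
  have hAb : BddBelow A := by
    refine ⟨0, fun u hu => ?_⟩
    by_contra! hcon
    have h2 : u / 2 ∈ V := hu.2 ⟨by linarith, by linarith [(hV01 (mem_of_mem_nhds h)).1]⟩
    linarith [(hV01 h2).1]
  have hBb : BddAbove B := by
    refine ⟨1, fun v hv => ?_⟩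
    by_contra! hcon
    have h2 : (v + 1) / 2 ∈ V := hv.2 ⟨by linarith [(hV01 (mem_of_mem_nhds h)).2], by linarith⟩
    linarith [(hV01 h2).2]
  have hα : sInf A < ζ := (csInf_le hAb hAε).trans_lt (by linarith)
  have hβ : ζ < sSup B := lt_of_lt_of_le (by linarith) (le_csSup hBb hBε)
  have hsub : Ioo (sInf A) (sSup B) ⊆ V := by
    intro c hc
    rcases le_or_gt c ζ with h' | h'
    · obtain ⟨u, hu, huc⟩ := exists_lt_of_csInf_lt ⟨_, hAε⟩ hc.1
      exact hu.2 ⟨huc, h'⟩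
    · obtain ⟨v, hv, hcv⟩ := exists_lt_of_lt_csSup ⟨_, hBε⟩ hc.2
      exact hv.2 ⟨h'.le, hcv⟩
  have hlt := hα.trans hβ
  refine ⟨t.pt (sInf A), t.pt (sSup B), ⟨fun h => hlt.ne (t.pt_injective h), ?_, ?_⟩, ?_⟩
  · rw [← t.pt_image_Ioo hlt]
    rintro _ ⟨c, hc, rfl⟩
    exact hsub hc
  · rw [← t.pt_image_Ioo hlt]
    intro x' y' h1 h2
    have hsg : segment ℝ x' y' ⊆ t.carrier := by
      rw [← closure_openSegment]
      exact closure_minimal (fun z hz => (h2 hz).1) t.isClosed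
    have hne : x' ≠ y' := by
      rintro rfl
      rw [openSegment_same] at h1
      have k1 := h1 (mem_image_of_mem _ ⟨hα, hβ⟩)
      have k2 := h1 (mem_image_of_mem _ (show (sInf A + ζ) / 2 ∈ Ioo (sInf A) (sSup B) from
        ⟨by linarith, by linarith⟩))
      have := t.pt_injective (k1.trans k2.symm)
      linarith
    obtain ⟨u, v, huv, huv'⟩ := Seg.exists_openSegment_eq (hsg (left_mem_segment ..))
      (hsg (right_mem_segment ..)) hne
    rw [huv'] at h1 h2 ⊢
    rw [image_subset_image_iff t.pt_injective] at h1
    have huvV : Ioo u v ⊆ V := fun c hc => h2 (mem_image_of_mem _ hc)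
    have hζ := h1 ⟨hα, hβ⟩
    have k1 : sInf A ≤ u := csInf_le hAb ⟨hζ.1, fun c hc => huvV ⟨hc.1, hc.2.trans_lt hζ.2⟩⟩
    have k2 : v ≤ sSup B := le_csSup hBb ⟨hζ.2, fun c hc => huvV ⟨hζ.1.trans_le hc.1, hc.2⟩⟩
    exact congrArg _ (Subset.antisymm (Ioo_subset_Ioo k1 k2) h1)
  · rw [← t.pt_image_Ioo hlt]
    exact mem_image_of_mem _ ⟨hα, hβ⟩

/-- Generic points that are visible from the left endpoint are covered by the initial triangles. -/
theorem exists_initial (hS : Scene S s σ) (hg : Generic S x) (hx : 0 < height s σ x)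
    (h : Sees S s.left x) : ∃ T ∈ initialTriangles S s σ, x ∈ T := by
  have h0 := hS.left_height
  have hA := (sees_iff_of_pos s.left_mem hx).1 h
  obtain ⟨κ, hκ, t0, ht0, hw⟩ := hS.exists_beyond _ s.left_mem _ s.left_mem x hx h
  set w := s.left + κ • (x - s.left) with hwdef
  have hwx : w = (1 - κ) • s.left + κ • x := by rw [hwdef]; module
  have hwh : height s σ w = κ * height s σ x := by
    rw [hwx, height_comb _ _ _ _ (by ring), h0, mul_zero, zero_add]
  have hw0 : 0 < height s σ w := by rw [hwh]; positivity
  obtain ⟨z, hz, hz0, ⟨t, ht, hzt⟩, hAz⟩ := hS.exists_first_hit s.left_mem hw0 ht0 hw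
  obtain ⟨z1, z2, z3⟩ := (mem_segment_iff (by rwa [h0])).1 hz
  have hwl : cross s.left x w = 0 := by
    rw [hwx, cross_comb _ _ _ _ (by ring)]
    simp
  have hpx : height s σ s.left < height s σ x := by rwa [h0]
  have hzl : cross s.left x z = 0 := cross_eq_zero_of_line (s := s) (σ := σ) (a := s.left) (b := w)
    (by rwa [h0]) (by simp) (by rw [cross_swap, hwl, neg_zero]) z1
  have hzx : height s σ x < height s σ z := by
    by_contra! hcon
    rcases hcon.lt_or_eq with h' | h'
    · exact hA.notMem ht ((mem_openSegment_iff hpx).2 ⟨hzl, by rwa [h0], h'⟩) hzt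
    · rw [eq_of_height_eq hpx hzl (by simp) h'] at hzt
      exact hg.notMem ht hzt
  have hxo : x ∈ openSegment ℝ s.left z := (mem_openSegment_iff (by rwa [h0])).2
    ⟨by rw [cross_swap, hzl, neg_zero], hpx, hzx⟩
  -- `x` lies on the line through `z` and the endpoint `s.left`.
  have hze : z ∉ endpoints S := by
    intro hze
    refine hg s.left ⟨s, hS.mem, Or.inl rfl⟩ z hze ?_ (by rw [cross_swap, hzl, neg_zero])
    rintro rfl
    exact hz0.ne' h0
  have hcol : cross s.left t.left t.right ≠ 0 := by
    intro hcol
    obtain ⟨a, b, ha, hb, hab, rfl⟩ := hxo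
    refine hg.cross_ends ht ?_
    rw [cross_comb _ _ _ _ hab, cross_eq_zero_of_mem hzt, cross_rotate, hcol]
    ring
  have hzv : z ∈ visiblePart S s σ t := ⟨hzt, hz0, Or.inr hAz⟩
  have hev := eventually_visible hS ht hzv hze t.left_mem t.right_mem hcol
  have hzi := Seg.mem_inner_of_notMem_ends hzt fun h => hze ⟨t, ht, h⟩
  obtain ⟨a, b, ha, hb, hab, hzb⟩ := id hzi
  have hzp : t.pt b = z := by
    rw [Seg.pt_eq, ← hab, add_sub_cancel_right, hzb]
  have hV : {u | t.pt u ∈ visiblePart S s σ t} ∈ 𝓝 b := by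
    have h1 := t.continuous_pt.tendsto b
    rw [hzp] at h1
    filter_upwards [h1.eventually hev, Ioo_mem_nhds hb (show b < 1 by linarith)] with u hu hu'
    exact hu (t.pt_mem (Ioo_subset_Icc_self hu'))
  obtain ⟨x', y', hv, hzo⟩ := exists_isVisibleEdge hV
  rw [hzp] at hzo
  refine ⟨_, ⟨t, ht, x', y', hv, rfl⟩, ?_⟩
  have hc := convex_convexHull ℝ ({s.left, x', y'} : Set Plane)
  have hm : ∀ w ∈ ({s.left, x', y'} : Set Plane), w ∈ convexHull ℝ ({s.left, x', y'} : Set Plane) :=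
    fun w hw => subset_convexHull ℝ _ hw
  exact hc.openSegment_subset (hm _ (by simp))
    (hc.openSegment_subset (hm _ (by simp)) (hm _ (by simp)) hzo) hxo

theorem cross_pt_of_mem (s : Seg) (σ τ τ' : ℝ) (x : Plane) (c : ℝ) :
    σ * cross (s.pt τ') x ((1 - c) • s.pt τ + c • x) = (1 - c) * (τ' - τ) * height s σ x := by
  simp only [Seg.pt_eq, cross, height, Prod.fst_add, Prod.snd_add,
    Prod.smul_fst, Prod.smul_snd, smul_eq_mul]
  ring

/-- When a generic point becomes visible, it is on an active edge. -/
theorem exists_act (hS : Scene S s σ) (hg : Generic S x) (hx : 0 < height s σ x) {τ τ₁ : ℝ}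
    (hτ : 0 ≤ τ) (hττ : τ < τ₁) (hτ₁ : τ₁ ≤ 1)
    (hb : ¬ Disjoint (segment ℝ (s.pt τ) x) (others S s))
    (hv : ∀ τ' ∈ Ioc τ τ₁, Disjoint (segment ℝ (s.pt τ') x) (others S s)) :
    ∃ q t y, Act S s σ (s.pt τ) q t ∧ y ∈ t.carrier ∧ q ∈ openSegment ℝ (s.pt τ) y ∧
      Avoids S (openSegment ℝ q y) ∧ y ∉ endpoints S ∧ x ∈ openSegment ℝ q y := by
  have hp : s.pt τ ∈ s.carrier := s.pt_mem ⟨hτ, by linarith⟩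
  have hp' : ∀ τ' ∈ Ioc τ τ₁, s.pt τ' ∈ s.carrier := fun τ' h =>
    s.pt_mem ⟨by linarith [h.1], h.2.trans hτ₁⟩
  set p := s.pt τ with hpdef
  have hp0 := height_eq_zero (σ := σ) hp
  have hpx : height s σ p < height s σ x := by rwa [hp0]
  have hvA : ∀ τ' ∈ Ioc τ τ₁, Avoids S (openSegment ℝ (s.pt τ') x) := fun τ' h =>
    (sees_iff_of_pos (hp' τ' h) hx).1 (sees_of_disjoint (hp' τ' h) hx (hv τ' h))
  have hnc : ∀ t ∈ S, NoCross p x t := by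
    intro t ht
    refine noCross_of_frequently hS.side_ne_zero hpx ?_
    have hc : Continuous fun τ' : ℝ => (s.pt τ', x) := by fun_prop
    refine ((hc.tendsto τ).mono_left (nhdsWithin_le_nhds (s := Ioi τ))).frequently ?_
    refine Eventually.frequently ?_
    filter_upwards [Ioc_mem_nhdsGT hττ] with τ' h
    exact hvA τ' h t ht
  -- As a limit of free segments, `px` is not crossed properly, and a segment along it would have
  -- the generic point `x` on its line.
  have hend : ∀ t ∈ S, ∀ w ∈ t.carrier, w ∈ openSegment ℝ p x → w ∈ t.ends := by
    intro t ht w hwt hw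
    refine (hnc t ht w hwt hw).resolve_right fun ⟨hl, hr⟩ => hg.cross_ends ht ?_
    exact cross_eq_zero_of_line hpx hl hr (by simp)
  have huniq : ∀ w ∈ endpoints S, ∀ w' ∈ endpoints S, cross p x w = 0 → cross p x w' = 0 →
      w = w' := by
    intro w hw w' hw' h1 h2
    by_contra hne
    exact hg w hw w' hw' hne (cross_eq_zero_of_line hpx h1 h2 (by simp))
  obtain ⟨q, hq, t', ht', hts', hqt'⟩ := Set.not_disjoint_iff.1 hb
  have hqo : q ∈ openSegment ℝ p x := by
    rw [← insert_endpoints_openSegment] at hq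
    rcases hq with rfl | rfl | hq
    · exact absurd ⟨t', ht', hts', hqt'⟩ (hS.notMem_others hp)
    · exact absurd hqt' (hg.notMem ht')
    · exact hq
  obtain ⟨q0, q1, q2⟩ := (mem_openSegment_iff hpx).1 hqo
  have hside : 0 < height s σ q := by rwa [hp0] at q1
  have hqE : q ∈ endpoints S := ⟨t', ht', hend t' ht' q hqt' hqo⟩
  have honly : ∀ t ∈ S, ∀ w ∈ t.carrier, w ∈ openSegment ℝ p x → w = q := fun t ht w hwt hw =>
    huniq w ⟨t, ht, hend t ht w hwt hw⟩ q hqE ((mem_openSegment_iff hpx).1 hw).1 q0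
  have hpq : height s σ p < height s σ q := q1
  have hfree : Avoids S (openSegment ℝ p q) := by
    intro t ht
    rw [Set.disjoint_left]
    intro w hw hwt
    have := honly t ht w hwt (openSegment_subset_of_mem hqo hw)
    subst this
    exact lt_irrefl _ ((mem_openSegment_iff hpq).1 hw).2.2
  have hline : ∀ w, cross p q w = 0 ↔ cross p x w = 0 := fun w =>
    ⟨fun h => cross_eq_zero_of_line hpq (by simp) (by rw [cross_swap, q0, neg_zero]) h,
      fun h => cross_eq_zero_of_line hpx (by simp) q0 h⟩
  have hleft : ∀ t ∈ S, q ∈ t.carrier → ∀ e ∈ t.carrier, e ≠ q → 0 < σ * cross p q e := by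
    intro t ht hqt e he hne
    obtain ⟨e', he', hne', -⟩ := Seg.exists_other_end (hend t ht q hqt hqo)
    have h1 : cross p q e ≠ 0 := fun h1 => by
      have h2 := Seg.cross_eq_zero_of_two hqt he hne.symm (by simp) h1 (t.ends_subset he')
      exact hne' (huniq _ ⟨t, ht, he'⟩ _ hqE ((hline _).1 h2) q0)
    by_contra! hle
    have hneg : 0 < (-σ) * cross p q e := by
      have := lt_of_le_of_ne hle (mul_ne_zero hS.side_ne_zero h1)
      linarith
    have hU : {z | 0 < height s σ z ∧ height s σ z < height s σ x} ∈ 𝓝 q := by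
      have k3 : ∀ᶠ z in 𝓝 q, 0 < height s σ z :=
        eventually_lt_of_continuous (by fun_prop) (by fun_prop) hside
      have k4 : ∀ᶠ z in 𝓝 q, height s σ z < height s σ x :=
        eventually_lt_of_continuous (by fun_prop) (by fun_prop) q2
      exact k3.and k4
    obtain ⟨c, hct, ⟨hc1, hc2⟩, hc3⟩ := exists_near_end hqt he hneg hU
    obtain ⟨b, hb0, hb1, hqb, hcr⟩ := cross_of_mem_openSegment hqo
    have hc4 : σ * cross p x c < 0 := by
      rw [hcr] at hc3
      have : 0 < b * (-σ * cross p x c) := by linarith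
      have := pos_of_mul_pos_right this hb0.le
      linarith
    have hev : ∀ᶠ τ' in 𝓝 τ, σ * cross (s.pt τ') x c < 0 :=
      eventually_lt_of_continuous (by fun_prop) (by fun_prop) hc4
    obtain ⟨τ', h3, h4⟩ := ((hev.filter_mono (nhdsWithin_le_nhds (s := Ioi τ))).and
      (Ioc_mem_nhdsGT hττ)).exists
    -- If a segment at `q` led to the right, a later line of sight to `x` would have `q` on its left
    -- and `c` on its right, and so would be blocked.
    have h5 : 0 < σ * cross (s.pt τ') x q := by
      rw [hqb, cross_pt_of_mem]
      have := h4.1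
      exact mul_pos (mul_pos (by linarith) (by linarith)) hx
    have hp'0 := height_eq_zero (σ := σ) (hp' τ' h4)
    obtain ⟨w, hw, -, hwo⟩ := not_disjoint_of_sides (s := s) (σ := σ) (a := s.pt τ') (b := x)
      t.convex hct hqt (by rwa [hp'0]) (by rwa [hp'0]) hc2 q2 h3 h5
    exact (hvA τ' h4).notMem ht hwo hw
  -- The upper end `y` is the first obstacle beyond `x`. It is not an endpoint, since `q` is the
  -- only endpoint on this line.
  obtain ⟨κ, hκ, t0, ht0, hw⟩ := hS.exists_beyond _ hp _ (hp' τ₁ ⟨hττ, le_rfl⟩) x hx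
    (Or.inr (hvA τ₁ ⟨hττ, le_rfl⟩))
  set w := p + κ • (x - p) with hwdef
  have hwx : w = (1 - κ) • p + κ • x := by rw [hwdef]; module
  have hwh : height s σ w = κ * height s σ x := by
    rw [hwx, height_comb _ _ _ _ (by ring), hp0, mul_zero, zero_add]
  have hwl : cross p x w = 0 := by
    rw [hwx, cross_comb _ _ _ _ (by ring)]
    simp
  have hxw : height s σ x < height s σ w := by
    refine lt_of_le_of_ne (by rw [hwh]; nlinarith) fun h' => ?_
    rw [← eq_of_height_eq hpx (by simp) hwl h'] at hw
    exact hg.notMem ht0 hw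
  obtain ⟨y, ⟨t, ht, hts, hyt⟩, hyx, hy, hd⟩ := exists_first (isClosed_others s hS.finite)
    hg.notMem_others (x := w) ⟨t0, ht0, by
      rintro rfl; exact (hx.trans hxw).ne' (height_eq_zero hw), hw⟩
  obtain ⟨y0, y1, y2⟩ := (mem_segment_iff hxw).1 hy
  have hyl : cross p x y = 0 := cross_eq_zero_of_line hxw
    (cross_eq_zero_of_line hpx (by simp) hwl (by simp)) (by simp) y0
  have hxy : height s σ x < height s σ y := lt_of_le_of_ne y1 fun h' =>
    hyx (eq_of_height_eq hpx hyl (by simp) h'.symm)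
  have hqy : q ∈ openSegment ℝ p y :=
    mem_openSegment_of_height_lt hp hside ((hline y).2 hyl) (q2.trans hxy)
  have hqx : x ∈ openSegment ℝ q y := (mem_openSegment_iff (q2.trans hxy)).2
    ⟨cross_eq_zero_of_line hpx q0 hyl (by simp), q2, hxy⟩
  have hAy : Avoids S (openSegment ℝ q y) := by
    refine avoids_of_disjoint_others (s := s) (σ := σ) (fun z hz =>
      height_pos_of_mem_openSegment hside.le (hx.trans hxy) hz) ?_
    rw [Set.disjoint_left]
    rintro z hz ⟨t'', ht'', hts'', hzt⟩
    obtain ⟨z0, z1, z2⟩ := (mem_openSegment_iff (q2.trans hxy)).1 hz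
    have hzl : cross p x z = 0 := cross_eq_zero_of_line (q2.trans hxy)
      (cross_eq_zero_of_line hpx q0 hyl (by simp)) (cross_eq_zero_of_line hpx q0 hyl (by simp)) z0
    rcases lt_trichotomy (height s σ z) (height s σ x) with h' | h' | h'
    · have := honly t'' ht'' z hzt ((mem_openSegment_iff hpx).2 ⟨hzl, by linarith, h'⟩)
      subst this
      exact lt_irrefl _ z1
    · rw [eq_of_height_eq hpx hzl (by simp) h'] at hzt
      exact hg.notMem ht'' hzt
    · exact Set.disjoint_left.1 hd ((mem_openSegment_iff hxy).2
        ⟨cross_eq_zero_of_line hpx (by simp) hyl hzl, h', z2⟩) ⟨t'', ht'', hts'', hzt⟩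
  refine ⟨q, t, y, ⟨hqE, hside, hfree, hleft, ht, y, hyt, hqy, hAy⟩, hyt, hqy, hAy, ?_, hqx⟩
  intro hye
  have := huniq y hye q hqE hyl q0
  subst this
  exact lt_irrefl _ (q2.trans hxy)

/-- Generic points of the region are covered. -/
theorem exists_triangle (hS : Scene S s σ) (hg : Generic S x) (hx : x ∈ openRegion S s σ) :
    ∃ T ∈ sideCover S s σ, x ∈ T := by
  obtain ⟨hx, p, hp, hsee⟩ := hx
  have hdisj : ∀ p ∈ s.carrier, Sees S p x → Disjoint (segment ℝ p x) (others S s) := by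
    intro p hp hsee
    rw [← insert_endpoints_openSegment, Set.disjoint_left]
    rintro w (rfl | rfl | hw) hwo
    · exact hS.notMem_others hp hwo
    · exact hg.notMem_others hwo
    · exact Set.disjoint_left.1 ((sees_iff_of_pos hp hx).1 hsee).disjoint_others hw hwo
  by_cases h0 : Disjoint (segment ℝ s.left x) (others S s)
  · obtain ⟨T, hT, hxT⟩ := exists_initial hS hg hx (sees_of_disjoint s.left_mem hx h0)
    exact ⟨T, Or.inl hT, hxT⟩
  obtain ⟨τ₁, hτ₁, rfl⟩ := Seg.exists_pt_eq hp
  have hcl : IsClosed {τ | ¬ Disjoint (segment ℝ (s.pt τ) x) (others S s)} :=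
    (isClosed_segment_meets (isClosed_others s hS.finite)).preimage
      (f := fun τ : ℝ => (s.pt τ, x)) (by fun_prop)
  have hK : IsCompact (Icc 0 τ₁ ∩ {τ | ¬ Disjoint (segment ℝ (s.pt τ) x) (others S s)}) :=
    isCompact_Icc.inter_right hcl
  obtain ⟨τ, ⟨hτ, hτb⟩, hmax⟩ := hK.exists_isGreatest ⟨0, left_mem_Icc.2 hτ₁.1, by simpa using h0⟩
  have hττ : τ < τ₁ := lt_of_le_of_ne hτ.2 fun h => hτb (h ▸ hdisj _ hp hsee)
  have hv : ∀ τ' ∈ Ioc τ τ₁, Disjoint (segment ℝ (s.pt τ') x) (others S s) := by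
    intro τ' h
    by_contra hcon
    exact absurd (hmax ⟨⟨hτ.1.trans h.1.le, h.2⟩, hcon⟩) (not_le.2 h.1)
  obtain ⟨q, t, y, hact, hyt, hqy, hA, hye, hxo⟩ := exists_act hS hg hx hτ.1 hττ hτ₁.2 hτb hv
  have hps : s.pt τ ∈ s.carrier := s.pt_mem ⟨hτ.1, hτ.2.trans hτ₁.2⟩
  -- `τ` may itself be an event, so activity is taken slightly to the right of `τ`, before the next
  -- event `d`. Then `a ≤ c ≤ τ < d ≤ b`.
  obtain ⟨c, d, hcd, hcτ, hτd⟩ := exists_nextEvent_of_lt hS hτ.1 (hττ.trans_le hτ₁.2)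
  have hev := ((s.continuous_pt.tendsto τ).eventually
    (hact.eventually hS hps hyt hqy hA hye)).filter_mono (nhdsWithin_le_nhds (s := Ioi τ))
  obtain ⟨τ', h1, h2⟩ := (hev.and (Ioo_mem_nhdsGT hτd)).exists
  have hd1 : d ≤ 1 := hcd.2.1.1.2
  have hc0 : 0 ≤ c := hcd.1.1.1
  have hact' := h1 (s.pt_mem ⟨hτ.1.trans h2.1.le, h2.2.le.trans hd1⟩)
  have hafter := activeAfter_of_act hS hc0 hd1 (fun x hx => hcd.not_hits hx)
    ⟨hcτ.trans_lt h2.1, h2.2⟩ hact'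
  obtain ⟨a, ha⟩ := exists_onList hS hcd.1 (hcd.2.2.1.trans_le hd1) hafter
  obtain ⟨τ'', b, hcτ'', hl, hnext, hhit⟩ := exists_leave hS hcd.1 (hcd.2.2.1.trans_le hd1) ha
  have hL : Listed S s σ q t a b := ⟨τ'', hl, hnext, hhit⟩
  have hdb : d ≤ b := by
    by_contra! hcon
    exact hcd.2.2.2 b ⟨hcτ''.trans_lt hnext.2.2.1, hcon⟩ hnext.2.1
  have hτab : τ ∈ Icc a b := ⟨ha.invariant.le.trans hcτ, hτd.le.trans hdb⟩
  obtain ⟨y₁, hy₁, hq₁⟩ := hL.exists_upper hS (left_mem_Icc.2 hL.lt.le)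
  obtain ⟨y₂, hy₂, hq₂⟩ := hL.exists_upper hS (right_mem_Icc.2 hL.lt.le)
  refine ⟨convexHull ℝ {q, y₁, y₂}, Or.inr ?_, ?_⟩
  · rw [sweptTriangles_eq]
    exact ⟨q, t, a, b, y₁, y₂, hL, hy₁, hq₁, hy₂, hq₂, rfl⟩
  · obtain ⟨z, hz, hqz⟩ := exists_upper_between hq₁ hq₂ hL.lt hτab
    have hzt := t.convex.segment_subset hy₁ hy₂ hz
    obtain rfl := hL.upper_unique hS hzt hqz hyt hqy hτab
    have hc := convex_convexHull ℝ ({q, y₁, y₂} : Set Plane)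
    have hm : ∀ w ∈ ({q, y₁, y₂} : Set Plane), w ∈ convexHull ℝ ({q, y₁, y₂} : Set Plane) :=
      fun w hw => subset_convexHull ℝ _ hw
    exact hc.openSegment_subset (hm _ (by simp))
      (hc.segment_subset (hm _ (by simp)) (hm _ (by simp)) hz) hxo

end


/-! ### Counting the triangles -/

section

variable {S : Set Seg} {s : Seg} {σ : ℝ}

theorem incidentEdges_finite (h : S.Finite) (s : Seg) : (incidentEdges S s).Finite := by
  have hV := vspVertices_finite h
  refine ((hV.prod hV).image fun e => openSegment ℝ e.1 e.2).subset ?_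
  rintro E ⟨a, b, h1, -, rfl, -⟩
  exact ⟨(a, b), ⟨h1.2.1, h1.2.2.1⟩, rfl⟩

theorem VGEdge.symm {u v : Plane} (h : VGEdge S u v) : VGEdge S v u := by
  obtain ⟨h1, h2, h3, h4⟩ := h
  exact ⟨h1.symm, h3, h2, by rwa [openSegment_symm, segment_symm]⟩

theorem EVGEdge.symm {a b : Plane} (h : EVGEdge S a b) : EVGEdge S b a := by
  rcases h with h | h | h
  · exact Or.inl h.symm
  · exact Or.inr (Or.inr h)
  · exact Or.inr (Or.inl h)

/-- Every edge of the extended visibility graph starts with an edge of the partition. -/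
theorem exists_vspEdge (hS : S.Finite) {p r : Plane} (h : EVGEdge S p r) (hpr : p ≠ r) :
    ∃ b, IsVSPEdge S p b ∧ ∃ κ : ℝ, 0 < κ ∧ b = p + κ • (r - p) := by
  obtain ⟨b, ⟨hb, hbp⟩, -, hbs, hd⟩ := exists_first (A := vspVertices S \ {p})
    ((vspVertices_finite hS).subset sdiff_subset).isClosed (p := p) (x := r) (by simp)
    ⟨Or.inl ⟨p, h.symm⟩, hpr.symm⟩
  have hpb : p ≠ b := fun h => hbp h.symm
  refine ⟨b, ⟨hpb, Or.inl ⟨r, h⟩, hb, ?_, ?_⟩, ?_⟩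
  · intro z hz
    exact Or.inl ⟨p, r, h, (convex_segment p r).openSegment_subset (left_mem_segment ..) hbs hz⟩
  · rw [Set.disjoint_left]
    intro z hz hzv
    refine Set.disjoint_left.1 hd hz ⟨hzv, ?_⟩
    rintro rfl
    exact hpb (left_mem_openSegment_iff.1 hz)
  · obtain ⟨c, d, hc, hd0, hcd, rfl⟩ := hbs
    obtain rfl : c = 1 - d := by linarith
    refine ⟨d, lt_of_le_of_ne hd0 ?_, by module⟩
    rintro rfl
    simp at hpb

theorem eq_of_openSegment_eq {p b b' : Plane} (h : openSegment ℝ p b = openSegment ℝ p b') :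
    b = b' := by
  have hs : segment ℝ p b = segment ℝ p b' := by
    rw [← closure_openSegment, ← closure_openSegment, h]
  obtain ⟨u, v, hu, hv, huv, h1⟩ := hs ▸ right_mem_segment ℝ p b
  obtain ⟨u', v', hu', hv', huv', h2⟩ := hs.symm ▸ right_mem_segment ℝ p b'
  obtain rfl : u = 1 - v := by linarith
  obtain rfl : u' = 1 - v' := by linarith
  have h3 : (1 - v * v') • (b - p) = 0 := by
    rw [← h2] at h1
    linear_combination (norm := module) -h1
  rcases smul_eq_zero.1 h3 with h4 | h4
  -- Both factors are at most one and their product is one.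
  · have : v = 1 := by nlinarith
    rw [← h1, this]
    simp
  · obtain rfl := sub_eq_zero.1 h4
    rw [← h2]
    module

/-- An open segment going up from `s` determines its lower end. -/
theorem eq_of_openSegment_eq' {p p' b b' : Plane} (hp : height s σ p = 0) (hp' : height s σ p' = 0)
    (hb : 0 < height s σ b) (h : openSegment ℝ p b = openSegment ℝ p' b') : p = p' := by
  have hs : segment ℝ p b = segment ℝ p' b' := by
    rw [← closure_openSegment, ← closure_openSegment, h]
  obtain ⟨h1, -⟩ := (mem_segment_iff (by rwa [hp])).1 (hs.symm ▸ left_mem_segment ℝ p' b')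
  exact (eq_of_height_eq (s := s) (σ := σ) (a := p) (b := b) (by rwa [hp]) h1 (by simp)
    (by rw [hp, hp'])).symm

theorem NextEvent.unique {a a' b : ℝ} (h : NextEvent S s a b) (h' : NextEvent S s a' b) :
    a = a' := by
  rcases lt_trichotomy a a' with hlt | rfl | hlt
  · exact absurd h'.1 (h.2.2.2 a' ⟨hlt, h'.2.2.1⟩)
  · rfl
  · exact absurd h.1 (h'.2.2.2 a ⟨hlt, h.2.2.1⟩)

theorem Listed.unique {q : Plane} {t : Seg} {a a' b : ℝ} (h : Listed S s σ q t a b)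
    (h' : Listed S s σ q t a' b) : a = a' := by
  obtain ⟨τ, h1, h2, -⟩ := h
  obtain ⟨τ', h1', h2', -⟩ := h'
  obtain rfl := h2.unique h2'
  exact h1.unique h1'

/-- The upper end of an active edge is unique. -/
theorem Act.upper_eq {p q : Plane} {t t' : Seg} (hp : p ∈ s.carrier) (h : Act S s σ p q t)
    (h' : Act S s σ p q t') : ∃ y ∈ t.carrier, y ∈ t'.carrier ∧ q ∈ openSegment ℝ p y := by
  obtain ⟨y, hy, hqy, hA⟩ := h.hit
  obtain ⟨y', hy', hqy', hA'⟩ := h'.hit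
  have hpq := h.line hp
  obtain ⟨h1, h2⟩ := height_lt_of_mem_openSegment hp h.side hqy
  obtain ⟨h1', h2'⟩ := height_lt_of_mem_openSegment hp h.side hqy'
  have hl : ∀ {y z}, cross p q y = 0 → cross p q z = 0 → cross q y z = 0 := fun hy hz =>
    cross_eq_zero_of_line hpq (by simp) hy hz
  rcases lt_trichotomy (height s σ y) (height s σ y') with hlt | heq | hlt
  · exact absurd hy (hA'.notMem h.mem ((mem_openSegment_iff h1').2 ⟨hl h2' h2, h1, hlt⟩))
  · obtain rfl := eq_of_height_eq hpq h2 h2' heq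
    exact ⟨y, hy, hy', hqy⟩
  · exact absurd hy' (hA.notMem h'.mem ((mem_openSegment_iff h1).2 ⟨hl h2 h2', h1', hlt⟩))

/-- Two edges with the same lower endpoint that leave the list at the same event have their upper
endpoint on the same segment. -/
theorem Listed.segment_unique (hS : Scene S s σ) {q : Plane} {t t' : Seg} {a a' b : ℝ}
    (h : Listed S s σ q t a b) (h' : Listed S s σ q t' a' b) : t = t' := by
  have hlt := h.lt
  have hlt' := h'.lt
  have hm : max a a' < b := max_lt hlt hlt'
  obtain ⟨c, hc1, hc2⟩ := exists_between hm
  obtain ⟨d, hd1, hd2⟩ := exists_between hc2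
  have key : ∀ τ, max a a' < τ → τ < b → ∃ y ∈ t.carrier, y ∈ t'.carrier ∧
      q ∈ openSegment ℝ (s.pt τ) y := by
    intro τ h1 h2
    rw [max_lt_iff] at h1
    exact Act.upper_eq (s.pt_mem ⟨h.nonneg.trans h1.1.le, h2.le.trans h.le_one⟩)
      (h.act hS ⟨h1.1, h2⟩) (h'.act hS ⟨h1.2, h2⟩)
  obtain ⟨y, hy, hy', hqy⟩ := key c hc1 hc2
  obtain ⟨z, hz, hz', hqz⟩ := key d (hc1.trans hd1) hd2
  have hne : y ≠ z := by
    rintro rfl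
    obtain ⟨β, hβ, hyβ⟩ := exists_eq_of_mem_openSegment hqz
    have h5 := cross_pt s σ d c q y β hyβ
    rw [max_lt_iff] at hc1
    rw [(height_lt_of_mem_openSegment (s.pt_mem ⟨h.nonneg.trans hc1.1.le, hc2.le.trans h.le_one⟩)
      (h.side hS) hqy).2, mul_zero, eq_comm, neg_eq_zero] at h5
    exact mul_ne_zero (mul_ne_zero hβ.ne' (sub_ne_zero.2 hd1.ne)) (h.side hS).ne' h5
  obtain ⟨p, -, hp⟩ := (h.frequently hS (left_mem_Icc.2 h.lt.le)).exists
  obtain ⟨p', -, hp'⟩ := (h'.frequently hS (left_mem_Icc.2 h'.lt.le)).exists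
  by_contra hcon
  have hmid : midpoint ℝ y z ∈ openSegment ℝ y z :=
    ⟨1 / 2, 1 / 2, by norm_num, by norm_num, by norm_num, by
      rw [midpoint_eq_smul_add, smul_add]; norm_num⟩
  exact Set.disjoint_left.1 (hS.inner_disjoint hp.mem hp'.mem hcon)
    (Seg.openSegment_subset_inner hy hz hne hmid) (Seg.openSegment_subset_inner hy' hz' hne hmid)

/-- Without degenerate alignments, two active edges that are hit from the same point in the same
direction have the same lower endpoint. -/
theorem Listed.not_lt (hS : Scene S s σ) (hn : NoAlignment S s) {q q' : Plane} {t t' : Seg}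
    {a a' b : ℝ} (h : Listed S s σ q t a b) (h' : Listed S s σ q' t' a' b)
    (h0 : cross (s.pt b) q' q = 0) : ¬ height s σ q < height s σ q' := by
  intro hqq
  have hlt := h.lt
  have hlt' := h'.lt
  have hm : max a a' < b := max_lt hlt hlt'
  have hside := h.side hS
  have hside' := h'.side hS
  have hb : s.pt b ∈ s.carrier := s.pt_mem ⟨h.nonneg.trans hlt.le, h.le_one⟩
  have hb0 : height s σ (s.pt b) = 0 := by simp
  obtain ⟨c, hc0, hc1, hqc⟩ : ∃ c : ℝ, 0 < c ∧ c < 1 ∧ q = (1 - c) • s.pt b + c • q' := by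
    have := eq_of_cross_eq_zero (s := s) (σ := σ) (a := s.pt b) (b := q') (by rwa [hb0]) h0
    rw [hb0, sub_zero, sub_zero] at this
    exact ⟨_, by positivity, by rwa [div_lt_one hside'], this⟩
  have hmem : ∀ τ ∈ Ioo (max a a') b, s.pt τ ∈ s.carrier ∧ Act S s σ (s.pt τ) q t ∧
      Act S s σ (s.pt τ) q' t' := by
    rintro τ ⟨h1, h2⟩
    rw [max_lt_iff] at h1
    exact ⟨s.pt_mem ⟨h.nonneg.trans h1.1.le, h2.le.trans h.le_one⟩, h.act hS ⟨h1.1, h2⟩,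
      h'.act hS ⟨h1.2, h2⟩⟩
  -- Before `b`, the lower point `q` is strictly to the right of the line of sight to `q'`.
  have hneg : ∀ τ < b, σ * cross (s.pt τ) q' q < 0 := by
    intro τ hτ
    rw [hqc, cross_pt_of_mem]
    have := mul_pos (mul_pos (sub_pos.2 hc1) (sub_pos.2 hτ)) hside'
    linarith
  obtain ⟨τ₀, hτ₀⟩ := exists_between hm
  obtain ⟨hp₀, hact₀, hact₀'⟩ := hmem τ₀ hτ₀
  obtain ⟨t'', ht'', hqe⟩ := hact₀.mem_endpoints
  obtain ⟨e, he, hne, hseg⟩ := Seg.exists_other_end hqe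
  have hqt := t''.ends_subset hqe
  have het := t''.ends_subset he
  have hle : 0 ≤ σ * cross (s.pt b) q e := by
    have hcont : Continuous fun τ : ℝ => σ * cross (s.pt τ) q e := by fun_prop
    refine ge_of_tendsto ((hcont.tendsto b).mono_left (nhdsWithin_le_nhds (s := Iio b))) ?_
    filter_upwards [Ioo_mem_nhdsLT hm] with τ hτ
    exact ((hmem τ hτ).2.1.left t'' ht'' hqt e het hne).le
  rcases hle.eq_or_lt with heq | hpos
  -- The segment at `q` is aligned with `s.pt b`, so its line contains `q'`. By `NoAlignment`, `q'`
  -- is an end of it, and then `q` must be to the left of the line of sight to `q'`, against `hneg`.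
  · have hcol := (mul_eq_zero.1 heq.symm).resolve_left hS.side_ne_zero
    have hbq : height s σ (s.pt b) < height s σ q := by rwa [hb0]
    have hl : ∀ w, cross q e w = 0 → cross t''.left t''.right w = 0 := by
      intro w hw
      rcases hqe with rfl | rfl <;> rcases he with rfl | rfl
      · exact absurd rfl hne
      · exact hw
      · simp only [cross] at hw ⊢
        linear_combination -hw
      · exact absurd rfl hne
    have hts : t'' ≠ s := by
      rintro rfl
      exact hside.ne' (height_eq_zero hqt)
    have hq'l : cross (s.pt b) q q' = 0 := by rw [cross_swap, h0, neg_zero]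
    obtain ⟨u, hu, hqu⟩ := hact₀'.mem_endpoints
    have hus : u ≠ s := by
      rintro rfl
      exact hside'.ne' (height_eq_zero (u.ends_subset hqu))
    have hq't := hn t'' ht'' hts ⟨s.pt b, hb, hl _ (cross_eq_zero_of_line hbq (by simp) hcol (by simp))⟩
      u hu hus q' hqu (hl _ (cross_eq_zero_of_line hbq (by simp) hcol hq'l))
    have h5 := hact₀'.left t'' ht'' (t''.ends_subset hq't) q hqt
      (by rintro rfl; exact lt_irrefl _ hqq)
    linarith [hneg τ₀ hτ₀.2]
  -- The segment at `q` leads strictly to the left even at `b`. Shortly before `b` it crosses the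
  -- line of sight to `q'`, from `q` on the right to a nearby `d` on the left.
  · have hU : {z | 0 < height s σ z ∧ height s σ z < height s σ q'} ∈ 𝓝 q := by
      have k3 : ∀ᶠ z in 𝓝 q, 0 < height s σ z :=
        eventually_lt_of_continuous (by fun_prop) (by fun_prop) hside
      have k4 : ∀ᶠ z in 𝓝 q, height s σ z < height s σ q' :=
        eventually_lt_of_continuous (by fun_prop) (by fun_prop) hqq
      exact k3.and k4
    obtain ⟨d, hdt, ⟨hd1, hd2⟩, hd3⟩ := exists_near_end hqt het hpos hU
    obtain ⟨β, hβ0, hβ1, hqβ, hcr⟩ := cross_of_mem_openSegment (p := s.pt b) (q := q) (z := q')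
      ⟨1 - c, c, by linarith, hc0, by ring, hqc.symm⟩
    have hd4 : 0 < σ * cross (s.pt b) q' d := by
      rw [hcr] at hd3
      have : 0 < β * (σ * cross (s.pt b) q' d) := by linarith
      exact pos_of_mul_pos_right this hβ0.le
    have hev : ∀ᶠ τ in 𝓝 b, 0 < σ * cross (s.pt τ) q' d :=
      eventually_lt_of_continuous (by fun_prop) (by fun_prop) hd4
    obtain ⟨τ, h3, h4⟩ := ((hev.filter_mono (nhdsWithin_le_nhds (s := Iio b))).and
      (Ioo_mem_nhdsLT hm)).exists
    obtain ⟨hp, hact, hact'⟩ := hmem τ h4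
    have hp0 : height s σ (s.pt τ) = 0 := by simp
    obtain ⟨w, hw, -, hwo⟩ := not_disjoint_of_sides (s := s) (σ := σ) (a := s.pt τ) (b := q')
      t''.convex hqt hdt (by rwa [hp0]) (by rwa [hp0]) hqq hd2 (hneg τ h4.2) h3
    exact hact'.free.notMem ht'' hwo hw

theorem Listed.endpoint_unique (hS : Scene S s σ) (hn : NoAlignment S s) {q q' : Plane}
    {t t' : Seg} {a a' b : ℝ} (h : Listed S s σ q t a b) (h' : Listed S s σ q' t' a' b)
    (h0 : cross (s.pt b) q q' = 0) : q = q' := by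
  have hb0 : height s σ (s.pt b) = 0 := by simp
  rcases lt_trichotomy (height s σ q) (height s σ q') with hlt | heq | hlt
  · exact absurd hlt (h.not_lt hS hn h' (by rw [cross_swap, h0, neg_zero]))
  · exact eq_of_height_eq (s := s) (σ := σ) (a := s.pt b) (b := q)
      (by rw [hb0]; exact h.side hS) (by simp) h0 heq
  · exact absurd hlt (h'.not_lt hS hn h h0)

/-! ### Charging triangles to edges of the partition -/

/-- The initial triangle `T` has the edge `E` of the partition on its left side. -/
def ChargeInitial (S : Set Seg) (s : Seg) (σ : ℝ) (T E : Set Plane) : Prop :=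
  ∃ t ∈ S, ∃ x y, IsVisibleEdge S s σ t x y ∧ σ * cross s.left x y < 0 ∧
    T = convexHull ℝ {s.left, x, y} ∧ ∃ κ : ℝ, 0 < κ ∧ E = openSegment ℝ s.left (s.left + κ • (x - s.left))

/-- The swept triangle `T` is closed at the edge `E` of the partition. -/
def ChargeSwept (S : Set Seg) (s : Seg) (σ : ℝ) (T E : Set Plane) : Prop :=
  ∃ q t a b y₁ y₂, Listed S s σ q t a b ∧ y₁ ∈ t.carrier ∧ q ∈ openSegment ℝ (s.pt a) y₁ ∧
    y₂ ∈ t.carrier ∧ q ∈ openSegment ℝ (s.pt b) y₂ ∧ T = convexHull ℝ {q, y₁, y₂} ∧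
    ∃ z, E = openSegment ℝ (s.pt b) z ∧ 0 < height s σ z ∧ cross (s.pt b) q z = 0

theorem incident_of_height_pos {p b : Plane} (hp : p ∈ s.carrier) (hE : IsVSPEdge S p b)
    (hb : 0 < height s σ b) : openSegment ℝ p b ∈ incidentEdges S s := by
  refine ⟨p, b, hE, hp, rfl, fun hsub => ?_⟩
  have hm : (2⁻¹ : ℝ) • p + (2⁻¹ : ℝ) • b ∈ openSegment ℝ p b :=
    ⟨_, _, by norm_num, by norm_num, by norm_num, rfl⟩
  exact (height_pos_of_mem_openSegment (height_eq_zero hp).ge hb hm).ne' (height_eq_zero (hsub hm))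

theorem exists_chargeInitial (hS : Scene S s σ) {T : Set Plane} (hT : T ∈ initialTriangles S s σ) :
    ∃ E ∈ incidentEdges S s, ChargeInitial S s σ T E := by
  obtain ⟨t, ht, x, y, h, hl, rfl⟩ := exists_left_right hS hT
  obtain ⟨κ, hκ, hE, hx⟩ := h.exists_evgEdge hS ht hl
  have hxl : s.left ≠ x := by
    rintro rfl
    simp at hl
  have hne : s.left ≠ s.left + κ • (x - s.left) := by
    intro h
    have := smul_eq_zero.1 (left_eq_add.1 h)
    rcases this with h | h
    · exact hκ.ne' h
    · exact hxl (sub_eq_zero.1 h).symm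
  obtain ⟨b, hb, κ', hκ', rfl⟩ := exists_vspEdge hS.finite hE hne
  rw [add_sub_cancel_left, smul_smul] at hb
  refine ⟨_, ?_, t, ht, x, y, h, hl, rfl, κ' * κ, by positivity, rfl⟩
  have h0 := hS.left_height
  have hx0 : 0 ≤ height s σ x := (h.segment_subset (left_mem_segment ..)).2
  have hc : s.left + (κ' * κ) • (x - s.left) = (1 - κ' * κ) • s.left + (κ' * κ) • x := by module
  rcases hx0.eq_or_lt with hx0 | hx0
  -- The charged edge runs along the supporting line of `s`, but outwards from its left endpoint, so
  -- it is not contained in `s`.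
  · obtain ⟨c, hc, hxc⟩ := hx hx0.symm
    refine ⟨_, _, hb, s.left_mem, rfl, fun hsub => ?_⟩
    have hm : (2⁻¹ : ℝ) • s.left + (2⁻¹ : ℝ) • (s.left + (κ' * κ) • (x - s.left)) ∈
        openSegment ℝ s.left (s.left + (κ' * κ) • (x - s.left)) :=
      ⟨_, _, by norm_num, by norm_num, by norm_num, rfl⟩
    obtain ⟨τ, hτ, hτz⟩ := Seg.exists_pt_eq (hsub hm)
    have h1 := congrArg Prod.fst hτz
    rw [hxc, Seg.pt_eq] at h1
    simp only [Prod.fst_add, Prod.smul_fst, smul_eq_mul, Prod.fst_sub, add_sub_cancel_left] at h1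
    have h2 : (τ - 2⁻¹ * (κ' * κ * c)) * (s.right.1 - s.left.1) = 0 := by linear_combination h1
    have h3 := (mul_eq_zero.1 h2).resolve_right (sub_pos.2 s.left_lt_right).ne'
    have h4 : κ' * κ * c < 0 := mul_neg_of_pos_of_neg (by positivity) hc
    linarith [hτ.1]
  · refine incident_of_height_pos (σ := σ) s.left_mem hb ?_
    rw [hc, height_comb _ _ _ _ (by ring), h0, mul_zero, zero_add]
    positivity

theorem exists_chargeSwept (hS : Scene S s σ) {T : Set Plane} (hT : T ∈ sweptTriangles S s σ) :
    ∃ E ∈ incidentEdges S s, ChargeSwept S s σ T E := by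
  rw [sweptTriangles_eq] at hT
  obtain ⟨q, t, a, b, y₁, y₂, h, hy₁, hq₁, hy₂, hq₂, rfl⟩ := hT
  have hb01 : b ∈ Icc (0 : ℝ) 1 := ⟨h.nonneg.trans h.lt.le, h.le_one⟩
  have hb := s.pt_mem hb01
  have hb0 : height s σ (s.pt b) = 0 := by simp
  obtain ⟨x, hE, hx, hqx⟩ := (hits_iff hb01 (h.side hS)).1 (h.hits hS)
  obtain ⟨z, hz, κ, hκ, rfl⟩ := exists_vspEdge hS.finite hE (by rintro rfl; exact hx.ne' hb0)
  have hc : s.pt b + κ • (x - s.pt b) = (1 - κ) • s.pt b + κ • x := by module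
  have hz0 : 0 < height s σ (s.pt b + κ • (x - s.pt b)) := by
    rw [hc, height_comb _ _ _ _ (by ring), hb0, mul_zero, zero_add]
    positivity
  refine ⟨_, incident_of_height_pos hb hz hz0, q, t, a, b, y₁, y₂, h, hy₁, hq₁, hy₂, hq₂, rfl, _,
    rfl, hz0, ?_⟩
  rw [hc, cross_comb _ _ _ _ (by ring), hqx]
  simp

theorem ChargeInitial.unique (hS : Scene S s σ) {T T' E : Set Plane}
    (h : ChargeInitial S s σ T E) (h' : ChargeInitial S s σ T' E) : T = T' := by
  obtain ⟨t, ht, x, y, hv, hl, rfl, κ, hκ, rfl⟩ := h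
  obtain ⟨t', ht', x', y', hv', hl', rfl, κ', hκ', hE⟩ := h'
  have h1 := add_left_cancel (eq_of_openSegment_eq hE)
  refine hv.convexHull_eq hS ht ht' hv' hl hl' (κ := κ / κ') (by positivity) ?_
  rw [div_eq_inv_mul, ← smul_smul, h1, smul_smul, inv_mul_cancel₀ hκ'.ne', one_smul,
    add_sub_cancel]

/-- Swept triangles are charged at viewpoints with `b > 0`, initial ones at the left endpoint. -/
theorem ChargeSwept.ne_initial (hS : Scene S s σ) {T T' E : Set Plane}
    (h : ChargeSwept S s σ T E) (h' : ChargeInitial S s σ T' E) : False := by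
  obtain ⟨q, t, a, b, y₁, y₂, h, -, -, -, -, -, z, rfl, hz, -⟩ := h
  obtain ⟨t', ht', x', y', hv', hl', rfl, κ', hκ', hE⟩ := h'
  have h1 := eq_of_openSegment_eq' (s := s) (σ := σ) (by simp) hS.left_height hz hE
  rw [← s.pt_zero] at h1
  exact (h.nonneg.trans_lt h.lt).ne' (s.pt_injective h1)

/-- The edge determines `b` and a direction, these determine `q` by `NoAlignment`, then `t` by two
common upper ends, `a` by the history of the list, and finally the corners. -/
theorem ChargeSwept.unique (hS : Scene S s σ) (hn : NoAlignment S s) {T T' E : Set Plane}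
    (h : ChargeSwept S s σ T E) (h' : ChargeSwept S s σ T' E) : T = T' := by
  obtain ⟨q, t, a, b, y₁, y₂, h, hy₁, hq₁, hy₂, hq₂, rfl, z, rfl, hz, hqz⟩ := h
  obtain ⟨q', t', a', b', y₁', y₂', h', hy₁', hq₁', hy₂', hq₂', rfl, z', hE, hz', hqz'⟩ := h'
  have h1 := eq_of_openSegment_eq' (s := s) (σ := σ) (by simp) (by simp) hz hE
  obtain rfl := s.pt_injective h1
  obtain rfl := eq_of_openSegment_eq hE
  have hb0 : height s σ (s.pt b) = 0 := by simp
  have h2 : cross (s.pt b) q q' = 0 := by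
    refine cross_eq_zero_of_line (s := s) (σ := σ) (a := s.pt b) (b := z) (by rwa [hb0]) (by simp)
      ?_ ?_
    · rw [cross_swap, hqz, neg_zero]
    · rw [cross_swap, hqz', neg_zero]
  obtain rfl := h.endpoint_unique hS hn h' h2
  obtain rfl := h.segment_unique hS h'
  obtain rfl := h.unique h'
  rw [h.upper_unique hS hy₁ hq₁ hy₁' hq₁' (left_mem_Icc.2 h.lt.le),
    h.upper_unique hS hy₂ hq₂ hy₂' hq₂' (right_mem_Icc.2 h.lt.le)]

/-- On initial triangles the charging is injective even with degenerate alignments, so it yields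
finiteness. -/
theorem initialTriangles_finite (hS : Scene S s σ) : (initialTriangles S s σ).Finite := by
  choose! f hf using fun T (hT : T ∈ initialTriangles S s σ) => exists_chargeInitial hS hT
  refine Set.Finite.of_finite_image ((incidentEdges_finite hS.finite s).subset
    (image_subset_iff.2 fun T hT => (hf T hT).1)) (f := f) ?_
  intro T hT T' hT' h
  exact ChargeInitial.unique hS (hf T hT).2 (h ▸ (hf T' hT').2)

theorem sideCover_finite (hS : Scene S s σ) : (sideCover S s σ).Finite :=
  (initialTriangles_finite hS).union (sweptTriangles_finite hS)

/-- There are at most as many triangles as edges of the partition that are incident on `s`. -/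
theorem ncard_sideCover_le (hS : Scene S s σ) (hn : NoAlignment S s) :
    (sideCover S s σ).ncard ≤ (incidentEdges S s).ncard := by
  have hex : ∀ T ∈ sideCover S s σ, ∃ E ∈ incidentEdges S s,
      ChargeInitial S s σ T E ∨ ChargeSwept S s σ T E := by
    rintro T (hT | hT)
    · obtain ⟨E, hE, h⟩ := exists_chargeInitial hS hT
      exact ⟨E, hE, Or.inl h⟩
    · obtain ⟨E, hE, h⟩ := exists_chargeSwept hS hT
      exact ⟨E, hE, Or.inr h⟩
  choose! f hf using hex
  refine Set.ncard_le_ncard_of_injOn f (fun T hT => (hf T hT).1) ?_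
    (incidentEdges_finite hS.finite s)
  intro T hT T' hT' h
  have h1 := (hf T hT).2
  have h2 := (hf T' hT').2
  rw [← h] at h2
  rcases h1 with h1 | h1 <;> rcases h2 with h2 | h2
  · exact h1.unique hS h2
  · exact (h2.ne_initial hS h1).elim
  · exact (h1.ne_initial hS h2).elim
  · exact h1.unique hS hn h2

/-- The triangles cover the region above `s`. -/
theorem sUnion_sideCover (hS : Scene S s σ) :
    ⋃₀ sideCover S s σ = closure (region S s ∩ {x | 0 ≤ height s σ x}) ∧
    ⋃₀ sideCover S s σ = closure (openRegion S s σ) := by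
  have h1 : ⋃₀ sideCover S s σ ⊆ closure (openRegion S s σ) := by
    refine sUnion_subset ?_
    rintro T (hT | hT)
    · exact initial_subset_closure hS hT
    · exact swept_subset_closure hS hT
  have h2 : openRegion S s σ ⊆ region S s ∩ {x | 0 ≤ height s σ x} := by
    rintro x ⟨hx, p, hp, hpx⟩
    exact ⟨mem_iUnion₂.2 ⟨p, hp, hpx⟩, le_of_lt hx⟩
  have hcl : IsClosed (⋃₀ sideCover S s σ) := by
    rw [sUnion_eq_biUnion]
    refine (sideCover_finite hS).isClosed_biUnion ?_
    rintro T (hT | hT)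
    · exact (initial_isTriangle hS hT).isClosed
    · exact (swept_isTriangle hS hT).isClosed
  have h3 : closure (region S s ∩ {x | 0 ≤ height s σ x}) ⊆ ⋃₀ sideCover S s σ := by
    refine closure_minimal ((region_subset_closure hS).trans (closure_minimal ?_ hcl)) hcl
    rintro x ⟨hg, hx⟩
    obtain ⟨T, hT, hxT⟩ := exists_triangle hS hg hx
    exact mem_sUnion.2 ⟨T, hT, hxT⟩
  exact ⟨Subset.antisymm (h1.trans (closure_mono h2)) h3,
    Subset.antisymm h1 ((closure_mono h2).trans h3)⟩

theorem isTriangle_of_mem (hS : Scene S s σ) {T : Set Plane} (hT : T ∈ sideCover S s σ) :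
    IsTriangle T :=
  hT.elim (initial_isTriangle hS) (swept_isTriangle hS)

theorem interior_subset_of_mem (hS : Scene S s σ) {T : Set Plane} (hT : T ∈ sideCover S s σ) :
    interior T ⊆ openRegion S s σ :=
  hT.elim (initial_interior_subset hS) (swept_interior_subset hS)

end


/-! ### The frame -/

section

variable {S F : Set Seg} {s : Seg}

/-- Every ray from a visible point leads to a segment of the frame. -/
theorem exists_beyond_of_frame (hF : IsBoundingFrame S F) (hs : s ∈ S \ F)
    (hsdisj : ∀ t ∈ S, t ≠ s → Disjoint s.carrier t.carrier) {p p' x : Plane}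
    (hp : p ∈ s.carrier) (hp' : p' ∈ s.carrier) (hxp : x ≠ p) (hsee : Sees S p' x) :
    ∃ κ : ℝ, 1 ≤ κ ∧ ∃ t ∈ S, p + κ • (x - p) ∈ t.carrier := by
  obtain ⟨hFS, o, u, v, hu, hv, huv, hcar, hint⟩ := hF
  set D := u.1 * v.2 - u.2 * v.1 with hDdef
  have hD : D ≠ 0 := by
    have hU : 0 < u.1 ^ 2 + u.2 ^ 2 := by
      by_contra! hcon
      exact hu (Prod.ext (by simpa using (by nlinarith [sq_nonneg u.1, sq_nonneg u.2] : u.1 = 0))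
        (by simpa using (by nlinarith [sq_nonneg u.1, sq_nonneg u.2] : u.2 = 0)))
    have hV : 0 < v.1 ^ 2 + v.2 ^ 2 := by
      by_contra! hcon
      exact hv (Prod.ext (by simpa using (by nlinarith [sq_nonneg v.1, sq_nonneg v.2] : v.1 = 0))
        (by simpa using (by nlinarith [sq_nonneg v.1, sq_nonneg v.2] : v.2 = 0)))
    intro h0
    -- Lagrange's identity: the product of the squared lengths is the squared determinant plus the
    -- squared inner product.
    have : (u.1 ^ 2 + u.2 ^ 2) * (v.1 ^ 2 + v.2 ^ 2) = 0 := by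
      linear_combination D * h0 + (u.1 * v.1 + u.2 * v.2) * huv
    exact (mul_pos hU hV).ne' this
  let f : Plane → ℝ := fun z => ((z.1 - o.1) * v.2 - (z.2 - o.2) * v.1) / D
  let g : Plane → ℝ := fun z => (u.1 * (z.2 - o.2) - u.2 * (z.1 - o.1)) / D
  have hfc : Continuous f := by fun_prop
  have hgc : Continuous g := by fun_prop
  have hfa : ∀ (a b : ℝ) (y z : Plane), a + b = 1 → f (a • y + b • z) = a * f y + b * f z := by
    intro a b y z hab
    obtain rfl : a = 1 - b := by linarith
    simp only [f, Prod.fst_add, Prod.snd_add, Prod.smul_fst, Prod.smul_snd, smul_eq_mul]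
    field_simp
    ring
  have hga : ∀ (a b : ℝ) (y z : Plane), a + b = 1 → g (a • y + b • z) = a * g y + b * g z := by
    intro a b y z hab
    obtain rfl : a = 1 - b := by linarith
    simp only [g, Prod.fst_add, Prod.snd_add, Prod.smul_fst, Prod.smul_snd, smul_eq_mul]
    field_simp
    ring
  have hfg : ∀ a b : ℝ, f (o + a • u + b • v) = a ∧ g (o + a • u + b • v) = b := by
    intro a b
    constructor
    · simp only [f, Prod.fst_add, Prod.snd_add, Prod.smul_fst, Prod.smul_snd, smul_eq_mul]
      field_simp
      rw [hDdef]
      ring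
    · simp only [g, Prod.fst_add, Prod.snd_add, Prod.smul_fst, Prod.smul_snd, smul_eq_mul]
      field_simp
      rw [hDdef]
      ring
  have hrep : ∀ z, z = o + f z • u + g z • v := by
    intro z
    ext
    · simp only [f, g, Prod.fst_add, Prod.smul_fst, smul_eq_mul]
      field_simp
      rw [hDdef]
      ring
    · simp only [f, g, Prod.snd_add, Prod.smul_snd, smul_eq_mul]
      field_simp
      rw [hDdef]
      ring
  -- In the affine coordinates `f`, `g` the rectangle is the unit square, and its sides form the
  -- level set `m = 1`.
  let m : Plane → ℝ := fun z => max |2 * f z - 1| |2 * g z - 1|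
  have hmc : Continuous m := by fun_prop
  have hside : ∀ z, m z = 1 → ∃ t ∈ F, z ∈ t.carrier := by
    intro z hz
    have hle1 : |2 * f z - 1| ≤ 1 := (le_max_left _ _).trans hz.le
    have hle2 : |2 * g z - 1| ≤ 1 := (le_max_right _ _).trans hz.le
    have hmem : ∀ B ∈ Seg.carrier '' F, z ∈ B → ∃ t ∈ F, z ∈ t.carrier := by
      rintro _ ⟨t, ht, rfl⟩ hzt
      exact ⟨t, ht, hzt⟩
    rw [hcar] at hmem
    rw [abs_le] at hle1 hle2
    have hz' := hrep z
    rcases max_choice |2 * f z - 1| |2 * g z - 1| with h | h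
    · have h1 : |2 * f z - 1| = 1 := h.symm.trans hz
      rcases (abs_eq one_pos.le).1 h1 with h2 | h2
      · have hf : f z = 1 := by linarith
        refine hmem (segment ℝ (o + u) (o + u + v)) (by simp)
          ⟨1 - g z, g z, by linarith, by linarith, by ring, ?_⟩
        rw [hf] at hz'
        nth_rw 3 [hz']
        module
      · have hf : f z = 0 := by linarith
        refine hmem (segment ℝ (o + v) o) (by simp)
          ⟨g z, 1 - g z, by linarith, by linarith, by ring, ?_⟩
        rw [hf] at hz'
        nth_rw 3 [hz']
        module
    · have h1 : |2 * g z - 1| = 1 := h.symm.trans hz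
      rcases (abs_eq one_pos.le).1 h1 with h2 | h2
      · have hf : g z = 1 := by linarith
        refine hmem (segment ℝ (o + u + v) (o + v)) (by simp)
          ⟨f z, 1 - f z, by linarith, by linarith, by ring, ?_⟩
        rw [hf] at hz'
        nth_rw 3 [hz']
        module
      · have hf : g z = 0 := by linarith
        refine hmem (segment ℝ o (o + u)) (by simp)
          ⟨1 - f z, f z, by linarith, by linarith, by ring, ?_⟩
        rw [hf] at hz'
        nth_rw 3 [hz']
        module
  have hhull : convexHull ℝ {o, o + u, o + u + v, o + v} ⊆
      {z | (0 ≤ f z ∧ f z ≤ 1) ∧ 0 ≤ g z ∧ g z ≤ 1} := by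
    refine convexHull_min ?_ ?_
    · have h1 := hfg 0 0
      have h2 := hfg 1 0
      have h3 := hfg 1 1
      have h4 := hfg 0 1
      simp only [zero_smul, one_smul, add_zero] at h1 h2 h3 h4
      rintro z (rfl | rfl | rfl | rfl)
      · simp [h1]
      · simp [h2]
      · simp [h3]
      · simp [h4]
    · intro y hy z hz a b ha hb hab
      obtain ⟨⟨k1, k2⟩, k3, k4⟩ := hy
      obtain ⟨⟨l1, l2⟩, l3, l4⟩ := hz
      simp only [mem_ofPred, hfa _ _ _ _ hab, hga _ _ _ _ hab]
      obtain rfl : a = 1 - b := by linarith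
      exact ⟨⟨by positivity, by nlinarith⟩, by positivity, by nlinarith⟩
  have hms : ∀ z ∈ s.carrier, m z < 1 := by
    intro z hz
    obtain ⟨⟨h1, h2⟩, h3, h4⟩ := hhull (interior_subset (hint s hs hz))
    refine lt_of_le_of_ne (max_le ?_ ?_) fun h => ?_
    · rw [abs_le]; constructor <;> linarith
    · rw [abs_le]; constructor <;> linarith
    · obtain ⟨t, ht, hzt⟩ := hside z h
      exact Set.disjoint_left.1 (hsdisj t (hFS ht) (by rintro rfl; exact hs.2 ht)) hz hzt
  -- A line of sight that left the rectangle would meet a side of the frame.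
  have hmx : m x ≤ 1 := by
    by_contra! hcon
    have hc : Continuous fun c : ℝ => m ((1 - c) • p' + c • x) := by fun_prop
    obtain ⟨c, hc1, hc2⟩ := intermediate_value_Ioo one_pos.le hc.continuousOn
      (show (1 : ℝ) ∈ Ioo _ _ from ⟨by simpa using hms p' hp', by simpa using hcon⟩)
    obtain ⟨t, ht, hzt⟩ := hside _ hc2
    rcases hsee with rfl | hA
    · exact absurd (hms _ hp') (not_lt.2 hcon.le)
    · exact hA.notMem (hFS ht) ⟨1 - c, c, by linarith [hc1.2], hc1.1, by ring, rfl⟩ hzt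
  obtain ⟨K, hK, hmK⟩ : ∃ K : ℝ, 1 ≤ K ∧ 1 ≤ m (p + K • (x - p)) := by
    have heq : ∀ K : ℝ, p + K • (x - p) = (1 - K) • p + K • x := fun K => by module
    have key : ∀ c d : ℝ, c ≠ d → |2 * c - 1| < 1 →
        ∃ K : ℝ, 1 ≤ K ∧ 1 ≤ |2 * ((1 - K) * c + K * d) - 1| := by
      intro c d hcd hc
      -- Then `K * |d - c| ≥ 1`, so the moving term has absolute value at least `2` and outweighs
      -- `|1 - 2 * c| < 1`.
      refine ⟨max 1 (1 / |d - c|), le_max_left _ _, ?_⟩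
      have hdc : 0 < |d - c| := abs_pos.2 (sub_ne_zero.2 hcd.symm)
      set K := max 1 (1 / |d - c|) with hKdef
      have hK1 : 1 ≤ K * |d - c| := by
        rw [← div_le_iff₀ hdc]
        exact le_max_right _ _
      have hK0 : 0 ≤ K := zero_le_one.trans (le_max_left _ _)
      have h1 : 2 * ((1 - K) * c + K * d) - 1 = 2 * K * (d - c) - (1 - 2 * c) := by ring
      have h2 : |2 * K * (d - c)| = 2 * (K * |d - c|) := by
        rw [abs_mul, abs_of_nonneg (by positivity : (0 : ℝ) ≤ 2 * K)]
        ring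
      have h3 := abs_sub_abs_le_abs_sub (2 * K * (d - c)) (1 - 2 * c)
      rw [h1]
      rw [abs_sub_comm] at hc
      linarith
    have hmp := hms p hp
    by_cases hf : f p = f x
    · have hg : g p ≠ g x := fun hg => hxp (by rw [hrep x, ← hf, ← hg, ← hrep p])
      obtain ⟨K, hK, h⟩ := key _ _ hg ((le_max_right _ _).trans_lt hmp)
      refine ⟨K, hK, h.trans ?_⟩
      rw [heq, ← hga (1 - K) K p x (by ring)]
      exact le_max_right _ _
    · obtain ⟨K, hK, h⟩ := key _ _ hf ((le_max_left _ _).trans_lt hmp)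
      refine ⟨K, hK, h.trans ?_⟩
      rw [heq, ← hfa (1 - K) K p x (by ring)]
      exact le_max_left _ _
  have hc : Continuous fun c : ℝ => m (p + c • (x - p)) := by fun_prop
  obtain ⟨κ, hκ, hmκ⟩ := intermediate_value_Icc hK hc.continuousOn
    (show (1 : ℝ) ∈ Icc _ _ from ⟨by simpa using hmx, hmK⟩)
  obtain ⟨t, ht, hzt⟩ := hside _ hmκ
  exact ⟨κ, hκ.1, t, hFS ht, hzt⟩

theorem scene_of_frame (hfin : S.Finite)
    (hdisj : S.Pairwise fun t t' => Disjoint t.inner t'.inner)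
    (hF : IsBoundingFrame S F) (hs : s ∈ S \ F)
    (hsdisj : ∀ t ∈ S, t ≠ s → Disjoint s.carrier t.carrier) {σ : ℝ} (hσ : σ ≠ 0) :
    Scene S s σ where
  side_ne_zero := hσ
  finite := hfin
  inner_disjoint := hdisj
  mem := hs.1
  isolated := hsdisj
  exists_beyond p hp p' hp' x hx hsee :=
    exists_beyond_of_frame hF hs hsdisj hp hp'
      (by rintro rfl; exact (show 0 < height s σ x from hx).ne' (height_eq_zero hp)) hsee

end

end Visibility

/-! ### Both sides together -/

open Visibility in
theorem mainTheorem2 (S F : Set Seg) (hfin : S.Finite)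
    (hdisj : S.Pairwise fun t t' => Disjoint t.inner t'.inner)
    (hF : IsBoundingFrame S F) (s : Seg) (hs : s ∈ S \ F)
    (hsdisj : ∀ t ∈ S, t ≠ s → Disjoint s.carrier t.carrier) :
    ((upperCover S s).Finite ∧ (lowerCover S s).Finite ∧ ∀ T ∈ cover S s, IsTriangle T) ∧
    (⋃₀ upperCover S s = closure (upperRegion S s) ∧
      ∀ T ∈ upperCover S s, interior T ⊆ upperRegion S s) ∧
    (⋃₀ lowerCover S s = closure (lowerRegion S s) ∧
      ∀ T ∈ lowerCover S s, interior T ⊆ lowerRegion S s) ∧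
    ⋃₀ cover S s = closure (region S s) ∧
    (NoAlignment S s →
      (upperCover S s).ncard ≤ (incidentEdges S s).ncard ∧
      (lowerCover S s).ncard ≤ (incidentEdges S s).ncard) := by
  have hU : Scene S s 1 := scene_of_frame hfin hdisj hF hs hsdisj one_ne_zero
  have hL : Scene S s (-1) := scene_of_frame hfin hdisj hF hs hsdisj (by norm_num)
  have hup : region S s ∩ {x | 0 ≤ height s 1 x} = upperRegion S s := by
    simp only [height, one_mul]
    rfl
  -- The lower region excludes the supporting line, so it is the open version of the region for `σ =
  -- -1`, whereas the upper region is the closed version for `σ = 1`.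
  have hlow : openRegion S s (-1) = lowerRegion S s := by
    ext x
    constructor
    · rintro ⟨h1, p, hp, hpx⟩
      refine ⟨mem_iUnion₂.2 ⟨p, hp, hpx⟩, fun h => ?_⟩
      have h2 : 0 ≤ cross s.left s.right x := h.2
      have h3 : 0 < -1 * cross s.left s.right x := h1
      linarith
    · rintro ⟨h1, h2⟩
      obtain ⟨p, hp, hpx⟩ := mem_iUnion₂.1 h1
      have h3 : cross s.left s.right x < 0 := not_le.1 fun h => h2 ⟨h1, h⟩
      exact ⟨show 0 < -1 * cross s.left s.right x by linarith, p, hp, hpx⟩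
  have hupper : ⋃₀ upperCover S s = closure (upperRegion S s) := hup ▸ (sUnion_sideCover hU).1
  have hlower : ⋃₀ lowerCover S s = closure (lowerRegion S s) := hlow ▸ (sUnion_sideCover hL).2
  refine ⟨⟨sideCover_finite hU, sideCover_finite hL, ?_⟩, ⟨hupper, ?_⟩, ⟨hlower, ?_⟩, ?_,
    fun hn => ⟨ncard_sideCover_le hU hn, ncard_sideCover_le hL hn⟩⟩
  · rintro T (hT | hT)
    · exact isTriangle_of_mem hU hT
    · exact isTriangle_of_mem hL hT
  · intro T hT
    refine (interior_subset_of_mem hU hT).trans ?_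
    rw [← hup]
    rintro x ⟨hx, p, hp, hpx⟩
    exact ⟨mem_iUnion₂.2 ⟨p, hp, hpx⟩, le_of_lt hx⟩
  · intro T hT
    exact hlow ▸ interior_subset_of_mem hL hT
  · rw [cover, sUnion_union, hupper, hlower, ← closure_union, lowerRegion, union_sdiff_cancel]
    exact inter_subset_left
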